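/- Let $n\ge 1$ and let $X\subset\mathbb{C}^n$ be either a bounded complete Reinhardt domain centered at the origin with $C^2$-smooth boundary, with $\Gamma_X=\partial X$ and $d=2n-1$, or the polydisc $\mathbb{D}^n$, with $\Gamma_X=\mathbb{T}^n$ and $d=n$. Let $G$ be a finite subgroup of the unitary group $U(n)$ that preserves $X$ and $\Gamma_X$, let $\Omega\subset\mathbb{C}^n$ be a bounded domain, and let $\Phi:X\to\Omega$ be a proper surjective holomorphic map that extends smoothly to $\overline X$ and whose fibres in $X$ are exactly the $G$-orbits, so that $\Omega\cong X/G$. Assume also that, for almost every $\zeta\in\Gamma_X$, every $\xi\in\Gamma_X$ with $\Phi(\xi)=\Phi(\zeta)$ lies in the $G$-orbit of $\zeta$. Put $\Gamma_\Omega=\Phi(\Gamma_X)$, and let $\sigma$ and $m$ be the induced ($d$-dimensional) Lebesgue measures on $\Gamma_X$ and $\Gamma_\Omega$, that is, the restrictions of the $d$-dimensional Hausdorff measure normalised to agree with Lebesgue measure on $\mathbb{R}^d$. Let $w\ge 0$ be a $G$-invariant measurable function on $\Gamma_X$ which is the density of the pullback of $m$, i.e. $$\frac1{|G|}\int_{\Gamma_X\cap\Phi^{-1}(E)}w\,d\sigma=m(E)\qquad\text{for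 every Borel set }E\subset\mathbb{C}^n ,$$ and assume that $(X,\Omega,\Phi,G)$ is admissible: there is a zero-free $G$-invariant holomorphic function $g$ on $X$ such that, for almost every $\zeta\in\Gamma_X$, the limit $g^*(\zeta)=\lim_{r\to1^-}g(r\zeta)$ exists and $|g^*(\zeta)|^2=w(\zeta)$. Fix such a $g$. For $0<p<\infty$ let $H^p(\Omega)$ be the space of holomorphic functions $f$ on $\Omega$ with $$\|f\|_{p,\Omega}^p=\frac1{|G|}\sup_{0<r<1}\int_{\Gamma_X}|(f\circ\Phi)(rz)|^p\,|g(rz)|^2\,d\sigma(z)<\infty .$$ Then for every $0<p<\infty$: 1. For every $f\in H^p(\Omega)$ the boundary limit $(f\circ\Phi)^*(\zeta)=\lim_{r\to1^-}(f\circ\Phi)(r\zeta)$ exists for almost every $\zeta\in\Gamma_X$, and there is a function $f^*\in L^p(\Gamma_\Omega)=L^p(\Gamma_\Omega,m)$, unique up to $m$-null sets among measurable functions on $\Gamma_\Omega$, with $f^*(\Phi(\zeta))=(f\circ\Phi)^*(\zeta)$ for almost every $\zeta\in\Gamma_X$. 2. The map $f\mapsto f^*$ is linear, its image is a closed subspace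 of $L^p(\Gamma_\Omega)$, and it is a quasi-isometry onto its image: there is a constant $C$ independent of $f$ with $\|f^*\|_{L^p(\Gamma_\Omega)}\le C\|f\|_{p,\Omega}$ and $\|f\|_{p,\Omega}\le C\|f^*\|_{L^p(\Gamma_\Omega)}$ for all $f\in H^p(\Omega)$. 3. If $X=\mathbb{D}^n$ or $X=\mathbb{B}^n$ (the unit ball), the map is an isometry: $\|f^*\|_{L^p(\Gamma_\Omega)}=\|f\|_{p,\Omega}$ for all $f\in H^p(\Omega)$. -/

import Mathlib

open Set Filter Topology MeasureTheory
open scoped ENNReal NNReal ContDiff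

noncomputable section

/-- `ℂⁿ` with its Euclidean (Hermitian) norm. -/
abbrev Cn (n : ℕ) : Type := EuclideanSpace ℂ (Fin n)

/-- The open unit polydisc `𝔻ⁿ`. -/
def polydisc (n : ℕ) : Set (Cn n) := {z | ∀ i, ‖z i‖ < 1}

/-- The distinguished boundary `𝕋ⁿ` of the polydisc. -/
def torus (n : ℕ) : Set (Cn n) := {z | ∀ i, ‖z i‖ = 1}

/-- Complete Reinhardt (centered at the origin): with `z`, the set contains every point whose
coordinates are bounded in modulus by those of `z`. -/
def IsCompleteReinhardt {n : ℕ} (X : Set (Cn n)) : Prop :=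
  ∀ z ∈ X, ∀ w : Cn n, (∀ i, ‖w i‖ ≤ ‖z i‖) → w ∈ X

/-- The boundary of `X` is `C²`-smooth: near each boundary point `X` is the negativity set of a
real `C²` function with non-vanishing differential at that point. -/
def HasC2Boundary {n : ℕ} (X : Set (Cn n)) : Prop :=
  ∀ ζ ∈ frontier X, ∃ (U : Set (Cn n)) (ρ : Cn n → ℝ), IsOpen U ∧ ζ ∈ U ∧
    ContDiffOn ℝ 2 ρ U ∧ fderiv ℝ ρ ζ ≠ 0 ∧ X ∩ U = {z ∈ U | ρ z < 0}

/-- The model domains `X`, with the part `Γ` of the boundary on which boundary values are taken,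
and the real dimension `d` of `Γ`: either a bounded complete Reinhardt domain with `C²` boundary
and `Γ = ∂X`, or the polydisc with `Γ = 𝕋ⁿ`. -/
def IsModelDomain {n : ℕ} (X Γ : Set (Cn n)) (d : ℕ) : Prop :=
  (IsOpen X ∧ X.Nonempty ∧ Bornology.IsBounded X ∧ IsCompleteReinhardt X ∧ HasC2Boundary X ∧
      Γ = frontier X ∧ d = 2 * n - 1) ∨
    (X = polydisc n ∧ Γ = torus n ∧ d = n)

/-- A quotient domain `Ω` of a model domain `X ⊆ ℂⁿ` by a finite subgroup `G` of `U(n)`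
(the group of complex-linear isometries of `ℂⁿ`). -/
structure QuotientQuadruple (n : ℕ) where
  X : Set (Cn n)
  /-- the part `Γ_X` of the boundary of `X` -/
  Γ : Set (Cn n)
  /-- the real dimension of `Γ_X` -/
  d : ℕ
  Ω : Set (Cn n)
  /-- the quotient map `X → Ω`, extended to the closure of `X`; values off the closure are
  irrelevant -/
  Φ : Cn n → Cn n
  G : Subgroup (Cn n ≃ₗᵢ[ℂ] Cn n)
  n_pos : 0 < n
  model : IsModelDomain X Γ d
  isOpen_Ω : IsOpen Ω
  isConnected_Ω : IsConnected Ω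
  isBounded_Ω : Bornology.IsBounded Ω
  holomorphic : DifferentiableOn ℂ Φ X
  smooth : ContDiffOn ℝ ∞ Φ (closure X)
  mapsTo : MapsTo Φ X Ω
  proper : IsProperMap mapsTo.restrict
  surjective : Φ '' X = Ω
  finite : Finite G
  G_X : ∀ τ ∈ G, ∀ z ∈ X, τ z ∈ X
  G_Γ : ∀ τ ∈ G, ∀ ζ ∈ Γ, τ ζ ∈ Γ
  /-- the fibres of `Φ` in `X` are the `G`-orbits, so that `Φ` induces a homeomorphism
  `X / G ≃ Ω` -/
  fibre : ∀ z ∈ X, ∀ z' ∈ X, Φ z = Φ z' ↔ ∃ τ ∈ G, τ z = z'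
  /-- for almost every `ζ ∈ Γ_X` the fibre of `Φ` in `Γ_X` through `ζ` is the `G`-orbit of `ζ`,
  so that `Γ_Ω` is `Γ_X / G` up to null sets -/
  boundary_fibre : ∀ᵐ ζ ∂((μHE[d] : Measure (Cn n)).restrict Γ),
    ∀ ξ ∈ Γ, Φ ξ = Φ ζ → ∃ τ ∈ G, τ ζ = ξ

namespace QuotientQuadruple

variable {n : ℕ} (Q : QuotientQuadruple n)

/-- The induced Lebesgue measure on `Γ_X`, as a measure on `ℂⁿ`: normalised `d`-dimensional
Hausdorff measure. -/
def σ : Measure (Cn n) := (μHE[Q.d] : Measure (Cn n)).restrict Q.Γ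

/-- The induced boundary `Γ_Ω = Φ(Γ_X)`. -/
def ΓΩ : Set (Cn n) := Q.Φ '' Q.Γ

/-- The induced Lebesgue measure on `Γ_Ω`. -/
def m : Measure (Cn n) := (μHE[Q.d] : Measure (Cn n)).restrict Q.ΓΩ

/-- `w` is a `G`-invariant density on `Γ_X`, with respect to `σ`, of the pullback under `Φ` of the
induced Lebesgue measure on `Γ_Ω`. -/
structure IsPullbackDensity (w : Cn n → ℝ) : Prop where
  measurable : Measurable w
  nonneg : ∀ ζ ∈ Q.Γ, 0 ≤ w ζ
  invariant : ∀ τ ∈ Q.G, ∀ ζ ∈ Q.Γ, w (τ ζ) = w ζ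
  change_of_variables : ∀ E : Set (Cn n), MeasurableSet E →
    (Nat.card Q.G : ℝ≥0∞)⁻¹ * ∫⁻ ζ in Q.Γ ∩ Q.Φ ⁻¹' E, ENNReal.ofReal (w ζ) ∂Q.σ = Q.m E

/-- `g` is a zero-free `G`-invariant holomorphic function on `X` whose radial limit `g*` exists
and satisfies `|g*|² = w` almost everywhere on `Γ_X`, where `w` is the density of the pullback of
the induced Lebesgue measure on `Γ_Ω`. The quadruple is admissible if such a `g` exists. -/
structure IsAdmissible (g : Cn n → ℂ) : Prop where
  holomorphic : DifferentiableOn ℂ g Q.X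
  ne_zero : ∀ z ∈ Q.X, g z ≠ 0
  invariant : ∀ τ ∈ Q.G, ∀ z ∈ Q.X, g (τ z) = g z
  boundary : ∃ w : Cn n → ℝ, Q.IsPullbackDensity w ∧
    ∀ᵐ ζ ∂Q.σ, ∃ c : ℂ, Tendsto (fun r : ℝ => g (r • ζ)) (𝓝[<] 1) (𝓝 c) ∧ ‖c‖ ^ 2 = w ζ

/-- `∫_{Γ_X} |(f ∘ Φ)(rz)|^p |g(rz)|² dσ(z)`. -/
def hardyIntegral (g : Cn n → ℂ) (p : ℝ) (f : Cn n → ℂ) (r : ℝ) : ℝ≥0∞ :=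
  ∫⁻ z, ‖f (Q.Φ (r • z))‖ₑ ^ p * ‖g (r • z)‖ₑ ^ 2 ∂Q.σ

/-- The Hardy (quasi-)norm `‖f‖_{p, Ω}`. -/
def hardyNorm (g : Cn n → ℂ) (p : ℝ) (f : Cn n → ℂ) : ℝ≥0∞ :=
  ((Nat.card Q.G : ℝ≥0∞)⁻¹ * ⨆ r ∈ Ioo (0 : ℝ) 1, Q.hardyIntegral g p f r) ^ (1 / p)

variable {Q}

theorem smul_mem {r : ℝ} (hr : r ∈ Ioo (0 : ℝ) 1) {z : Cn n} (hz : z ∈ Q.Γ) : r • z ∈ Q.X := by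
  rcases Q.model with ⟨_, _, _, hR, _, hΓ, _⟩ | ⟨hX, hΓ, _⟩
  · rw [hΓ] at hz
    have hfr := mem_closure_iff_frequently.1 (frontier_subset_closure hz)
    have hev : ∀ᶠ w in 𝓝 z, ∀ i, ‖(r • z) i‖ ≤ ‖w i‖ := by
      rw [eventually_all]
      intro i
      have hn : ‖(r • z) i‖ = r * ‖z i‖ := by simp [abs_of_pos hr.1]
      rw [hn]
      by_cases h0 : z i = 0
      · simp [h0]
      · have hlt : r * ‖z i‖ < ‖z i‖ := by
          have := norm_pos_iff.2 h0
          nlinarith [hr.2]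
        have hc : Continuous fun w : Cn n => ‖w i‖ := by fun_prop
        exact (hc.continuousAt.eventually (lt_mem_nhds hlt)).mono fun _ h => le_of_lt h
    obtain ⟨w, hwX, hw⟩ := (hfr.and_eventually hev).exists
    exact hR w hwX _ hw
  · rw [hΓ] at hz
    rw [hX]
    intro i
    have hn : ‖(r • z) i‖ = r * ‖z i‖ := by simp [abs_of_pos hr.1]
    rw [hn, hz i, mul_one]
    exact hr.2

theorem isClosed_Γ : IsClosed Q.Γ := by
  rcases Q.model with ⟨_, _, _, _, _, hΓ, _⟩ | ⟨_, hΓ, _⟩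
  · rw [hΓ]; exact isClosed_frontier
  · rw [hΓ]
    have : torus n = ⋂ i, {z : Cn n | ‖z i‖ = 1} := by ext; simp [torus]
    rw [this]
    exact isClosed_iInter fun i => isClosed_eq (by fun_prop) continuous_const

theorem aemeasurable_integrand {g : Cn n → ℂ} (hg : Q.IsAdmissible g) {p : ℝ}
    {f : Cn n → ℂ} (hf : DifferentiableOn ℂ f Q.Ω) {r : ℝ} (hr : r ∈ Ioo (0 : ℝ) 1) :
    AEMeasurable (fun z => ‖f (Q.Φ (r • z))‖ₑ ^ p * ‖g (r • z)‖ₑ ^ 2) Q.σ := by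
  have hs : MapsTo (fun z : Cn n => r • z) Q.Γ Q.X := fun z hz => smul_mem hr hz
  have hsc : ContinuousOn (fun z : Cn n => r • z) Q.Γ := by fun_prop
  have h1 : ContinuousOn (fun z : Cn n => f (Q.Φ (r • z))) Q.Γ :=
    (hf.continuousOn.comp Q.holomorphic.continuousOn Q.mapsTo).comp hsc hs
  have h2 : ContinuousOn (fun z : Cn n => g (r • z)) Q.Γ :=
    hg.holomorphic.continuousOn.comp hsc hs
  have m1 : AEMeasurable (fun z : Cn n => f (Q.Φ (r • z))) Q.σ :=
    h1.aemeasurable isClosed_Γ.measurableSet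
  have m2 : AEMeasurable (fun z : Cn n => g (r • z)) Q.σ :=
    h2.aemeasurable isClosed_Γ.measurableSet
  exact (m1.enorm.pow_const p).mul (m2.enorm.pow_const 2)

theorem hardyNorm_lt_top_iff {g : Cn n → ℂ} {p : ℝ} (hp : 0 < p) {f : Cn n → ℂ} :
    Q.hardyNorm g p f < (⊤ : ℝ≥0∞) ↔ ⨆ r ∈ Ioo (0 : ℝ) 1, Q.hardyIntegral g p f r < (⊤ : ℝ≥0∞) := by
  have := Q.finite
  have hc : (Nat.card Q.G : ℝ≥0∞) ≠ 0 := by exact_mod_cast Nat.card_pos.ne'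
  unfold hardyNorm
  rw [ENNReal.rpow_lt_top_iff_of_pos (by positivity)]
  constructor
  · intro h
    by_contra h'
    rw [not_lt, top_le_iff] at h'
    rw [h', ENNReal.mul_top (by simp)] at h
    exact lt_irrefl _ h
  · intro h
    exact ENNReal.mul_lt_top (by simp) h

/-- The Hardy space `H^p(Ω)`. A function on `Ω` is represented by its extension by zero to `ℂⁿ`. -/
def hardySpace (Q : QuotientQuadruple n) {g : Cn n → ℂ} (hg : Q.IsAdmissible g) {p : ℝ}
    (hp : 0 < p) : Submodule ℂ (Cn n → ℂ) where
  carrier := {f | DifferentiableOn ℂ f Q.Ω ∧ (∀ z ∉ Q.Ω, f z = 0) ∧ Q.hardyNorm g p f < (⊤ : ℝ≥0∞)}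
  zero_mem' := by
    refine ⟨differentiableOn_const 0, fun _ _ => rfl, ?_⟩
    rw [hardyNorm_lt_top_iff hp]
    simp [hardyIntegral, ENNReal.zero_rpow_of_pos hp]
  add_mem' := by
    rintro a b ⟨ha, ha0, han⟩ ⟨hb, hb0, hbn⟩
    refine ⟨ha.add hb, fun z hz => by simp [ha0 z hz, hb0 z hz], ?_⟩
    rw [hardyNorm_lt_top_iff hp] at *
    have key : ∀ x y : ℝ≥0∞, (x + y) ^ p ≤ 2 ^ p * (x ^ p + y ^ p) := by
      intro x y
      have h1 : x + y ≤ 2 * max x y := by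
        rw [two_mul]; exact add_le_add (le_max_left _ _) (le_max_right _ _)
      calc (x + y) ^ p ≤ (2 * max x y) ^ p := ENNReal.rpow_le_rpow h1 hp.le
        _ = 2 ^ p * (max x y) ^ p := ENNReal.mul_rpow_of_nonneg _ _ hp.le
        _ ≤ 2 ^ p * (x ^ p + y ^ p) := by
          gcongr
          rcases max_cases x y with h | h <;> rw [h.1]
          · exact le_self_add
          · exact le_add_self
    refine lt_of_le_of_lt (iSup₂_le (a := 2 ^ p * ((⨆ r ∈ Ioo (0 : ℝ) 1, Q.hardyIntegral g p a r) +
      ⨆ r ∈ Ioo (0 : ℝ) 1, Q.hardyIntegral g p b r)) ?_) (ENNReal.mul_lt_top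
        (ENNReal.rpow_lt_top_of_nonneg hp.le (by simp)) (ENNReal.add_lt_top.2 ⟨han, hbn⟩))
    intro r hr
    calc Q.hardyIntegral g p (a + b) r
        ≤ ∫⁻ z, 2 ^ p * (‖a (Q.Φ (r • z))‖ₑ ^ p * ‖g (r • z)‖ₑ ^ 2 +
            ‖b (Q.Φ (r • z))‖ₑ ^ p * ‖g (r • z)‖ₑ ^ 2) ∂Q.σ := by
          refine lintegral_mono fun z => ?_
          dsimp only
          rw [← add_mul, ← mul_assoc]
          gcongr
          exact (ENNReal.rpow_le_rpow (enorm_add_le _ _) hp.le).trans (key _ _)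
      _ = 2 ^ p * (Q.hardyIntegral g p a r + Q.hardyIntegral g p b r) := by
          rw [lintegral_const_mul' _ _ (ENNReal.rpow_ne_top_of_nonneg hp.le (by simp)),
            lintegral_add_left' (aemeasurable_integrand hg ha hr)]
          rfl
      _ ≤ _ := by
          gcongr
          · exact le_iSup₂ (f := fun r (_ : r ∈ Ioo (0 : ℝ) 1) => Q.hardyIntegral g p a r) r hr
          · exact le_iSup₂ (f := fun r (_ : r ∈ Ioo (0 : ℝ) 1) => Q.hardyIntegral g p b r) r hr
  smul_mem' := by
    rintro c a ⟨ha, ha0, han⟩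
    refine ⟨ha.const_smul c, fun z hz => by simp [ha0 z hz], ?_⟩
    rw [hardyNorm_lt_top_iff hp] at *
    have h : ∀ r, Q.hardyIntegral g p (c • a) r = ‖c‖ₑ ^ p * Q.hardyIntegral g p a r := by
      intro r
      unfold hardyIntegral
      rw [← lintegral_const_mul' _ _ (ENNReal.rpow_ne_top_of_nonneg hp.le (by simp))]
      refine lintegral_congr fun z => ?_
      rw [Pi.smul_apply, enorm_smul, ENNReal.mul_rpow_of_nonneg _ _ hp.le, mul_assoc]
    simp only [h, ← ENNReal.mul_iSup]
    exact ENNReal.mul_lt_top (ENNReal.rpow_lt_top_of_nonneg hp.le (by simp)) han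

end QuotientQuadruple

end

/-! The problem is reduced to one variable by slicing. For `ζ ∈ Γ_X` the disc `w ↦ w ζ` lies in `X`,
and `σ` is invariant under `ζ ↦ e^{iθ} ζ`, so an integral over `Γ_X` equals the integral over `ζ` of
the mean over the circle through `ζ` (`lintegral_rot`). On a slice write `h` for `f ∘ Φ`. Since `g`
is zero-free, `k = h g^{2/p}` is holomorphic with `|k|^p = |h|^p |g|^2` (`exists_weighted_root`),
and for almost every slice `k` belongs to the classical Hardy space of the disc. There the radial
limits exist and the means increase to the `p`-integral of the limit
(`iSup_lintegral_circleMap_eq`). Monotone convergence over the slices gives an exact identity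
between `hardyNorm` and the boundary integral (`ae_tendsto_radial_and_iSup_eq`), so the boundary map
is isometric for every model domain.

The disc theory rests on Fatou's theorem for bounded functions, obtained by differentiating a
Lipschitz primitive. For `H^p`, a harmonic majorant `Re F` of `|k|^p` presents `k` as the quotient
of the bounded functions `k e^{-F/p}` and `e^{-F/p}`; the denominator has nonzero limits almost
everywhere (`ae_radial_limit_ne_zero`).

To recover `h` from `k`, the limit of `g` must be nonzero, that is, `w` must be positive almost
everywhere. The Jacobian determinant of `Φ` is bounded because `Φ` is smooth up to the boundary, and
it is not identically zero because `Φ(X)` is open and nonempty. Hence it has nonzero radial limits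
on almost every slice. Where it does, the boundary derivative of `Φ` is invertible and `Φ` cannot
contract `Γ_X` too much, so a set of positive measure on which `w` vanishes cannot have a null image
(`ae_ne_zero_of_isPullbackDensity`). The same fact shows that `m` and the image of `σ` have the same
null sets, which makes `f*` unique.

Since `f ∘ Φ` is `G`-invariant and almost all boundary fibres are orbits, the limit descends to a
Borel function on `Γ_Ω` (`exists_boundary_value`). For closedness of the image, point evaluations
are bounded on compact sets (`exists_enorm_rpow_le`), so the Hardy space is complete
(`exists_hardySpace_limit`), and an isometric image of a complete space is closed. -/

/-! ### Subharmonic functions on the disc: maximum principle and Poisson majorisation. -/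

/-- The sub-mean value property on all sufficiently small circles. -/
def LocallySubmean (v : ℂ → ℝ) (U : Set ℂ) : Prop :=
  ∀ z ∈ U, ∀ᶠ r in 𝓝[>] (0 : ℝ), v z ≤ Real.circleAverage v z r

theorem eventually_pos_and_closedBall_subset {z : ℂ} {U : Set ℂ} (hU : IsOpen U) (hz : z ∈ U) :
    ∀ᶠ r in 𝓝[>] (0 : ℝ), 0 < r ∧ Metric.closedBall z r ⊆ U := by
  obtain ⟨δ, hδ, hs⟩ := Metric.isOpen_iff.1 hU z hz
  filter_upwards [Ioo_mem_nhdsGT hδ] with r hr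
  exact ⟨hr.1, (Metric.closedBall_subset_ball hr.2).trans hs⟩

theorem ContinuousOn.circleIntegrable_closedBall {E : Type*} [NormedAddCommGroup E]
    {f : ℂ → E} {z : ℂ} {r : ℝ} (hr : 0 ≤ r) (hf : ContinuousOn f (Metric.closedBall z r)) :
    CircleIntegrable f z r :=
  (hf.mono Metric.sphere_subset_closedBall).circleIntegrable hr

theorem circleAverage_re_of_differentiable {P : ℂ → ℂ} (hP : Differentiable ℂ P) (z : ℂ) (r : ℝ) :
    Real.circleAverage (fun w => (P w).re) z r = (P z).re := by
  have h := Complex.reCLM.circleAverage_comp_comm (f := P) (c := z) (R := r)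
    (hP.continuous.continuousOn.circleIntegrable')
  rw [(hP.diffContOnCl).circleAverage] at h
  exact h

theorem circleAverage_norm_sq (z : ℂ) (r : ℝ) :
    Real.circleAverage (fun w => ‖w‖ ^ 2) z r = ‖z‖ ^ 2 + r ^ 2 := by
  -- On the circle, `|w|^2 = |z|^2 + 2 Re (conj z (w - z)) + r^2`, the real part of an affine
  -- function.
  set P : ℂ → ℂ := fun w => (‖z‖ ^ 2 + r ^ 2 : ℝ) + 2 * (starRingEnd ℂ z) * (w - z) with hP
  have h1 := circleAverage_re_of_differentiable (P := P) (by fun_prop) z r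
  have h2 : (P z).re = ‖z‖ ^ 2 + r ^ 2 := by
    simp only [hP, sub_self, mul_zero, add_zero, Complex.ofReal_re]
  rw [← h2, ← h1]
  refine Real.circleAverage_congr_sphere fun w hw => ?_
  have hw' : ‖w - z‖ ^ 2 = r ^ 2 := by
    rw [mem_sphere_iff_norm] at hw; rw [hw, sq_abs]
  simp only [hP, Complex.add_re, Complex.ofReal_re]
  rw [← hw', ← Complex.normSq_eq_norm_sq, ← Complex.normSq_eq_norm_sq, ← Complex.normSq_eq_norm_sq]
  simp [Complex.normSq_apply]
  ring

/-- Adding `δ |w|^2` makes the sub-mean inequality strict, so a maximum cannot be interior. The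
choice of `δ` keeps the added term below `ε` on the disc. -/
theorem LocallySubmean.le_of_le_sphere {v : ℂ → ℝ} {R M : ℝ}
    (hc : ContinuousOn v (Metric.closedBall 0 R)) (hv : LocallySubmean v (Metric.ball 0 R))
    (h : ∀ z ∈ Metric.sphere (0 : ℂ) R, v z ≤ M) :
    ∀ z ∈ Metric.closedBall (0 : ℂ) R, v z ≤ M := by
  intro z hz
  refine le_of_forall_pos_le_add fun ε hε => ?_
  set δ : ℝ := ε / (R ^ 2 + 1) with hδ
  have hδ0 : 0 < δ := by positivity
  have hδR : δ * R ^ 2 ≤ ε := by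
    rw [hδ, div_mul_eq_mul_div, div_le_iff₀ (by positivity)]; nlinarith
  set u : ℂ → ℝ := fun w => v w + δ * ‖w‖ ^ 2 with hu
  have huc : ContinuousOn u (Metric.closedBall 0 R) := by fun_prop
  obtain ⟨x, hx, hmax⟩ := (isCompact_closedBall (0 : ℂ) R).exists_isMaxOn ⟨z, hz⟩ huc
  have hxR : x ∈ Metric.sphere (0 : ℂ) R := by
    by_contra hxs
    have hxb : x ∈ Metric.ball (0 : ℂ) R := by
      rw [mem_closedBall_zero_iff] at hx
      rw [mem_sphere_zero_iff_norm] at hxs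
      rw [mem_ball_zero_iff]
      exact lt_of_le_of_ne hx hxs
    obtain ⟨r, h1, hr0, hrs⟩ := ((hv x hxb).and
      (eventually_pos_and_closedBall_subset Metric.isOpen_ball hxb)).exists
    have hrs' := hrs.trans Metric.ball_subset_closedBall
    have hvi := (hc.mono hrs').circleIntegrable_closedBall hr0.le
    have hsq : CircleIntegrable (fun w : ℂ => δ * ‖w‖ ^ 2) x r :=
      ContinuousOn.circleIntegrable' (by fun_prop)
    have h2 : Real.circleAverage u x r ≤ u x :=
      Real.circleAverage_mono_on_of_le_circle ((huc.mono hrs').circleIntegrable_closedBall hr0.le)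
        fun w hw => hmax (hrs' (by
          rw [abs_of_pos hr0] at hw; exact Metric.sphere_subset_closedBall hw))
    have h3 : Real.circleAverage u x r = Real.circleAverage v x r + δ * (‖x‖ ^ 2 + r ^ 2) := by
      rw [hu, Real.circleAverage_fun_add hvi hsq]
      have := Real.circleAverage_fun_smul (a := δ) (f := fun w : ℂ => ‖w‖ ^ 2) (c := x) (R := r)
      simp only [smul_eq_mul] at this
      rw [this, circleAverage_norm_sq x r]
    rw [h3] at h2
    have : 0 < δ * r ^ 2 := by positivity
    simp only [hu] at h2
    nlinarith
  have h1 : u z ≤ u x := hmax hz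
  have h2 := h x hxR
  rw [mem_sphere_zero_iff_norm] at hxR
  simp only [hu, hxR] at h1
  have : 0 ≤ δ * ‖z‖ ^ 2 := by positivity
  linarith

theorem LocallySubmean.sub_re {v : ℂ → ℝ} {U : Set ℂ} (hU : IsOpen U) (hc : ContinuousOn v U)
    (hv : LocallySubmean v U) {P : ℂ → ℂ} (hP : Differentiable ℂ P) :
    LocallySubmean (fun z => v z - (P z).re) U := by
  intro z hz
  filter_upwards [hv z hz, eventually_pos_and_closedBall_subset hU hz] with r h1 h2
  have hvi := (hc.mono h2.2).circleIntegrable_closedBall h2.1.le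
  have hPi : CircleIntegrable (fun w => (P w).re) z r :=
    (Complex.continuous_re.comp hP.continuous).continuousOn.circleIntegrable'
  rw [Real.circleAverage_fun_sub hvi hPi, circleAverage_re_of_differentiable hP]
  linarith

/-- A negative frequency is the conjugate of a positive one, and conjugation does not change the
real part. The scalar `c` is quantified inside so that the induction passes through scalar
multiples. -/
theorem exists_differentiable_re_fourier {T : ℝ} [Fact (0 < T)] {q : C(AddCircle T, ℂ)}
    (hq : q ∈ Submodule.span ℂ (range (@fourier T))) :
    ∀ c : ℂ, ∃ P : ℂ → ℂ, Differentiable ℂ P ∧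
      ∀ x : AddCircle T, (c * q x).re = (P (fourier 1 x)).re := by
  induction hq using Submodule.span_induction with
  | mem q hq =>
    obtain ⟨m, rfl⟩ := hq
    intro c
    obtain ⟨k, rfl | rfl⟩ := m.eq_nat_or_neg
    · refine ⟨fun z => c * z ^ k, by fun_prop, fun x => ?_⟩
      simp [fourier_apply, AddCircle.toCircle_nsmul]
    · refine ⟨fun z => (starRingEnd ℂ c) * z ^ k, by fun_prop, fun x => ?_⟩
      have : fourier (-(k : ℤ)) x = (starRingEnd ℂ) ((fourier 1 x) ^ k) := by
        rw [fourier_neg]; simp [fourier_apply, AddCircle.toCircle_nsmul]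
      rw [this, ← Complex.conj_re]
      simp
  | zero => exact fun c => ⟨0, differentiable_const 0, by simp⟩
  | add x y _ _ hx hy =>
    intro c
    obtain ⟨P, hP, h1⟩ := hx c
    obtain ⟨Q, hQ, h2⟩ := hy c
    refine ⟨fun z => P z + Q z, by fun_prop, fun t => ?_⟩
    rw [ContinuousMap.add_apply, mul_add, Complex.add_re, h1, h2, Complex.add_re]
  | smul a x _ hx =>
    intro c
    obtain ⟨P, hP, h1⟩ := hx (c * a)
    exact ⟨P, hP, fun t => by rw [← h1 t, ContinuousMap.smul_apply, smul_eq_mul, mul_assoc]⟩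

theorem exists_differentiable_re_approx {v : ℂ → ℝ} {R : ℝ} (hR : 0 < R)
    (hv : ContinuousOn v (Metric.sphere 0 R)) {ε : ℝ} (hε : 0 < ε) :
    ∃ P : ℂ → ℂ, Differentiable ℂ P ∧ ∀ z ∈ Metric.sphere (0 : ℂ) R, |(P z).re - v z| < ε := by
  have : Fact (0 < (1 : ℝ)) := ⟨one_pos⟩
  have hs : ∀ x : AddCircle (1 : ℝ), (R : ℂ) * fourier 1 x ∈ Metric.sphere (0 : ℂ) R := by
    intro x
    simp [fourier_apply, abs_of_pos hR, Circle.norm_coe]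
  let φ : C(AddCircle (1 : ℝ), ℂ) := ⟨fun x => (v ((R : ℂ) * fourier 1 x) : ℂ), by
    refine Complex.continuous_ofReal.comp (hv.comp_continuous ?_ hs)
    exact continuous_const.mul (ContinuousMap.continuous _)⟩
  have hmem : φ ∈ (Submodule.span ℂ (range (@fourier 1))).topologicalClosure := by
    rw [span_fourier_closure_eq_top]; trivial
  rw [← SetLike.mem_coe, Submodule.topologicalClosure_coe, Metric.mem_closure_iff] at hmem
  obtain ⟨q, hq, hd⟩ := hmem ε hε
  obtain ⟨P, hP, h1⟩ := exists_differentiable_re_fourier hq 1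
  refine ⟨fun z => P ((R : ℂ)⁻¹ * z), by fun_prop, fun z hz => ?_⟩
  have hz1 : ‖(R : ℂ)⁻¹ * z‖ = 1 := by
    rw [mem_sphere_zero_iff_norm] at hz
    rw [norm_mul, hz]; simp [abs_of_pos hR, hR.ne']
  obtain ⟨x, hx⟩ : ∃ x : AddCircle (1 : ℝ), fourier 1 x = (R : ℂ)⁻¹ * z := by
    obtain ⟨x, hx⟩ := (AddCircle.homeomorphCircle (T := (1 : ℝ)) one_ne_zero).surjective
      ⟨(R : ℂ)⁻¹ * z, by simpa [Submonoid.unitSphere] using hz1⟩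
    refine ⟨x, ?_⟩
    rw [fourier_apply, one_zsmul, ← AddCircle.homeomorphCircle_apply one_ne_zero, hx]
  have hRC : (R : ℂ) ≠ 0 := by exact_mod_cast hR.ne'
  have hxz : (R : ℂ) * fourier 1 x = z := by rw [hx]; field_simp
  have h2 := (ContinuousMap.dist_lt_iff hε).1 hd x
  have h3 := h1 x
  rw [one_mul] at h3
  show |(P ((R : ℂ)⁻¹ * z)).re - v z| < ε
  rw [← hx, ← h3]
  have h4 : v z = (φ x).re := by
    show v z = ((v ((R : ℂ) * fourier 1 x) : ℝ) : ℂ).re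
    rw [hxz, Complex.ofReal_re]
  rw [h4, abs_sub_comm]
  calc |(φ x).re - (q x).re| = |(φ x - q x).re| := by simp
    _ ≤ ‖φ x - q x‖ := Complex.abs_re_le_norm _
    _ < ε := by rwa [← dist_eq_norm]

/-- This replaces the solution of the Dirichlet problem: trigonometric polynomials approximate the
boundary values uniformly, and each is the boundary value of the real part of an entire function.
The maximum principle carries the comparison inside. -/
theorem LocallySubmean.exists_majorant {v : ℂ → ℝ} {R : ℝ} (hR : 0 < R)
    (hc : ContinuousOn v (Metric.closedBall 0 R)) (hv : LocallySubmean v (Metric.ball 0 R))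
    {ε : ℝ} (hε : 0 < ε) :
    ∃ P : ℂ → ℂ, Differentiable ℂ P ∧ (∀ z ∈ Metric.closedBall (0 : ℂ) R, v z ≤ (P z).re) ∧
      ∀ z ∈ Metric.sphere (0 : ℂ) R, (P z).re ≤ v z + ε := by
  obtain ⟨P, hP, h⟩ := exists_differentiable_re_approx hR
    (hc.mono Metric.sphere_subset_closedBall) (half_pos hε)
  refine ⟨fun z => P z + (ε / 2 : ℝ), by fun_prop, fun z hz => ?_, fun z hz => ?_⟩
  · have hsub := hv.sub_re Metric.isOpen_ball (hc.mono Metric.ball_subset_closedBall)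
      (P := fun z => P z + (ε / 2 : ℝ)) (by fun_prop)
    have hPc := hP.continuous
    have h3 : ContinuousOn (fun z => v z - (P z + (ε / 2 : ℝ)).re) (Metric.closedBall 0 R) :=
      hc.sub (Complex.continuous_re.comp (by fun_prop)).continuousOn
    have := hsub.le_of_le_sphere (M := 0) h3 (fun z hz => ?_) z hz
    · simp only [Complex.add_re, Complex.ofReal_re] at this ⊢
      linarith
    · have := abs_lt.1 (h z hz)
      simp only [Complex.add_re, Complex.ofReal_re]
      linarith
  · have := abs_lt.1 (h z hz)
    simp only [Complex.add_re, Complex.ofReal_re]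
    linarith

theorem LocallySubmean.circleAverage_mono {v : ℂ → ℝ} {r R : ℝ} (hr : 0 ≤ r) (hrR : r ≤ R)
    (hR : 0 < R) (hc : ContinuousOn v (Metric.closedBall 0 R))
    (hv : LocallySubmean v (Metric.ball 0 R)) :
    Real.circleAverage v 0 r ≤ Real.circleAverage v 0 R := by
  refine le_of_forall_pos_le_add fun ε hε => ?_
  obtain ⟨P, hP, h1, h2⟩ := hv.exists_majorant hR hc hε
  have hPi : ∀ s, CircleIntegrable (fun w => (P w).re) 0 s := fun s =>
    (Complex.continuous_re.comp hP.continuous).continuousOn.circleIntegrable'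
  have hvR := hc.circleIntegrable_closedBall hR.le
  have hεi : CircleIntegrable (fun _ : ℂ => ε) 0 R := ContinuousOn.circleIntegrable' (by fun_prop)
  calc Real.circleAverage v 0 r ≤ Real.circleAverage (fun w => (P w).re) 0 r := by
        refine Real.circleAverage_mono
          ((hc.mono (Metric.closedBall_subset_closedBall hrR)).circleIntegrable_closedBall hr)
          (hPi r) fun z hz => h1 z ?_
        rw [abs_of_nonneg hr] at hz
        exact Metric.closedBall_subset_closedBall hrR (Metric.sphere_subset_closedBall hz)
    _ = Real.circleAverage (fun w => (P w).re) 0 R := by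
        rw [circleAverage_re_of_differentiable hP, circleAverage_re_of_differentiable hP]
    _ ≤ Real.circleAverage (fun w => v w + ε) 0 R := by
        refine Real.circleAverage_mono (hPi R) (hvR.add hεi) fun z hz => h2 z ?_
        rwa [abs_of_pos hR] at hz
    _ = Real.circleAverage v 0 R + ε := by
        rw [Real.circleAverage_fun_add hvR hεi, Real.circleAverage_const]

theorem continuousOn_poissonKernel_sphere {w : ℂ} {R : ℝ} (hw : w ∈ Metric.ball 0 R) :
    ContinuousOn (poissonKernel 0 w) (Metric.sphere 0 R) := by
  unfold poissonKernel
  refine ContinuousOn.div (by fun_prop) (by fun_prop) fun z hz => ?_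
  rw [mem_sphere_zero_iff_norm] at hz
  rw [mem_ball_zero_iff] at hw
  have : z - w ≠ 0 := by
    rintro h
    rw [sub_eq_zero] at h
    rw [h] at hz; linarith
  simpa using this

theorem poissonKernel_nonneg {w z : ℂ} (h : ‖w‖ ≤ ‖z‖) : 0 ≤ poissonKernel 0 w z := by
  unfold poissonKernel
  refine div_nonneg ?_ (by positivity)
  simp only [sub_zero]
  nlinarith [norm_nonneg w]

theorem circleAverage_poissonKernel {w : ℂ} {R : ℝ} (hw : w ∈ Metric.ball 0 R) :
    Real.circleAverage (poissonKernel 0 w) 0 R = 1 := by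
  have hR : 0 < R := Metric.pos_of_mem_ball hw
  have hk := continuousOn_poissonKernel_sphere hw
  have := (diffContOnCl_const (c := (1 : ℂ)) (𝕜 := ℂ)
    (s := Metric.ball (0 : ℂ) R)).circleAverage_poissonKernel_smul hw
  have h2 := Complex.reCLM.circleAverage_comp_comm (f := poissonKernel 0 w • fun _ : ℂ => (1 : ℂ))
    (c := 0) (R := R) ((hk.smul continuousOn_const).circleIntegrable hR.le)
  rw [this] at h2
  rw [show (1 : ℝ) = Complex.reCLM (1 : ℂ) by simp, ← h2]
  congr 1
  ext z
  simp

/-- The majorant is reproduced by its Poisson integral, and on the circle it exceeds `v` by at most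
`ε`, which integrates to `ε` since the kernel has mean `1`. -/
theorem LocallySubmean.le_circleAverage_poissonKernel {v : ℂ → ℝ} {R : ℝ}
    (hc : ContinuousOn v (Metric.closedBall 0 R)) (hv : LocallySubmean v (Metric.ball 0 R))
    {w : ℂ} (hw : w ∈ Metric.ball 0 R) :
    v w ≤ Real.circleAverage (fun z => poissonKernel 0 w z * v z) 0 R := by
  have hR : 0 < R := Metric.pos_of_mem_ball hw
  have hk := continuousOn_poissonKernel_sphere hw
  have hpos : ∀ z ∈ Metric.sphere (0 : ℂ) R, 0 ≤ poissonKernel 0 w z := fun z hz =>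
    poissonKernel_nonneg (by
      rw [mem_sphere_zero_iff_norm] at hz; rw [mem_ball_zero_iff] at hw; linarith)
  have hvi : ContinuousOn v (Metric.sphere 0 R) := hc.mono Metric.sphere_subset_closedBall
  refine le_of_forall_pos_le_add fun ε hε => ?_
  obtain ⟨P, hP, h1, h2⟩ := hv.exists_majorant hR hc hε
  have hPc : Continuous fun w => (P w).re := Complex.continuous_re.comp hP.continuous
  calc v w ≤ (P w).re := h1 w (Metric.ball_subset_closedBall hw)
    _ = Real.circleAverage (fun z => poissonKernel 0 w z * (P z).re) 0 R := by
        have h3 := (hP.diffContOnCl (s := Metric.ball 0 R)).circleAverage_poissonKernel_smul hw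
        have h4 := Complex.reCLM.circleAverage_comp_comm (f := poissonKernel 0 w • P)
          (c := 0) (R := R) ((hk.smul hP.continuous.continuousOn).circleIntegrable hR.le)
        rw [h3] at h4
        rw [show (P w).re = Complex.reCLM (P w) from rfl, ← h4]
        congr 1
        ext z
        simp
    _ ≤ Real.circleAverage (fun z => poissonKernel 0 w z * v z + ε * poissonKernel 0 w z) 0 R := by
        refine Real.circleAverage_mono ((hk.mul hPc.continuousOn).circleIntegrable hR.le)
          (((hk.mul hvi).add (continuousOn_const.mul hk)).circleIntegrable hR.le) fun z hz => ?_
        rw [abs_of_pos hR] at hz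
        have := mul_le_mul_of_nonneg_left (h2 z hz) (hpos z hz)
        linarith
    _ = _ := by
        rw [Real.circleAverage_fun_add (f₁ := fun z => poissonKernel 0 w z * v z)
          (f₂ := fun z => ε * poissonKernel 0 w z) ((hk.mul hvi).circleIntegrable hR.le)
          ((continuousOn_const.mul hk).circleIntegrable hR.le)]
        congr 1
        have := Real.circleAverage_fun_smul (a := ε) (f := poissonKernel 0 w) (c := 0) (R := R)
        simp only [smul_eq_mul] at this
        rw [this, circleAverage_poissonKernel hw, mul_one]

/-! ### Logarithms on discs and subharmonicity of powers of the modulus. -/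

theorem exists_exp_eqOn_ball {f : ℂ → ℂ} {c : ℂ} {r : ℝ}
    (hf : DifferentiableOn ℂ f (Metric.ball c r)) (h0 : ∀ z ∈ Metric.ball c r, f z ≠ 0) :
    ∃ L : ℂ → ℂ, DifferentiableOn ℂ L (Metric.ball c r) ∧
      ∀ z ∈ Metric.ball c r, Complex.exp (L z) = f z := by
  rcases le_or_gt r 0 with hr | hr
  · exact ⟨0, by simp [Metric.ball_eq_empty.2 hr], by simp [Metric.ball_eq_empty.2 hr]⟩
  have hd : DifferentiableOn ℂ (fun z => deriv f z / f z) (Metric.ball c r) :=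
    (hf.deriv Metric.isOpen_ball).div hf h0
  obtain ⟨L, hL⟩ := hd.isExactOn_ball
  have hcm := Metric.mem_ball_self (x := c) hr
  set M : ℂ → ℂ := fun z => L z - L c + Complex.log (f c)
  have hM : ∀ z ∈ Metric.ball c r, HasDerivAt M (deriv f z / f z) z := fun z hz =>
    ((hL z hz).sub_const _).add_const _
  have hq : ∀ z ∈ Metric.ball c r, HasDerivAt (fun z => f z * Complex.exp (-M z)) 0 z := by
    intro z hz
    have h1 := (hf.differentiableAt (Metric.isOpen_ball.mem_nhds hz)).hasDerivAt
    have h2 := h1.mul (hM z hz).neg.cexp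
    have := h0 z hz
    refine h2.congr_deriv ?_
    field_simp
    ring
  refine ⟨M, fun z hz => (hM z hz).differentiableAt.differentiableWithinAt, fun z hz => ?_⟩
  have hconst : f z * Complex.exp (-M z) = f c * Complex.exp (-M c) := by
    refine Metric.isOpen_ball.is_const_of_deriv_eq_zero (𝕜 := ℂ)
      (convex_ball c r).isPreconnected (f := fun z => f z * Complex.exp (-M z)) ?_ ?_ hz hcm
    · exact fun w hw => (hq w hw).differentiableAt.differentiableWithinAt
    · exact fun w hw => (hq w hw).deriv
  have h1 : M c = Complex.log (f c) := by simp [M]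
  rw [h1, Complex.exp_neg, Complex.exp_neg, Complex.exp_log (h0 c hcm),
    mul_inv_cancel₀ (h0 c hcm)] at hconst
  field_simp at hconst
  exact hconst.symm

/-- At a zero there is nothing to prove. Elsewhere `k = exp L` locally, and `|k|^q = |exp (q L)|` is
the modulus of a holomorphic function, for every `q > 0`. -/
theorem DifferentiableOn.locallySubmean_norm_rpow {k : ℂ → ℂ} {U : Set ℂ} (hU : IsOpen U)
    (hk : DifferentiableOn ℂ k U) {q : ℝ} (hq : 0 < q) :
    LocallySubmean (fun z => ‖k z‖ ^ q) U := by
  intro z hz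
  by_cases h0 : k z = 0
  · filter_upwards [self_mem_nhdsWithin] with r hr
    rw [h0, norm_zero, Real.zero_rpow hq.ne']
    exact Real.circleAverage_nonneg_of_nonneg fun _ _ => by positivity
  · have hev : ∀ᶠ w in 𝓝 z, w ∈ U ∧ k w ≠ 0 :=
      (hU.eventually_mem hz).and
        ((hk.continuousOn.continuousAt (hU.mem_nhds hz)).eventually_ne h0)
    obtain ⟨δ, hδ, hs⟩ := Metric.eventually_nhds_iff_ball.1 hev
    obtain ⟨L, hL, hLe⟩ := exists_exp_eqOn_ball (hk.mono fun w hw => (hs w hw).1)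
      fun w hw => (hs w hw).2
    have hn : ∀ w ∈ Metric.ball z δ, ‖k w‖ ^ q = ‖Complex.exp (q * L w)‖ := by
      intro w hw
      rw [← hLe w hw, Complex.norm_exp, Complex.norm_exp, ← Real.exp_mul]
      simp [mul_comm]
    filter_upwards [Ioo_mem_nhdsGT hδ] with r hr
    have hsub : Metric.closedBall z r ⊆ Metric.ball z δ := Metric.closedBall_subset_ball hr.2
    have hE : DifferentiableOn ℂ (fun w => Complex.exp (q * L w)) (Metric.ball z δ) := by
      fun_prop
    have hmean := (hE.diffContOnCl_ball (by simpa [abs_of_pos hr.1] using hsub) :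
      DiffContOnCl ℂ _ (Metric.ball z |r|)).circleAverage
    have hEc : ContinuousOn (fun w => Complex.exp (q * L w)) (Metric.closedBall z r) :=
      hE.continuousOn.mono hsub
    rw [hn z (Metric.mem_ball_self hδ), ← hmean]
    calc ‖Real.circleAverage (fun w => Complex.exp (q * L w)) z r‖
        ≤ Real.circleAverage (fun w => ‖Complex.exp (q * L w)‖) z r := by
          rw [Real.circleAverage_def, Real.circleAverage_def, norm_smul, smul_eq_mul,
            Real.norm_of_nonneg (by positivity)]
          gcongr
          exact intervalIntegral.norm_integral_le_integral_norm (by positivity)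
      _ = Real.circleAverage (fun z => ‖k z‖ ^ q) z r := by
          refine Real.circleAverage_congr_sphere fun w hw => (hn w ?_).symm
          rw [abs_of_pos hr.1] at hw
          exact hsub (Metric.sphere_subset_closedBall hw)

/-! ### Fatou's theorem for bounded functions. -/

/-- The first term is Cauchy's formula for the derivative. The second has its pole at the reflected
point `ζ₀ / r` outside the disc and vanishes at `0`, so it contributes nothing; subtracting it gives
the kernel an extra factor `1 - r^2`, which Cauchy's kernel alone lacks. -/
theorem deriv_eq_circleAverage_kernel {G : ℂ → ℂ} (hG : DiffContOnCl ℂ G (Metric.ball 0 1))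
    {ζ₀ : ℂ} (hζ : ‖ζ₀‖ = 1) {r : ℝ} (hr : r ∈ Ioo (0 : ℝ) 1) :
    deriv G (r * ζ₀) = Real.circleAverage
      (fun ζ => (ζ / (ζ - r * ζ₀) ^ 2 - ζ / (ζ - ζ₀ / r) ^ 2) * G ζ) 0 1 := by
  set w : ℂ := r * ζ₀ with hw
  set w' : ℂ := ζ₀ / r with hw'
  have hr0 : (r : ℂ) ≠ 0 := by exact_mod_cast hr.1.ne'
  have hwn : ‖w‖ < 1 := by rw [hw, norm_mul, hζ]; simp [abs_of_pos hr.1, hr.2]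
  have hwb : w ∈ Metric.ball (0 : ℂ) 1 := by rwa [mem_ball_zero_iff]
  have hwn' : 1 < ‖w'‖ := by
    rw [hw', norm_div, hζ]
    simpa [abs_of_pos hr.1] using (one_lt_inv₀ hr.1).2 hr.2
  have hGc : ContinuousOn G (Metric.closedBall 0 1) := by
    have := hG.continuousOn; rwa [closure_ball _ one_ne_zero] at this
  have hGs : ContinuousOn G (Metric.sphere 0 1) := hGc.mono Metric.sphere_subset_closedBall
  have hne : ∀ ζ ∈ Metric.sphere (0 : ℂ) 1, ∀ u ∈ Metric.ball (0 : ℂ) 1, ζ - u ≠ 0 := by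
    intro ζ hζ u hu h
    rw [sub_eq_zero] at h
    rw [mem_sphere_zero_iff_norm] at hζ; rw [mem_ball_zero_iff] at hu
    rw [h] at hζ; linarith
  have hne' : ∀ ζ ∈ Metric.closedBall (0 : ℂ) 1, ζ - w' ≠ 0 := by
    intro ζ hζ h
    rw [sub_eq_zero] at h
    rw [mem_closedBall_zero_iff] at hζ
    rw [h] at hζ; linarith
  have hcauchy : ∀ u ∈ Metric.ball (0 : ℂ) 1,
      Real.circleAverage (fun ζ => herglotzRieszKernel 0 u ζ • G ζ) 0 1 = 2 * G u - G 0 := by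
    intro u hu
    have h1 := DiffContOnCl.circleAverage_smul_div (R := 1) (by simpa using hG) (by simpa using hu)
    have h2 := DiffContOnCl.circleAverage (R := 1) (c := 0) (by simpa using hG)
    have hk : ContinuousOn (fun ζ : ℂ => (ζ - 0) / (ζ - u)) (Metric.sphere 0 1) :=
      ContinuousOn.div (by fun_prop) (by fun_prop) fun ζ hζ => hne ζ hζ u hu
    rw [← h1, ← h2]
    have h3 := Real.circleAverage_fun_smul (a := (2 : ℂ))
      (f := fun ζ => ((ζ - 0) / (ζ - u)) • G ζ) (c := 0) (R := 1)
    rw [← smul_eq_mul, ← h3, ← Real.circleAverage_fun_sub]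
    · refine Real.circleAverage_congr_sphere fun ζ hζ => ?_
      rw [abs_one] at hζ
      have := hne ζ hζ u hu
      simp only [herglotzRieszKernel_def, smul_eq_mul, sub_zero]
      field_simp
      ring
    · exact ((hk.smul hGs).const_smul (2 : ℂ)).circleIntegrable zero_le_one
    · exact hGs.circleIntegrable zero_le_one
  have hder := hasDerivAt_circleAverage_herglotzRieszKernel_smul
    (f := G) (hGs.circleIntegrable zero_le_one) hwb
  have hder2 : HasDerivAt (fun u => 2 * G u - G 0) (2 * deriv G w) w :=
    (((hG.differentiableAt Metric.isOpen_ball hwb).hasDerivAt).const_mul 2).sub_const _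
  have hder3 := hder2.congr_of_eventuallyEq (f₁ := fun u => Real.circleAverage
      (fun ζ => herglotzRieszKernel 0 u ζ • G ζ) 0 1)
    (Filter.eventually_of_mem (Metric.isOpen_ball.mem_nhds hwb) hcauchy)
  have h4 := hder.unique hder3
  have hzero : Real.circleAverage (fun ζ => ζ / (ζ - w') ^ 2 * G ζ) 0 1 = 0 := by
    have : DiffContOnCl ℂ (fun ζ => ζ / (ζ - w') ^ 2 * G ζ) (Metric.ball 0 |1|) := by
      rw [abs_one]
      refine ⟨?_, ?_⟩
      · refine DifferentiableOn.mul (DifferentiableOn.div (by fun_prop) (by fun_prop) ?_) hG.differentiableOn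
        exact fun ζ hζ => pow_ne_zero 2 (hne' ζ (Metric.ball_subset_closedBall hζ))
      · rw [closure_ball _ one_ne_zero]
        refine ContinuousOn.mul (ContinuousOn.div (by fun_prop) (by fun_prop) ?_) hGc
        exact fun ζ hζ => pow_ne_zero 2 (hne' ζ hζ)
    rw [this.circleAverage]
    simp
  have hk1 : ContinuousOn (fun ζ : ℂ => ζ / (ζ - w) ^ 2 * G ζ) (Metric.sphere 0 1) :=
    (ContinuousOn.div (by fun_prop) (by fun_prop) fun ζ hζ => pow_ne_zero 2 (hne ζ hζ w hwb)).mul hGs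
  have hk2 : ContinuousOn (fun ζ : ℂ => ζ / (ζ - w') ^ 2 * G ζ) (Metric.sphere 0 1) :=
    (ContinuousOn.div (by fun_prop) (by fun_prop) fun ζ hζ => pow_ne_zero 2
      (hne' ζ (Metric.sphere_subset_closedBall hζ))).mul hGs
  simp only [sub_mul]
  rw [Real.circleAverage_fun_sub (f₁ := fun ζ : ℂ => ζ / (ζ - w) ^ 2 * G ζ)
    (f₂ := fun ζ : ℂ => ζ / (ζ - w') ^ 2 * G ζ) (hk1.circleIntegrable zero_le_one)
    (hk2.circleIntegrable zero_le_one), hzero, sub_zero]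
  have h5 := Real.circleAverage_fun_smul (a := (2 : ℂ))
      (f := fun ζ : ℂ => ζ / (ζ - w) ^ 2 * G ζ) (c := 0) (R := 1)
  have h6 : (2 : ℂ) * deriv G w = 2 * Real.circleAverage (fun ζ : ℂ => ζ / (ζ - w) ^ 2 * G ζ) 0 1 := by
    rw [← h4, ← smul_eq_mul (2 : ℂ), ← h5]
    refine congrArg (fun f => Real.circleAverage f 0 1) ?_
    ext ζ
    simp only [smul_eq_mul]
    ring
  exact mul_left_cancel₀ two_ne_zero h6

/-- On the unit circle `|ζ - ζ₀ / r| = |ζ - r ζ₀| / r`, so the difference of the two poles factors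
out and its size is `(1 - r^2) / r`. -/
theorem norm_kernel_le {ζ ζ₀ : ℂ} (hζ : ‖ζ‖ = 1) (hζ₀ : ‖ζ₀‖ = 1) {r : ℝ} (hr : r ∈ Ioo (0 : ℝ) 1) :
    ‖ζ / (ζ - r * ζ₀) ^ 2 - ζ / (ζ - ζ₀ / r) ^ 2‖ ≤ 2 * (1 - r ^ 2) / ‖ζ - r * ζ₀‖ ^ 3 := by
  have hr0 : (r : ℂ) ≠ 0 := by exact_mod_cast hr.1.ne'
  have h1 : ζ - r * ζ₀ ≠ 0 := by
    intro h
    rw [sub_eq_zero] at h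
    have := congrArg norm h
    rw [hζ, norm_mul, hζ₀] at this
    simp [abs_of_pos hr.1] at this
    linarith [hr.2]
  have hD : ‖ζ - ζ₀ / r‖ = ‖ζ - r * ζ₀‖ / r := by
    rw [eq_div_iff hr.1.ne']
    have e1 : ‖ζ - ζ₀ / r‖ * r = ‖r * ζ - ζ₀‖ := by
      rw [show (r : ℂ) * ζ - ζ₀ = r * (ζ - ζ₀ / r) by field_simp, norm_mul]
      simp [abs_of_pos hr.1, mul_comm]
    rw [e1, ← sq_eq_sq₀ (norm_nonneg _) (norm_nonneg _), ← Complex.normSq_eq_norm_sq,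
      ← Complex.normSq_eq_norm_sq, Complex.normSq_sub, Complex.normSq_sub]
    simp only [Complex.normSq_eq_norm_sq, norm_mul, hζ, hζ₀]
    simp
    ring
  set D := ‖ζ - r * ζ₀‖ with hDdef
  have hDpos : 0 < D := norm_pos_iff.2 h1
  have h2 : ζ - ζ₀ / r ≠ 0 := by
    rw [← norm_pos_iff, hD]; exact div_pos hDpos hr.1
  have e2 : ζ / (ζ - r * ζ₀) ^ 2 - ζ / (ζ - ζ₀ / r) ^ 2 =
      ζ * ((r * ζ₀ - ζ₀ / r) * ((ζ - r * ζ₀) + (ζ - ζ₀ / r))) /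
        ((ζ - r * ζ₀) ^ 2 * (ζ - ζ₀ / r) ^ 2) := by
    rw [div_sub_div _ _ (pow_ne_zero 2 h1) (pow_ne_zero 2 h2)]
    congr 1
    ring
  have e3 : ‖(r : ℂ) * ζ₀ - ζ₀ / r‖ = (1 - r ^ 2) / r := by
    rw [show (r : ℂ) * ζ₀ - ζ₀ / r = -(((1 - r ^ 2) / r : ℝ) * ζ₀) by
      push_cast; field_simp; ring, norm_neg, norm_mul, hζ₀, mul_one, Complex.norm_real,
      Real.norm_of_nonneg]
    exact div_nonneg (by nlinarith [hr.1, hr.2]) hr.1.le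
  rw [e2, norm_div, norm_mul, norm_mul, norm_mul, norm_pow, norm_pow, hζ, e3, hD, ← hDdef, one_mul]
  have e4 : ‖(ζ - r * ζ₀) + (ζ - ζ₀ / r)‖ ≤ D + D / r := by
    rw [← hD]; exact norm_add_le _ _
  have h1r : 0 ≤ 1 - r ^ 2 := by nlinarith [hr.1, hr.2]
  have hrp := hr.1
  calc (1 - r ^ 2) / r * ‖(ζ - r * ζ₀) + (ζ - ζ₀ / r)‖ / (D ^ 2 * (D / r) ^ 2)
      ≤ (1 - r ^ 2) / r * (D + D / r) / (D ^ 2 * (D / r) ^ 2) := by gcongr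
    _ = (1 + r) * (1 - r ^ 2) / D ^ 3 := by field_simp; ring
    _ ≤ 2 * (1 - r ^ 2) / D ^ 3 := by
        gcongr
        linarith [hr.2]

theorem exists_continuousAt_angle {ζ₀ : ℂ} {θ : ℝ} (h : ζ₀ = circleMap 0 1 θ) :
    ∃ t : ℂ → ℝ, Tendsto t (𝓝 ζ₀) (𝓝 θ) ∧
      ∀ ζ ∈ Metric.sphere (0 : ℂ) 1, ζ = circleMap 0 1 (t ζ) := by
  have h0 : ζ₀ ≠ 0 := by rw [h]; exact circleMap_ne_center one_ne_zero
  refine ⟨fun ζ => θ + (ζ / ζ₀).arg, ?_, fun ζ hζ => ?_⟩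
  · have h1 : Tendsto (fun ζ : ℂ => ζ / ζ₀) (𝓝 ζ₀) (𝓝 1) := by
      have : Tendsto (fun ζ : ℂ => ζ / ζ₀) (𝓝 ζ₀) (𝓝 (ζ₀ / ζ₀)) := tendsto_id.div_const _
      rwa [div_self h0] at this
    have h2 := ((Complex.continuousAt_arg (x := 1) (by simp)).tendsto.comp h1).const_add θ
    simpa using h2
  · rw [mem_sphere_zero_iff_norm] at hζ
    have h3 : ‖ζ₀‖ = 1 := by rw [h]; simp
    have h4 := Complex.norm_mul_exp_arg_mul_I (ζ / ζ₀)
    rw [norm_div, hζ, h3] at h4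
    have h5 : ζ = ζ₀ * Complex.exp ((ζ / ζ₀).arg * Complex.I) := by
      have : Complex.exp ((ζ / ζ₀).arg * Complex.I) = ζ / ζ₀ := by simpa using h4
      rw [this]; field_simp
    show ζ = circleMap 0 1 (θ + (ζ / ζ₀).arg)
    generalize (ζ / ζ₀).arg = a at h5 ⊢
    rw [h5, h]
    simp only [circleMap, Complex.ofReal_one, one_mul, zero_add, Complex.ofReal_add, add_mul,
      Complex.exp_add]

/-- Near `ζ₀` this is differentiability of the boundary values; away from `ζ₀` boundedness suffices.
The exponent `3` in the far term matches the cube in the denominator of the kernel bound. -/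
theorem exists_norm_sub_affine_le {G : ℂ → ℂ} (hG : ContinuousOn G (Metric.closedBall 0 1))
    {θ : ℝ} {D : ℂ} (hD : HasDerivAt (fun θ : ℝ => G (circleMap 0 1 θ)) D θ) {ζ₀ : ℂ}
    (hζ₀ : ζ₀ = circleMap 0 1 θ) {ε : ℝ} (hε : 0 < ε) :
    ∃ M : ℝ, 0 ≤ M ∧ ∀ ζ ∈ Metric.sphere (0 : ℂ) 1,
      ‖G ζ - G ζ₀ - D / (ζ₀ * Complex.I) * (ζ - ζ₀)‖ ≤ ε * ‖ζ - ζ₀‖ + M * ‖ζ - ζ₀‖ ^ 3 := by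
  have h0 : ζ₀ ≠ 0 := by rw [hζ₀]; exact circleMap_ne_center one_ne_zero
  have hI : ζ₀ * Complex.I ≠ 0 := mul_ne_zero h0 Complex.I_ne_zero
  have hc : HasDerivAt (circleMap 0 1) (ζ₀ * Complex.I) θ := by
    rw [hζ₀]; exact hasDerivAt_circleMap 0 1 θ
  obtain ⟨t, ht, hts⟩ := exists_continuousAt_angle hζ₀
  have h1 : HasDerivAt (fun s : ℝ => G (circleMap 0 1 s) - D / (ζ₀ * Complex.I) * circleMap 0 1 s)
      0 θ := by
    refine (hD.sub (hc.const_mul (D / (ζ₀ * Complex.I)))).congr_deriv ?_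
    rw [div_mul_cancel₀ _ hI, sub_self]
  rw [hasDerivAt_iff_isLittleO] at h1
  have h2 : (fun s : ℝ => s - θ) =O[𝓝 θ] fun s => circleMap 0 1 s - circleMap 0 1 θ :=
    ((hc.isTheta_sub hI).symm.isBigO).comp_tendsto (k := fun s => (s, θ))
      (tendsto_id.prodMk tendsto_const_pure)
  have h3 := ((h1.trans_isBigO h2).def hε)
  have h4 := ht.eventually h3
  obtain ⟨δ, hδ, hs⟩ := Metric.eventually_nhds_iff.1 h4
  obtain ⟨M, hM⟩ := ((isCompact_sphere (0 : ℂ) 1).exists_bound_of_continuousOn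
    (f := fun ζ => G ζ - G ζ₀ - D / (ζ₀ * Complex.I) * (ζ - ζ₀))
    (((hG.mono Metric.sphere_subset_closedBall).sub continuousOn_const).sub (by fun_prop)))
  have hM0 : 0 ≤ |M| := abs_nonneg _
  refine ⟨|M| / δ ^ 3, by positivity, fun ζ hζ => ?_⟩
  by_cases hd : dist ζ ζ₀ < δ
  · have h5 := hs hd
    rw [← hts ζ hζ, ← hζ₀] at h5
    simp only [smul_zero, sub_zero] at h5
    calc ‖G ζ - G ζ₀ - D / (ζ₀ * Complex.I) * (ζ - ζ₀)‖
        = ‖G ζ - D / (ζ₀ * Complex.I) * ζ - (G ζ₀ - D / (ζ₀ * Complex.I) * ζ₀)‖ := by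
          congr 1; ring
      _ ≤ ε * ‖ζ - ζ₀‖ := h5
      _ ≤ _ := le_add_of_nonneg_right (by positivity)
  · rw [not_lt, dist_eq_norm] at hd
    calc _ ≤ M := hM ζ hζ
      _ ≤ |M| := le_abs_self M
      _ = |M| / δ ^ 3 * δ ^ 3 := by field_simp
      _ ≤ |M| / δ ^ 3 * ‖ζ - ζ₀‖ ^ 3 := by gcongr
      _ ≤ _ := le_add_of_nonneg_left (by positivity)

theorem norm_circleAverage_le {f : ℂ → ℂ} {u : ℂ → ℝ} {R : ℝ} (hR : 0 < R)
    (hu : ContinuousOn u (Metric.sphere 0 R))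
    (h : ∀ z ∈ Metric.sphere (0 : ℂ) R, ‖f z‖ ≤ u z) :
    ‖Real.circleAverage f 0 R‖ ≤ Real.circleAverage u 0 R := by
  rw [Real.circleAverage_def, Real.circleAverage_def, norm_smul, smul_eq_mul,
    Real.norm_of_nonneg (by positivity)]
  gcongr
  refine intervalIntegral.norm_integral_le_of_norm_le (by positivity) ?_ (hu.circleIntegrable hR.le)
  exact Filter.Eventually.of_forall fun t _ => h _ (by simp [abs_of_pos hR])

/-- A holomorphic function with Lipschitz extension `G` to the closed disc has a derivative with
radial limits wherever the boundary values of `G` are differentiable. -/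
theorem tendsto_deriv_radial {G : ℂ → ℂ} (hG : DiffContOnCl ℂ G (Metric.ball 0 1))
    {θ : ℝ} {D : ℂ} (hD : HasDerivAt (fun θ : ℝ => G (circleMap 0 1 θ)) D θ) :
    ∃ c : ℂ, Tendsto (fun r : ℝ => deriv G (circleMap 0 r θ)) (𝓝[<] 1) (𝓝 c) := by
  set ζ₀ : ℂ := circleMap 0 1 θ with hζ₀
  have hζn : ‖ζ₀‖ = 1 := by simp [hζ₀]
  have hr1 : ∀ r : ℝ, circleMap 0 r θ = r * ζ₀ := fun r => by simp [hζ₀, circleMap]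
  set c : ℂ := D / (ζ₀ * Complex.I) with hc
  have hGc : ContinuousOn G (Metric.closedBall 0 1) := by
    have := hG.continuousOn; rwa [closure_ball _ one_ne_zero] at this
  refine ⟨c, ?_⟩
  rw [Metric.tendsto_nhds]
  intro ε hε
  -- With `|ζ - ζ₀| ≤ 2 |ζ - r ζ₀|`, the kernel bound turns the linear error into `4 (ε / 8)` times
  -- the Poisson kernel, of mean `1`, and the cubic error into the constant `16 M (1 - r^2)`, which
  -- tends to `0`. The total limit `ε / 2` is below `ε`.
  obtain ⟨M, hM0, hM⟩ := exists_norm_sub_affine_le hGc hD hζ₀ (ε := ε / 8) (by positivity)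
  have hlim : Tendsto (fun r : ℝ => 4 * (ε / 8) + 16 * M * (1 - r ^ 2)) (𝓝[<] 1)
      (𝓝 (4 * (ε / 8) + 16 * M * (1 - 1 ^ 2))) :=
    (Continuous.tendsto (by fun_prop) 1).mono_left nhdsWithin_le_nhds
  have hlt : 4 * (ε / 8) + 16 * M * (1 - 1 ^ 2) < ε := by linarith
  filter_upwards [hlim.eventually (gt_mem_nhds hlt), Ioo_mem_nhdsLT (zero_lt_one' ℝ)] with r hr hr01
  refine lt_of_le_of_lt ?_ hr
  set w : ℂ := r * ζ₀ with hw
  set K : ℂ → ℂ := fun ζ => ζ / (ζ - r * ζ₀) ^ 2 - ζ / (ζ - ζ₀ / r) ^ 2 with hK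
  have hwb : w ∈ Metric.ball (0 : ℂ) 1 := by
    rw [mem_ball_zero_iff, hw, norm_mul, hζn]; simp [abs_of_pos hr01.1, hr01.2]
  have hwn : ‖w‖ = r := by rw [hw, norm_mul, hζn]; simp [abs_of_pos hr01.1]
  set ℓ : ℂ → ℂ := fun ζ => G ζ₀ + c * (ζ - ζ₀) with hℓ
  have hℓd : Differentiable ℂ ℓ := by simp only [hℓ]; fun_prop
  have h1 := deriv_eq_circleAverage_kernel (hG.sub hℓd.diffContOnCl) hζn hr01
  have h2 : deriv (G - ℓ) (r * ζ₀) = deriv G (r * ζ₀) - c := by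
    rw [deriv_sub (hG.differentiableAt Metric.isOpen_ball hwb) hℓd.differentiableAt]
    congr 1
    simp [hℓ]
  rw [dist_eq_norm, hr1, ← h2, h1]
  have hkc := continuousOn_poissonKernel_sphere hwb
  calc _ ≤ Real.circleAverage (fun ζ => 4 * (ε / 8) * poissonKernel 0 w ζ + 16 * M * (1 - r ^ 2)) 0 1 := by
        refine norm_circleAverage_le one_pos ((continuousOn_const.mul hkc).add continuousOn_const)
          fun ζ hζ => ?_
        have hζ1 : ‖ζ‖ = 1 := by rwa [mem_sphere_zero_iff_norm] at hζ
        have hb := hM ζ hζ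
        have hk := norm_kernel_le hζ1 hζn hr01
        have hP : poissonKernel 0 w ζ = (1 - r ^ 2) / ‖ζ - r * ζ₀‖ ^ 2 := by
          rw [poissonKernel_def, sub_zero, sub_zero, hζ1, hwn, one_pow]
        have hd1 : ‖ζ - ζ₀‖ ≤ 2 * ‖ζ - r * ζ₀‖ := by
          have e1 : ‖(r : ℂ) * ζ₀ - ζ₀‖ = 1 - r := by
            rw [show (r : ℂ) * ζ₀ - ζ₀ = -((1 - r : ℝ) * ζ₀) by push_cast; ring, norm_neg, norm_mul,
              hζn, mul_one, Complex.norm_real, Real.norm_of_nonneg (by linarith [hr01.2])]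
          have e2 : 1 - r ≤ ‖ζ - r * ζ₀‖ := by
            have := norm_sub_norm_le ζ (r * ζ₀)
            rw [hζ1, ← hw, hwn] at this
            exact this
          calc ‖ζ - ζ₀‖ = ‖(ζ - r * ζ₀) + (r * ζ₀ - ζ₀)‖ := by congr 1; ring
            _ ≤ ‖ζ - r * ζ₀‖ + ‖(r : ℂ) * ζ₀ - ζ₀‖ := norm_add_le _ _
            _ ≤ _ := by linarith
        have hDpos : 0 < ‖ζ - r * ζ₀‖ := by
          have := norm_sub_norm_le ζ (r * ζ₀)
          rw [hζ1, ← hw, hwn] at this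
          linarith [hr01.2]
        set Δ := ‖ζ - r * ζ₀‖ with hΔ
        have h1r : 0 ≤ 1 - r ^ 2 := by nlinarith [hr01.1, hr01.2]
        have hsub : (G - ℓ) ζ = G ζ - G ζ₀ - c * (ζ - ζ₀) := by simp [hℓ]; ring
        rw [norm_mul, hsub, hP]
        calc _ ≤ 2 * (1 - r ^ 2) / Δ ^ 3 * (ε / 8 * ‖ζ - ζ₀‖ + M * ‖ζ - ζ₀‖ ^ 3) := by
              gcongr
          _ ≤ 2 * (1 - r ^ 2) / Δ ^ 3 * (ε / 8 * (2 * Δ) + M * (2 * Δ) ^ 3) := by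
              gcongr
          _ = _ := by field_simp; ring
    _ = 4 * (ε / 8) + 16 * M * (1 - r ^ 2) := by
        rw [Real.circleAverage_fun_add (f₁ := fun ζ => 4 * (ε / 8) * poissonKernel 0 w ζ)
          (f₂ := fun _ => 16 * M * (1 - r ^ 2)) ((continuousOn_const.mul hkc).circleIntegrable zero_le_one)
          (continuousOn_const.circleIntegrable zero_le_one), Real.circleAverage_const]
        have := Real.circleAverage_fun_smul (a := 4 * (ε / 8)) (f := poissonKernel 0 w) (c := 0) (R := 1)
        simp only [smul_eq_mul] at this
        rw [this, circleAverage_poissonKernel hwb, mul_one]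

/-- **Fatou's theorem** for bounded holomorphic functions on the unit disc. -/
theorem ae_tendsto_radial_of_bounded {f : ℂ → ℂ} (hf : DifferentiableOn ℂ f (Metric.ball 0 1))
    {M : ℝ} (hM : ∀ z ∈ Metric.ball (0 : ℂ) 1, ‖f z‖ ≤ M) :
    ∀ᵐ θ : ℝ, ∃ c : ℂ, Tendsto (fun r : ℝ => f (circleMap 0 r θ)) (𝓝[<] 1) (𝓝 c) := by
  -- A primitive of a bounded function is Lipschitz, hence extends to the closed disc with boundary
  -- values differentiable almost everywhere; `f` is the derivative of that extension inside.
  obtain ⟨F, hF⟩ := hf.isExactOn_ball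
  have hM' : ∀ z ∈ Metric.ball (0 : ℂ) 1, ‖f z‖₊ ≤ M.toNNReal := fun z hz => by
    rw [← norm_toNNReal]; exact Real.toNNReal_le_toNNReal (hM z hz)
  have hLip : LipschitzOnWith M.toNNReal F (Metric.ball 0 1) :=
    (convex_ball 0 1).lipschitzOnWith_of_nnnorm_hasDerivWithin_le
      (fun z hz => (hF z hz).hasDerivWithinAt) hM'
  obtain ⟨G, hG, hGF⟩ := hLip.extend_finite_dimension
  have hder : ∀ z ∈ Metric.ball (0 : ℂ) 1, HasDerivAt G (f z) z := fun z hz =>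
    (hF z hz).congr_of_eventuallyEq
      (Filter.eventually_of_mem (Metric.isOpen_ball.mem_nhds hz) fun w hw => (hGF hw).symm)
  have hdc : DiffContOnCl ℂ G (Metric.ball 0 1) :=
    ⟨fun z hz => (hder z hz).differentiableAt.differentiableWithinAt, hG.continuous.continuousOn⟩
  have hlc : LipschitzWith _ (fun θ : ℝ => G (circleMap 0 1 θ)) :=
    hG.comp (lipschitzWith_circleMap 0 1)
  filter_upwards [hlc.ae_differentiableAt] with θ hθ
  obtain ⟨c, hc⟩ := tendsto_deriv_radial hdc hθ.hasDerivAt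
  refine ⟨c, hc.congr' ?_⟩
  filter_upwards [Ioo_mem_nhdsLT (zero_lt_one' ℝ)] with r hr
  exact (hder _ (by simp [abs_of_pos hr.1, hr.2])).deriv

/-! ### Means over circles as integrals over angles. -/

/-- The normalised Lebesgue measure on the interval `(0, 2π]` of angles. -/
noncomputable def angleMeasure : Measure ℝ :=
  (ENNReal.ofReal (2 * Real.pi))⁻¹ • volume.restrict (Ioc 0 (2 * Real.pi))

instance : IsProbabilityMeasure angleMeasure := ⟨by
  have : ENNReal.ofReal (2 * Real.pi) ≠ 0 := by
    rw [Ne, ENNReal.ofReal_eq_zero, not_le]; positivity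
  simp only [angleMeasure, Measure.smul_apply, Measure.restrict_apply_univ, Real.volume_Ioc,
    sub_zero, smul_eq_mul]
  exact ENNReal.inv_mul_cancel this ENNReal.ofReal_ne_top⟩

theorem angleMeasure_absolutelyContinuous : angleMeasure ≪ volume :=
  (Measure.smul_absolutelyContinuous).trans Measure.restrict_le_self.absolutelyContinuous

theorem circleAverage_eq_integral_angleMeasure {E : Type*} [NormedAddCommGroup E]
    [NormedSpace ℝ E] (f : ℂ → E) (c : ℂ) (R : ℝ) :
    Real.circleAverage f c R = ∫ θ, f (circleMap c R θ) ∂angleMeasure := by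
  rw [Real.circleAverage_def, angleMeasure, integral_smul_measure,
    intervalIntegral.integral_of_le (by positivity), ENNReal.toReal_inv,
    ENNReal.toReal_ofReal (by positivity)]

theorem lintegral_angleMeasure_eq_ofReal_circleAverage {F : ℂ → ℝ} {R : ℝ} (hR : 0 ≤ R)
    (hF : ContinuousOn F (Metric.sphere 0 R)) (h0 : ∀ z ∈ Metric.sphere (0 : ℂ) R, 0 ≤ F z) :
    ∫⁻ θ, ENNReal.ofReal (F (circleMap 0 R θ)) ∂angleMeasure =
      ENNReal.ofReal (Real.circleAverage F 0 R) := by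
  have hm : ∀ θ, circleMap 0 R θ ∈ Metric.sphere (0 : ℂ) R := circleMap_mem_sphere 0 hR
  have hc : Continuous fun θ => F (circleMap 0 R θ) :=
    hF.comp_continuous (continuous_circleMap 0 R) hm
  obtain ⟨C, hC⟩ := (isCompact_sphere (0 : ℂ) R).exists_bound_of_continuousOn hF
  rw [circleAverage_eq_integral_angleMeasure, ofReal_integral_eq_lintegral_ofReal]
  · exact Integrable.of_bound hc.aestronglyMeasurable C (Eventually.of_forall fun θ => hC _ (hm θ))
  · exact Eventually.of_forall fun θ => h0 _ (hm θ)

theorem ofReal_norm_rpow {E : Type*} [NormedAddCommGroup E] (x : E) {q : ℝ} (hq : 0 ≤ q) :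
    ENNReal.ofReal (‖x‖ ^ q) = ‖x‖ₑ ^ q := by
  rw [← ENNReal.ofReal_rpow_of_nonneg (norm_nonneg _) hq, ofReal_norm]

theorem mul_circleMap (R r θ : ℝ) : (R : ℂ) * circleMap 0 r θ = circleMap 0 (R * r) θ := by
  simp [circleMap, mul_assoc]

theorem lintegral_enorm_rpow_eq_circleAverage {k : ℂ → ℂ}
    (hk : DifferentiableOn ℂ k (Metric.ball 0 1)) {q : ℝ} (hq : 0 < q) {r : ℝ}
    (hr : r ∈ Ioo (0 : ℝ) 1) :
    ∫⁻ θ, ‖k (circleMap 0 r θ)‖ₑ ^ q ∂angleMeasure =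
      ENNReal.ofReal (Real.circleAverage (fun z => ‖k z‖ ^ q) 0 r) := by
  have hc : ContinuousOn (fun z => ‖k z‖ ^ q) (Metric.sphere 0 r) :=
    ((hk.continuousOn.mono (Metric.sphere_subset_closedBall.trans
      (Metric.closedBall_subset_ball hr.2))).norm).rpow_const fun _ _ => Or.inr hq.le
  rw [← lintegral_angleMeasure_eq_ofReal_circleAverage hr.1.le hc fun z _ => by positivity]
  exact lintegral_congr fun θ => (ofReal_norm_rpow _ hq.le).symm

theorem continuousOn_norm_rpow {k : ℂ → ℂ} {s : Set ℂ} (hk : ContinuousOn k s) {q : ℝ}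
    (hq : 0 < q) : ContinuousOn (fun z => ‖k z‖ ^ q) s :=
  hk.norm.rpow_const fun _ _ => Or.inr hq.le

/-- The `p`-means of a holomorphic function on circles around the origin are increasing. -/
theorem lintegral_enorm_rpow_circleMap_mono {k : ℂ → ℂ}
    (hk : DifferentiableOn ℂ k (Metric.ball 0 1)) {q : ℝ} (hq : 0 < q) {r R : ℝ}
    (hr : 0 < r) (hrR : r ≤ R) (hR : R < 1) :
    ∫⁻ θ, ‖k (circleMap 0 r θ)‖ₑ ^ q ∂angleMeasure ≤
      ∫⁻ θ, ‖k (circleMap 0 R θ)‖ₑ ^ q ∂angleMeasure := by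
  rw [lintegral_enorm_rpow_eq_circleAverage hk hq ⟨hr, hrR.trans_lt hR⟩,
    lintegral_enorm_rpow_eq_circleAverage hk hq ⟨hr.trans_le hrR, hR⟩]
  refine ENNReal.ofReal_le_ofReal ?_
  exact ((hk.mono (Metric.ball_subset_ball hR.le)).locallySubmean_norm_rpow
    Metric.isOpen_ball hq).circleAverage_mono hr.le hrR (hr.trans_le hrR)
      (continuousOn_norm_rpow (hk.continuousOn.mono (Metric.closedBall_subset_ball hR)) hq)

theorem continuous_poissonKernel_circleMap {w : ℂ} (hw : w ∈ Metric.ball (0 : ℂ) 1) :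
    Continuous fun θ => poissonKernel 0 w (circleMap 0 1 θ) :=
  (continuousOn_poissonKernel_sphere hw).comp_continuous (continuous_circleMap 0 1)
    (circleMap_mem_sphere 0 zero_le_one)

theorem poissonKernel_circleMap_pos {w : ℂ} (hw : w ∈ Metric.ball (0 : ℂ) 1) (θ : ℝ) :
    0 < poissonKernel 0 w (circleMap 0 1 θ) := by
  rw [mem_ball_zero_iff] at hw
  have h : circleMap 0 1 θ - w ≠ 0 := by
    intro h
    rw [sub_eq_zero] at h
    rw [← h] at hw; simp at hw
  rw [poissonKernel_def]
  simp only [sub_zero, norm_circleMap_zero, abs_one, one_pow]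
  refine div_pos ?_ (by positivity)
  nlinarith [norm_nonneg w]

theorem lintegral_poissonKernel {w : ℂ} (hw : w ∈ Metric.ball (0 : ℂ) 1) :
    ∫⁻ θ, ENNReal.ofReal (poissonKernel 0 w (circleMap 0 1 θ)) ∂angleMeasure = 1 := by
  rw [lintegral_angleMeasure_eq_ofReal_circleAverage zero_le_one
    (continuousOn_poissonKernel_sphere hw), circleAverage_poissonKernel hw, ENNReal.ofReal_one]
  intro z hz
  rw [mem_sphere_zero_iff_norm] at hz
  rw [mem_ball_zero_iff] at hw
  exact poissonKernel_nonneg (by rw [hz]; exact hw.le)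

theorem enorm_rpow_le_lintegral_poissonKernel {k : ℂ → ℂ} {R : ℝ} (hR : 0 < R)
    (hkc : ContinuousOn k (Metric.closedBall 0 R))
    (hk : DifferentiableOn ℂ k (Metric.ball 0 R)) {q : ℝ} (hq : 0 < q) {w : ℂ}
    (hw : w ∈ Metric.ball (0 : ℂ) 1) :
    ‖k (R * w)‖ₑ ^ q ≤ ∫⁻ θ, ENNReal.ofReal (poissonKernel 0 w (circleMap 0 1 θ)) *
      ‖k (circleMap 0 R θ)‖ₑ ^ q ∂angleMeasure := by
  set κ : ℂ → ℂ := fun z => k (R * z) with hκ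
  have hm : MapsTo (fun z : ℂ => (R : ℂ) * z) (Metric.closedBall 0 1) (Metric.closedBall 0 R) := by
    intro z hz
    rw [mem_closedBall_zero_iff] at hz ⊢
    rw [norm_mul, Complex.norm_real, Real.norm_of_nonneg hR.le]
    nlinarith
  have hm' : MapsTo (fun z : ℂ => (R : ℂ) * z) (Metric.ball 0 1) (Metric.ball 0 R) := by
    intro z hz
    rw [mem_ball_zero_iff] at hz ⊢
    rw [norm_mul, Complex.norm_real, Real.norm_of_nonneg hR.le]
    nlinarith
  have hκc : ContinuousOn κ (Metric.closedBall 0 1) := hkc.comp (by fun_prop) hm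
  have hκd : DifferentiableOn ℂ κ (Metric.ball 0 1) := hk.comp (by fun_prop) hm'
  have hvc := continuousOn_norm_rpow hκc hq
  have h1 := (hκd.locallySubmean_norm_rpow Metric.isOpen_ball hq).le_circleAverage_poissonKernel
    hvc hw
  have hpk : ∀ z ∈ Metric.sphere (0 : ℂ) 1, 0 ≤ poissonKernel 0 w z := fun z hz =>
    poissonKernel_nonneg (by
      rw [mem_sphere_zero_iff_norm] at hz; rw [mem_ball_zero_iff] at hw; linarith)
  rw [← ofReal_norm_rpow _ hq.le]
  refine (ENNReal.ofReal_le_ofReal h1).trans_eq ?_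
  rw [← lintegral_angleMeasure_eq_ofReal_circleAverage
    (F := fun z => poissonKernel 0 w z * ‖κ z‖ ^ q) zero_le_one
    ((continuousOn_poissonKernel_sphere hw).mul (hvc.mono Metric.sphere_subset_closedBall))
    fun z hz => mul_nonneg (hpk z hz) (by positivity)]
  refine lintegral_congr fun θ => ?_
  rw [ENNReal.ofReal_mul (hpk _ (circleMap_mem_sphere 0 zero_le_one θ)), ofReal_norm_rpow _ hq.le]
  simp only [hκ, mul_circleMap, mul_one]

/-- An increasing sequence of radii in `(0, 1)` that tends to `1`. -/
noncomputable def radius (j : ℕ) : ℝ := 1 - 1 / ((j : ℝ) + 2)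

theorem radius_mem (j : ℕ) : radius j ∈ Ioo (0 : ℝ) 1 := by
  unfold radius
  have h : (0 : ℝ) < (j : ℝ) + 2 := by positivity
  constructor
  · rw [sub_pos, div_lt_one h]; linarith [(Nat.cast_nonneg j : (0 : ℝ) ≤ j)]
  · have : 0 < 1 / ((j : ℝ) + 2) := by positivity
    linarith

theorem radius_mono : Monotone radius := by
  intro i j hij
  unfold radius
  have : (i : ℝ) ≤ j := by exact_mod_cast hij
  gcongr

theorem tendsto_radius : Tendsto radius atTop (𝓝[<] 1) := by
  refine tendsto_nhdsWithin_iff.2 ⟨?_, Eventually.of_forall fun j => (radius_mem j).2⟩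
  have h1 : Tendsto (fun j : ℕ => (j : ℝ) + 2) atTop atTop :=
    tendsto_atTop_add_const_right _ _ tendsto_natCast_atTop_atTop
  have h2 := (tendsto_const_nhds (x := (1 : ℝ))).sub (h1.inv_tendsto_atTop)
  rw [sub_zero] at h2
  exact h2.congr fun j => by simp [radius]

theorem tendsto_radius_nhds : Tendsto radius atTop (𝓝 1) :=
  tendsto_radius.mono_right nhdsWithin_le_nhds

theorem continuous_comp_circleMap {k : ℂ → ℂ} (hk : ContinuousOn k (Metric.ball 0 1)) {r : ℝ}
    (hr : r ∈ Ioo (0 : ℝ) 1) : Continuous fun θ => k (circleMap 0 r θ) :=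
  hk.comp_continuous (continuous_circleMap 0 r) fun θ => by simp [abs_of_pos hr.1, hr.2]

theorem aemeasurable_radial_limit {k : ℂ → ℂ} (hk : ContinuousOn k (Metric.ball 0 1))
    {u : ℝ → ℂ} (hu : ∀ᵐ θ ∂angleMeasure,
      Tendsto (fun r : ℝ => k (circleMap 0 r θ)) (𝓝[<] 1) (𝓝 (u θ))) :
    AEMeasurable u angleMeasure :=
  aemeasurable_of_tendsto_metrizable_ae atTop
    (fun j => (continuous_comp_circleMap hk (radius_mem j)).measurable.aemeasurable)
    (hu.mono fun _ h => h.comp tendsto_radius)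

/-! ### Poisson majorisation by radial limits, and their nonvanishing. -/

/-- Poisson majorisation by the boundary values, for exponents below that of the Hardy space. -/
theorem enorm_rpow_le_lintegral_poissonKernel_limit {k : ℂ → ℂ}
    (hk : DifferentiableOn ℂ k (Metric.ball 0 1)) {q : ℝ} (hq : 0 < q) {M : ℝ≥0∞} (hM : M ≠ ⊤)
    (hbd : ∀ r ∈ Ioo (0 : ℝ) 1, ∫⁻ θ, ‖k (circleMap 0 r θ)‖ₑ ^ (2 * q) ∂angleMeasure ≤ M)
    {u : ℝ → ℂ} (hu : ∀ᵐ θ ∂angleMeasure,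
      Tendsto (fun r : ℝ => k (circleMap 0 r θ)) (𝓝[<] 1) (𝓝 (u θ)))
    {w : ℂ} (hw : w ∈ Metric.ball (0 : ℂ) 1) :
    ‖k w‖ₑ ^ q ≤ ∫⁻ θ, ENNReal.ofReal (poissonKernel 0 w (circleMap 0 1 θ)) *
      ‖u θ‖ₑ ^ q ∂angleMeasure := by
  set P : ℝ → ℝ≥0∞ := fun θ => ENNReal.ofReal (poissonKernel 0 w (circleMap 0 1 θ)) with hP
  have hPm : Measurable P := (continuous_poissonKernel_circleMap hw).measurable.ennreal_ofReal
  obtain ⟨C, hC⟩ : ∃ C : ℝ≥0, ∀ θ, P θ ≤ C := by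
    obtain ⟨C, hC⟩ := (isCompact_sphere (0 : ℂ) 1).exists_bound_of_continuousOn
      (continuousOn_poissonKernel_sphere hw)
    exact ⟨C.toNNReal, fun θ => ENNReal.ofReal_le_ofReal
      ((le_abs_self _).trans (hC _ (circleMap_mem_sphere 0 zero_le_one θ)))⟩
  -- Truncation at height `A`: the bounded part passes to the limit by dominated convergence, and
  -- the excess is at most `x ^ (2 * q) / A`, controlled by the uniform bound for the exponent `2 *
  -- q`. Finally `A → ∞`.
  have key : ∀ A : ℝ≥0, A ≠ 0 → ‖k w‖ₑ ^ q ≤ (∫⁻ θ, P θ * ‖u θ‖ₑ ^ q ∂angleMeasure) + C * M / A := by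
    intro A hA
    have hA' : (A : ℝ≥0∞) ≠ 0 := by exact_mod_cast hA
    have hpt : ∀ x : ℝ≥0∞, x ^ q ≤ min (x ^ q) A + x ^ (2 * q) / A := by
      intro x
      rcases le_total (x ^ q) A with h | h
      · rw [min_eq_left h]; exact le_self_add
      · refine le_trans ?_ le_add_self
        rw [ENNReal.le_div_iff_mul_le (Or.inl hA') (Or.inl ENNReal.coe_ne_top), two_mul,
          ENNReal.rpow_add_of_nonneg _ _ hq.le hq.le]
        gcongr
    have h1 : ∀ j, ‖k (radius j * w)‖ₑ ^ q ≤
        (∫⁻ θ, P θ * min (‖k (circleMap 0 (radius j) θ)‖ₑ ^ q) A ∂angleMeasure) + C * M / A := by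
      intro j
      have hr := radius_mem j
      have hcm := (continuous_comp_circleMap hk.continuousOn hr).measurable.enorm
      calc _ ≤ ∫⁻ θ, P θ * ‖k (circleMap 0 (radius j) θ)‖ₑ ^ q ∂angleMeasure :=
            enorm_rpow_le_lintegral_poissonKernel hr.1
              (hk.continuousOn.mono (Metric.closedBall_subset_ball hr.2))
              (hk.mono (Metric.ball_subset_ball hr.2.le)) hq hw
        _ ≤ ∫⁻ θ, (P θ * min (‖k (circleMap 0 (radius j) θ)‖ₑ ^ q) A +
              C * (A : ℝ≥0∞)⁻¹ * ‖k (circleMap 0 (radius j) θ)‖ₑ ^ (2 * q)) ∂angleMeasure := by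
            refine lintegral_mono fun θ => ?_
            refine (mul_le_mul_right (hpt _) (P θ)).trans ?_
            rw [mul_add]
            refine add_le_add le_rfl ?_
            rw [div_eq_mul_inv, mul_comm (_ ^ _), ← mul_assoc]
            exact mul_le_mul_left (mul_le_mul_left (hC θ) _) _
        _ = (∫⁻ θ, P θ * min (‖k (circleMap 0 (radius j) θ)‖ₑ ^ q) A ∂angleMeasure) +
              C * (A : ℝ≥0∞)⁻¹ * ∫⁻ θ, ‖k (circleMap 0 (radius j) θ)‖ₑ ^ (2 * q) ∂angleMeasure := by
            rw [lintegral_add_left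
              (f := fun θ => P θ * min (‖k (circleMap 0 (radius j) θ)‖ₑ ^ q) A)
              (hPm.mul ((hcm.pow_const q).min measurable_const)),
              lintegral_const_mul _ (hcm.pow_const _)]
        _ ≤ _ := by
            rw [div_eq_mul_inv, mul_right_comm]
            gcongr
            exact hbd _ hr
    have h2 : Tendsto (fun j => ‖k (radius j * w)‖ₑ ^ q) atTop (𝓝 (‖k w‖ₑ ^ q)) := by
      have h3 : Tendsto (fun j => (radius j : ℂ) * w) atTop (𝓝 w) := by
        have := ((Complex.continuous_ofReal.tendsto 1).comp tendsto_radius_nhds).mul_const w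
        simpa using this
      have h4 := (hk.continuousOn.continuousAt (Metric.isOpen_ball.mem_nhds hw)).tendsto.comp h3
      exact (ENNReal.continuous_rpow_const.tendsto _).comp h4.enorm
    have h3 : Tendsto (fun j => ∫⁻ θ, P θ * min (‖k (circleMap 0 (radius j) θ)‖ₑ ^ q) A ∂angleMeasure)
        atTop (𝓝 (∫⁻ θ, P θ * min (‖u θ‖ₑ ^ q) A ∂angleMeasure)) := by
      refine tendsto_lintegral_of_dominated_convergence (fun _ => (C : ℝ≥0∞) * A) (fun j => ?_)
        (fun j => ?_) ?_ ?_
      · exact hPm.mul (((continuous_comp_circleMap hk.continuousOn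
          (radius_mem j)).measurable.enorm.pow_const q).min measurable_const)
      · exact Eventually.of_forall fun θ => mul_le_mul' (hC θ) (min_le_right _ _)
      · simp [ENNReal.mul_ne_top]
      · filter_upwards [hu] with θ hθ
        have h5 := (hθ.comp tendsto_radius).enorm
        have h6 := (ENNReal.continuous_rpow_const (y := q)).tendsto _ |>.comp h5
        have h7 := h6.min (tendsto_const_nhds (x := (A : ℝ≥0∞)))
        exact ENNReal.Tendsto.const_mul h7 (Or.inr ((hC θ).trans_lt ENNReal.coe_lt_top).ne)
    refine (le_of_tendsto_of_tendsto' h2 (h3.add_const _) h1).trans ?_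
    gcongr
    exact min_le_left _ _
  have hlim : Tendsto (fun A : ℕ => (∫⁻ θ, P θ * ‖u θ‖ₑ ^ q ∂angleMeasure) +
      C * M / ((A + 1 : ℕ) : ℝ≥0∞)) atTop (𝓝 ((∫⁻ θ, P θ * ‖u θ‖ₑ ^ q ∂angleMeasure) + 0)) := by
    refine tendsto_const_nhds.add ?_
    simp only [div_eq_mul_inv]
    have := ENNReal.Tendsto.const_mul (a := C * M)
      (ENNReal.tendsto_inv_nat_nhds_zero.comp (tendsto_add_atTop_nat 1))
      (Or.inr (ENNReal.mul_ne_top ENNReal.coe_ne_top hM))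
    simpa using this
  rw [add_zero] at hlim
  refine ge_of_tendsto' hlim fun A => ?_
  have := key ((A + 1 : ℕ) : ℝ≥0) (by positivity)
  simpa using this

/-- A bounded holomorphic function that does not vanish identically has radial limits that vanish
almost nowhere. -/
theorem ae_radial_limit_ne_zero {f : ℂ → ℂ} (hf : DifferentiableOn ℂ f (Metric.ball 0 1))
    (hb : ∀ z ∈ Metric.ball (0 : ℂ) 1, ‖f z‖ ≤ 1) {a : ℂ} (ha : a ∈ Metric.ball (0 : ℂ) 1)
    (hfa : f a ≠ 0) {u : ℝ → ℂ} (hu : ∀ᵐ θ ∂angleMeasure,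
      Tendsto (fun r : ℝ => f (circleMap 0 r θ)) (𝓝[<] 1) (𝓝 (u θ))) :
    ∀ᵐ θ ∂angleMeasure, u θ ≠ 0 := by
  set P : ℝ → ℝ≥0∞ := fun θ => ENNReal.ofReal (poissonKernel 0 a (circleMap 0 1 θ)) with hP
  have hPm : Measurable P := (continuous_poissonKernel_circleMap ha).measurable.ennreal_ofReal
  wlog hum : Measurable u generalizing u
  · have h1 := aemeasurable_radial_limit hf.continuousOn hu
    have h2 := this (u := h1.mk u) (by
      filter_upwards [hu, h1.ae_eq_mk] with θ h3 h4
      rwa [← h4]) h1.measurable_mk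
    filter_upwards [h2, h1.ae_eq_mk] with θ h3 h4
    rwa [h4]
  have hN : MeasurableSet {θ | u θ = 0} := hum (measurableSet_singleton (0 : ℂ))
  have hule : ∀ᵐ θ ∂angleMeasure, ‖u θ‖ₑ ≤ 1 := by
    filter_upwards [hu] with θ hθ
    refine le_of_tendsto hθ.enorm ?_
    filter_upwards [Ioo_mem_nhdsLT (zero_lt_one' ℝ)] with r hr
    have := hb (circleMap 0 r θ) (by simp [abs_of_pos hr.1, hr.2])
    rw [← ofReal_norm]
    simpa using ENNReal.ofReal_le_ofReal this
  -- As `|u| ≤ 1`, the right side is at most the Poisson mass of the set where `u ≠ 0`, for every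
  -- exponent. Letting `q → 0` sends the left side to `1`, so the zero set has Poisson mass `0`, and
  -- the kernel is positive.
  have h1 : ∀ q : ℝ, 0 < q → ‖f a‖ₑ ^ q ≤ ∫⁻ θ in {θ | u θ = 0}ᶜ, P θ ∂angleMeasure := by
    intro q hq
    refine (enorm_rpow_le_lintegral_poissonKernel_limit hf hq (M := 1) ENNReal.one_ne_top ?_ hu
      ha).trans ?_
    · intro r hr
      refine (lintegral_mono (g := fun _ => 1) fun θ => ?_).trans (by simp)
      have := hb (circleMap 0 r θ) (by simp [abs_of_pos hr.1, hr.2])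
      refine ENNReal.rpow_le_one ?_ (by positivity)
      rw [← ofReal_norm]
      simpa using ENNReal.ofReal_le_ofReal this
    · rw [← lintegral_indicator hN.compl]
      refine lintegral_mono_ae ?_
      filter_upwards [hule] with θ hθ
      by_cases h0 : u θ = 0
      · simp [h0, ENNReal.zero_rpow_of_pos hq]
      · rw [indicator_of_mem (by exact h0)]
        exact mul_le_of_le_one_right' (ENNReal.rpow_le_one hθ hq.le)
  have h2 : 1 ≤ ∫⁻ θ in {θ | u θ = 0}ᶜ, P θ ∂angleMeasure := by
    have hlim : Tendsto (fun j : ℕ => ‖f a‖ₑ ^ (1 / ((j : ℝ) + 1))) atTop (𝓝 1) := by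
      have := tendsto_one_div_add_atTop_nhds_zero_nat (𝕜 := ℝ)
      have h3 := ENNReal.tendsto_ofReal
        ((Real.continuousAt_const_rpow (a := ‖f a‖) (b := 0) (by simpa using hfa)).tendsto.comp this)
      rw [Real.rpow_zero, ENNReal.ofReal_one] at h3
      exact h3.congr fun j => ofReal_norm_rpow _ (by positivity)
    exact le_of_tendsto' hlim fun j => h1 _ (by positivity)
  have h3 : ∫⁻ θ in {θ | u θ = 0}, P θ ∂angleMeasure = 0 := by
    have h4 := lintegral_add_compl (μ := angleMeasure) P hN
    rw [lintegral_poissonKernel ha] at h4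
    have h5 : ∫⁻ θ in {θ | u θ = 0}ᶜ, P θ ∂angleMeasure ≠ ⊤ :=
      (lt_of_le_of_lt (le_add_self.trans h4.le) ENNReal.one_lt_top).ne
    have h6 : (∫⁻ θ in {θ | u θ = 0}, P θ ∂angleMeasure) + 1 ≤ 0 + 1 := by
      rw [zero_add]; nth_rewrite 2 [← h4]; gcongr
    exact le_antisymm ((ENNReal.add_le_add_iff_right ENNReal.one_ne_top).1 h6) zero_le
  rw [setLIntegral_eq_zero_iff hN hPm] at h3
  filter_upwards [h3] with θ hθ h0
  have := hθ h0
  simp only [hP, ENNReal.ofReal_eq_zero] at this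
  exact absurd (poissonKernel_circleMap_pos ha θ) (not_lt.2 this)

/-! ### Harmonic majorants and radial limits in the Hardy space of the disc. -/

/-- The Herglotz integral over the circle of radius `R` of the real function `v`. -/
noncomputable def herglotzIntegral (v : ℂ → ℝ) (R : ℝ) (z : ℂ) : ℂ :=
  Real.circleAverage (fun ζ => herglotzRieszKernel 0 z ζ • (v ζ : ℂ)) 0 R

theorem herglotzIntegral_re {v : ℂ → ℝ} {R : ℝ} (hv : ContinuousOn v (Metric.sphere 0 R)) {z : ℂ}
    (hz : z ∈ Metric.ball 0 R) :
    (herglotzIntegral v R z).re = Real.circleAverage (fun ζ => poissonKernel 0 z ζ * v ζ) 0 R := by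
  have hR : 0 < R := Metric.pos_of_mem_ball hz
  rw [herglotzIntegral, re_circleAverage_herglotzRieszKernel_smul (hv.circleIntegrable hR.le) hz,
    ← poissonKernel_eq_re_herglotzRieszKernel]
  rfl

theorem herglotzIntegral_zero {v : ℂ → ℝ} {R : ℝ} (hR : 0 < R)
    (hv : ContinuousOn v (Metric.sphere 0 R)) :
    herglotzIntegral v R 0 = (Real.circleAverage v 0 R : ℝ) := by
  have h := Complex.ofRealCLM.circleAverage_comp_comm (hv.circleIntegrable hR.le)
  rw [show ((Real.circleAverage v 0 R : ℝ) : ℂ) = Complex.ofRealCLM (Real.circleAverage v 0 R) from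
    rfl, ← h, herglotzIntegral]
  refine Real.circleAverage_congr_sphere fun ζ hζ => ?_
  rw [abs_of_pos hR, mem_sphere_zero_iff_norm] at hζ
  have : ζ ≠ 0 := by rintro rfl; simp at hζ; linarith
  simp [herglotzRieszKernel_def, this]

theorem herglotzIntegral_differentiableOn {v : ℂ → ℝ} {R : ℝ} (hR : 0 < R)
    (hv : ContinuousOn v (Metric.sphere 0 R)) :
    DifferentiableOn ℂ (herglotzIntegral v R) (Metric.ball 0 R) :=
  differentiableOn_circleAverage_herglotzRieszKernel_smul
    ((Complex.continuous_ofReal.comp_continuousOn hv).circleIntegrable hR.le)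

/-- The Borel–Carathéodory inequality as the bound on the real part tends to `0`. It serves as
Harnack's inequality for the harmonic majorants and also controls their conjugates. -/
theorem norm_le_of_re_nonpos {f : ℂ → ℂ} {R : ℝ} (hf : DifferentiableOn ℂ f (Metric.ball 0 R))
    (hre : ∀ z ∈ Metric.ball (0 : ℂ) R, (f z).re ≤ 0) {z : ℂ} (hz : z ∈ Metric.ball 0 R) :
    ‖f z‖ ≤ ‖f 0‖ * (R + ‖z‖) / (R - ‖z‖) := by
  have hlim : Tendsto (fun M : ℝ => 2 * M * ‖z‖ / (R - ‖z‖) + ‖f 0‖ * (R + ‖z‖) / (R - ‖z‖))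
      (𝓝[>] 0) (𝓝 (2 * 0 * ‖z‖ / (R - ‖z‖) + ‖f 0‖ * (R + ‖z‖) / (R - ‖z‖))) :=
    (Continuous.tendsto (by fun_prop) 0).mono_left nhdsWithin_le_nhds
  have h0 : 2 * 0 * ‖z‖ / (R - ‖z‖) + ‖f 0‖ * (R + ‖z‖) / (R - ‖z‖) =
      ‖f 0‖ * (R + ‖z‖) / (R - ‖z‖) := by simp
  rw [h0] at hlim
  refine ge_of_tendsto hlim ?_
  filter_upwards [self_mem_nhdsWithin] with M hM
  exact Complex.borelCaratheodory hM hf (fun w hw => (hre w hw).trans (le_of_lt hM))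
    (Metric.pos_of_mem_ball hz) hz

/-- A locally submean function with bounded circle means has a harmonic majorant. -/
theorem LocallySubmean.exists_differentiableOn_re_majorant {v : ℂ → ℝ}
    (hc : ContinuousOn v (Metric.ball 0 1)) (hv : LocallySubmean v (Metric.ball 0 1)) {M : ℝ}
    (hM : ∀ r ∈ Ioo (0 : ℝ) 1, Real.circleAverage v 0 r ≤ M) :
    ∃ F : ℂ → ℂ, DifferentiableOn ℂ F (Metric.ball 0 1) ∧
      ∀ z ∈ Metric.ball (0 : ℂ) 1, v z ≤ (F z).re := by
  set F : ℕ → ℂ → ℂ := fun j => herglotzIntegral v (radius j) with hF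
  set m : ℕ → ℝ := fun j => Real.circleAverage v 0 (radius j) with hm
  have hcB : ∀ j, ContinuousOn v (Metric.closedBall 0 (radius j)) := fun j =>
    hc.mono (Metric.closedBall_subset_ball (radius_mem j).2)
  have hcS : ∀ j, ContinuousOn v (Metric.sphere 0 (radius j)) := fun j =>
    (hcB j).mono Metric.sphere_subset_closedBall
  have hsub : ∀ j, LocallySubmean v (Metric.ball 0 (radius j)) := fun j z hz =>
    hv z (Metric.ball_subset_ball (radius_mem j).2.le hz)
  have hFd : ∀ j, DifferentiableOn ℂ (F j) (Metric.ball 0 (radius j)) := fun j =>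
    herglotzIntegral_differentiableOn (radius_mem j).1 (hcS j)
  have hFre : ∀ j, ∀ z ∈ Metric.ball (0 : ℂ) (radius j), v z ≤ (F j z).re := fun j z hz => by
    rw [hF, herglotzIntegral_re (hcS j) hz]
    exact (hsub j).le_circleAverage_poissonKernel (hcB j) hz
  have hmmono : Monotone m := fun i j hij =>
    (hsub j).circleAverage_mono (radius_mem i).1.le (radius_mono hij) (radius_mem j).1 (hcB j)
  have hmb : BddAbove (range m) := ⟨M, by rintro _ ⟨j, rfl⟩; exact hM _ (radius_mem j)⟩
  have hmlim := tendsto_atTop_ciSup hmmono hmb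
  set μ := ⨆ j, m j with hμ
  -- On the circle of radius `radius i`, `Re (F j)` dominates `v`; inside, `Re (F i)` is the Poisson
  -- integral of `v` and `Re (F j)` is that of its own values.
  have hFmono : ∀ i j, i ≤ j → ∀ z ∈ Metric.ball (0 : ℂ) (radius i), (F i z).re ≤ (F j z).re := by
    intro i j hij z hz
    rcases hij.eq_or_lt with rfl | hij'
    · exact le_rfl
    have hlt : radius i < radius j := by
      unfold radius
      have : (i : ℝ) < j := by exact_mod_cast hij'
      gcongr
    have hsubset := Metric.closedBall_subset_ball (x := (0 : ℂ)) hlt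
    have hk := continuousOn_poissonKernel_sphere hz
    have hcF : ContinuousOn (F j) (Metric.closedBall 0 (radius i)) :=
      (hFd j).continuousOn.mono hsubset
    have hFs : ContinuousOn (F j) (Metric.sphere 0 (radius i)) :=
      hcF.mono Metric.sphere_subset_closedBall
    have h1 := ((hFd j).diffContOnCl_ball hsubset).circleAverage_poissonKernel_smul hz
    have h2 := Complex.reCLM.circleAverage_comp_comm (f := poissonKernel 0 z • F j)
      (c := 0) (R := radius i) ((hk.smul hFs).circleIntegrable (radius_mem i).1.le)
    rw [h1] at h2
    rw [show (F j z).re = Complex.reCLM (F j z) from rfl, ← h2, hF, herglotzIntegral_re (hcS i) hz]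
    refine Real.circleAverage_mono ((hk.mul (hcS i)).circleIntegrable (radius_mem i).1.le)
      ((Complex.continuous_re.comp_continuousOn (hk.smul hFs)).circleIntegrable
        (radius_mem i).1.le) fun ζ hζ => ?_
    rw [abs_of_pos (radius_mem i).1] at hζ
    have hp : 0 ≤ poissonKernel 0 z ζ := poissonKernel_nonneg (by
      rw [mem_sphere_zero_iff_norm] at hζ; rw [mem_ball_zero_iff] at hz; linarith)
    have h3 := hFre j ζ (hsubset (Metric.sphere_subset_closedBall hζ))
    simpa using mul_le_mul_of_nonneg_left h3 hp
  -- `F i - F j` has nonpositive real part, and its value at `0` is the real number `m i - m j`.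
  -- Convergence of the bounded increasing means `m` therefore makes `F` locally uniformly Cauchy.
  have hdiff : ∀ i j, i ≤ j → ∀ z ∈ Metric.ball (0 : ℂ) (radius i),
      ‖F i z - F j z‖ ≤ (m j - m i) * (radius i + ‖z‖) / (radius i - ‖z‖) := by
    intro i j hij z hz
    have h1 := norm_le_of_re_nonpos (f := fun z => F i z - F j z) ((hFd i).sub
      ((hFd j).mono (Metric.ball_subset_ball (radius_mono hij))))
      (fun z hz => by simpa using hFmono i j hij z hz) hz
    have h2 : ‖F i 0 - F j 0‖ = m j - m i := by
      simp only [hF]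
      rw [herglotzIntegral_zero (radius_mem i).1 (hcS i),
        herglotzIntegral_zero (radius_mem j).1 (hcS j), ← Complex.ofReal_sub, Complex.norm_real,
        Real.norm_of_nonpos (sub_nonpos.2 (hmmono hij))]
      ring
    rwa [h2] at h1
  have hin : ∀ z ∈ Metric.ball (0 : ℂ) 1, ∃ N, z ∈ Metric.ball (0 : ℂ) (radius N) := by
    intro z hz
    rw [mem_ball_zero_iff] at hz
    obtain ⟨N, hN⟩ := (tendsto_radius_nhds.eventually (lt_mem_nhds hz)).exists
    exact ⟨N, by rwa [mem_ball_zero_iff]⟩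
  have hunif : ∀ N i j, N + 1 ≤ i → i ≤ j → ∀ z ∈ Metric.ball (0 : ℂ) (radius N),
      ‖F i z - F j z‖ ≤ (μ - m i) * (2 / (radius (N + 1) - radius N)) := by
    intro N i j hi hij z hz
    have hgap : 0 < radius (N + 1) - radius N := by
      rw [sub_pos]; unfold radius; push_cast; gcongr; linarith
    have hNi := radius_mono hi
    have hz' : ‖z‖ < radius N := by rwa [mem_ball_zero_iff] at hz
    have h1 := hdiff i j hij z (by rw [mem_ball_zero_iff]; linarith)
    have h2 : m j ≤ μ := le_ciSup hmb j
    have h3 : 0 ≤ m j - m i := sub_nonneg.2 (hmmono hij)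
    calc _ ≤ _ := h1
      _ = (m j - m i) * ((radius i + ‖z‖) / (radius i - ‖z‖)) := by ring
      _ ≤ _ := by
        have hi1 := (radius_mem i).2
        have hi0 := (radius_mem i).1
        have h4 : (radius i + ‖z‖) / (radius i - ‖z‖) ≤ 2 / (radius (N + 1) - radius N) :=
          div_le_div₀ zero_le_two (by linarith) hgap (by linarith)
        exact mul_le_mul (by linarith) h4
          (div_nonneg (by linarith [norm_nonneg z]) (by linarith)) (by linarith)
  have hblim : ∀ N, Tendsto (fun i => (μ - m i) * (2 / (radius (N + 1) - radius N))) atTop (𝓝 0) := by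
    intro N
    simpa using (hmlim.const_sub μ).mul_const (2 / (radius (N + 1) - radius N))
  have hlim : ∀ z ∈ Metric.ball (0 : ℂ) 1, ∃ c, Tendsto (fun j => F j z) atTop (𝓝 c) := by
    intro z hz
    obtain ⟨N, hN⟩ := hin z hz
    have hcs : CauchySeq fun l => F (l + (N + 1)) z :=
      cauchySeq_of_le_tendsto_0' _ (fun i j hij => by
        rw [dist_eq_norm]
        exact hunif N (i + (N + 1)) (j + (N + 1)) (by omega) (by omega) z hN)
        ((tendsto_add_atTop_iff_nat (N + 1)).2 (hblim N))
    obtain ⟨c, hc⟩ := cauchySeq_tendsto_of_complete hcs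
    exact ⟨c, (tendsto_add_atTop_iff_nat (f := fun j => F j z) (N + 1)).1 hc⟩
  choose! F' hF' using hlim
  refine ⟨F', ?_, fun z hz => ?_⟩
  · intro z hz
    obtain ⟨N, hN⟩ := hin z hz
    have htu : TendstoUniformlyOn F F' atTop (Metric.ball 0 (radius N)) := by
      rw [Metric.tendstoUniformlyOn_iff]
      intro ε hε
      filter_upwards [(hblim N).eventually (gt_mem_nhds hε), eventually_ge_atTop (N + 1)] with i h1 h2 x hx
      have hx1 := Metric.ball_subset_ball (radius_mem N).2.le hx
      have h3 : Tendsto (fun j => ‖F i x - F j x‖) atTop (𝓝 ‖F i x - F' x‖) :=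
        ((hF' x hx1).const_sub _).norm
      rw [dist_comm, dist_eq_norm]
      refine lt_of_le_of_lt (le_of_tendsto h3 ?_) h1
      filter_upwards [eventually_ge_atTop i] with j hj
      exact hunif N i j h2 hj x hx
    have hd := htu.tendstoLocallyUniformlyOn.differentiableOn (by
      filter_upwards [eventually_ge_atTop N] with i hi
      exact (hFd i).mono (Metric.ball_subset_ball (radius_mono hi))) Metric.isOpen_ball
    exact (hd.differentiableAt (Metric.isOpen_ball.mem_nhds hN)).differentiableWithinAt
  · obtain ⟨N, hN⟩ := hin z hz
    refine ge_of_tendsto ((Complex.continuous_re.tendsto _).comp (hF' z hz)) ?_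
    filter_upwards [eventually_ge_atTop N] with i hi
    exact hFre i z (Metric.ball_subset_ball (radius_mono hi) hN)

/-- Radial limits of functions in the Hardy space `H^p` of the disc. -/
theorem ae_tendsto_radial_of_hardy {k : ℂ → ℂ} (hk : DifferentiableOn ℂ k (Metric.ball 0 1))
    {p : ℝ} (hp : 0 < p) {M : ℝ≥0∞} (hM : M ≠ ⊤)
    (hbd : ∀ r ∈ Ioo (0 : ℝ) 1, ∫⁻ θ, ‖k (circleMap 0 r θ)‖ₑ ^ p ∂angleMeasure ≤ M) :
    ∀ᵐ θ ∂angleMeasure, ∃ c : ℂ,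
      Tendsto (fun r : ℝ => k (circleMap 0 r θ)) (𝓝[<] 1) (𝓝 c) := by
  obtain ⟨F, hF, hFre⟩ := (hk.locallySubmean_norm_rpow Metric.isOpen_ball
    hp).exists_differentiableOn_re_majorant (continuousOn_norm_rpow hk.continuousOn hp)
    (M := M.toReal) fun r hr => by
      have h1 := hbd r hr
      rw [lintegral_enorm_rpow_eq_circleAverage hk hp hr] at h1
      exact (ENNReal.ofReal_le_iff_le_toReal hM).1 h1
  -- `|E| ≤ 1` because `Re F ≥ |k|^p ≥ 0`, and `|k E| ≤ 1` because `log x ≤ x^p / p`. So `k` is a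
  -- quotient of bounded functions whose denominator has nonzero radial limits almost everywhere.
  set E : ℂ → ℂ := fun z => Complex.exp (-F z / p) with hE
  have hEd : DifferentiableOn ℂ E (Metric.ball 0 1) := (hF.neg.div_const _).cexp
  have hEn : ∀ z, ‖E z‖ = Real.exp (-(F z).re / p) := fun z => by
    rw [hE, Complex.norm_exp, Complex.div_ofReal_re, Complex.neg_re]
  have hEb : ∀ z ∈ Metric.ball (0 : ℂ) 1, ‖E z‖ ≤ 1 := fun z hz => by
    rw [hEn, Real.exp_le_one_iff]
    have := (Real.rpow_nonneg (norm_nonneg (k z)) p).trans (hFre z hz)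
    exact div_nonpos_of_nonpos_of_nonneg (by linarith) hp.le
  have hkE : ∀ z ∈ Metric.ball (0 : ℂ) 1, ‖k z * E z‖ ≤ 1 := fun z hz => by
    rw [norm_mul, hEn]
    have h1 : ‖k z‖ ≤ Real.exp (‖k z‖ ^ p / p) := by
      rcases (norm_nonneg (k z)).eq_or_lt with h0 | h0
      · rw [← h0]; positivity
      · rw [← Real.log_le_iff_le_exp h0]
        exact Real.log_le_rpow_div h0.le hp
    calc ‖k z‖ * Real.exp (-(F z).re / p)
        ≤ Real.exp (‖k z‖ ^ p / p) * Real.exp (-(F z).re / p) := by gcongr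
      _ ≤ 1 := by
        rw [← Real.exp_add, Real.exp_le_one_iff, ← add_div]
        exact div_nonpos_of_nonpos_of_nonneg (by linarith [hFre z hz]) hp.le
  have h1 := angleMeasure_absolutelyContinuous.ae_le (ae_tendsto_radial_of_bounded hEd hEb)
  have h2 := angleMeasure_absolutelyContinuous.ae_le
    (ae_tendsto_radial_of_bounded (hk.mul hEd) hkE)
  choose! u hu using fun θ (h : ∃ c : ℂ, Tendsto (fun r : ℝ => E (circleMap 0 r θ)) (𝓝[<] 1) (𝓝 c)) => h
  have h1' : ∀ᵐ θ ∂angleMeasure, Tendsto (fun r : ℝ => E (circleMap 0 r θ)) (𝓝[<] 1) (𝓝 (u θ)) := by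
    filter_upwards [h1] with θ h using hu θ h
  have h0 := ae_radial_limit_ne_zero hEd hEb (Metric.mem_ball_self one_pos)
    (Complex.exp_ne_zero _) h1'
  filter_upwards [h0, h1', h2] with θ h3 h4 h5
  obtain ⟨c, hc⟩ := h5
  refine ⟨c / u θ, (hc.div h4 h3).congr fun r => ?_⟩
  have : E (circleMap 0 r θ) ≠ 0 := Complex.exp_ne_zero _
  simp only [Pi.mul_apply, Pi.div_apply]
  field_simp

/-! ### The Hardy norm on the disc equals the boundary norm. -/

theorem poissonKernel_circleMap_comm {r θ φ : ℝ} :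
    poissonKernel 0 (circleMap 0 r φ) (circleMap 0 1 θ) =
      poissonKernel 0 (circleMap 0 r θ) (circleMap 0 1 φ) := by
  have h : ‖circleMap 0 1 θ - circleMap 0 r φ‖ ^ 2 = ‖circleMap 0 1 φ - circleMap 0 r θ‖ ^ 2 := by
    rw [← Complex.normSq_eq_norm_sq, ← Complex.normSq_eq_norm_sq, Complex.normSq_sub,
      Complex.normSq_sub]
    simp only [Complex.normSq_eq_norm_sq, circleMap_zero]
    simp [Complex.exp_re, Complex.exp_im]
    ring
  simp only [poissonKernel_def, sub_zero, norm_circleMap_zero, h]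

theorem measurable_poissonKernel (r : ℝ) :
    Measurable fun x : ℝ × ℝ => poissonKernel 0 (circleMap 0 r x.1) (circleMap 0 1 x.2) := by
  unfold poissonKernel
  fun_prop

/-- The means of an `H^p` function are bounded by the `L^p` norm of the radial limit. -/
theorem lintegral_circleMap_le_of_hardy {k : ℂ → ℂ} (hk : DifferentiableOn ℂ k (Metric.ball 0 1))
    {p : ℝ} (hp : 0 < p) {M : ℝ≥0∞} (hM : M ≠ ⊤)
    (hbd : ∀ r ∈ Ioo (0 : ℝ) 1, ∫⁻ θ, ‖k (circleMap 0 r θ)‖ₑ ^ p ∂angleMeasure ≤ M)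
    {u : ℝ → ℂ} (hu : ∀ᵐ θ ∂angleMeasure,
      Tendsto (fun r : ℝ => k (circleMap 0 r θ)) (𝓝[<] 1) (𝓝 (u θ))) {r : ℝ}
    (hr : r ∈ Ioo (0 : ℝ) 1) :
    ∫⁻ θ, ‖k (circleMap 0 r θ)‖ₑ ^ p ∂angleMeasure ≤ ∫⁻ θ, ‖u θ‖ₑ ^ p ∂angleMeasure := by
  have hum := aemeasurable_radial_limit hk.continuousOn hu
  have h2 : ∀ x : ℝ≥0∞, (x ^ (p / 2)) ^ (2 : ℝ) = x ^ p := fun x => by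
    rw [← ENNReal.rpow_mul]; congr 1; ring
  -- The majorisation by limits is available only below the Hardy exponent, so it is used for `p /
  -- 2`. Cauchy–Schwarz against the Poisson kernel, of mass `1`, then squares it up to `p`.
  have hpt : ∀ w ∈ Metric.ball (0 : ℂ) 1, ‖k w‖ₑ ^ p ≤
      ∫⁻ θ, ENNReal.ofReal (poissonKernel 0 w (circleMap 0 1 θ)) * ‖u θ‖ₑ ^ p ∂angleMeasure := by
    intro w hw
    have h1 := enorm_rpow_le_lintegral_poissonKernel_limit hk (half_pos hp) hM
      (by rwa [mul_div_cancel₀ _ (two_ne_zero' ℝ)]) hu hw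
    set P : ℝ → ℝ≥0∞ := fun θ => ENNReal.ofReal (poissonKernel 0 w (circleMap 0 1 θ)) with hP
    have hPm : Measurable P := (continuous_poissonKernel_circleMap hw).measurable.ennreal_ofReal
    have h3 := ENNReal.lintegral_mul_le_Lp_mul_Lq angleMeasure Real.HolderConjugate.two_two
      (f := fun θ => P θ ^ (1 / 2 : ℝ)) (g := fun θ => P θ ^ (1 / 2 : ℝ) * ‖u θ‖ₑ ^ (p / 2))
      (hPm.pow_const _).aemeasurable ((hPm.pow_const _).aemeasurable.mul (hum.enorm.pow_const _))
    have hhalf : ∀ x : ℝ≥0∞, (x ^ (1 / 2 : ℝ)) ^ (2 : ℝ) = x := fun x => by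
      rw [← ENNReal.rpow_mul]; norm_num
    have hhalf' : ∀ x : ℝ≥0∞, x ^ (1 / 2 : ℝ) * x ^ (1 / 2 : ℝ) = x := fun x => by
      rw [← ENNReal.rpow_add_of_nonneg _ _ (by norm_num) (by norm_num)]; norm_num
    simp only [Pi.mul_apply, ← mul_assoc, hhalf', ENNReal.mul_rpow_of_nonneg _ _ zero_le_two,
      hhalf, h2] at h3
    rw [hP, lintegral_poissonKernel hw, ENNReal.one_rpow, one_mul] at h3
    rw [← h2]
    calc _ ≤ _ := ENNReal.rpow_le_rpow (h1.trans h3) zero_le_two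
      _ = _ := hhalf _
  calc ∫⁻ φ, ‖k (circleMap 0 r φ)‖ₑ ^ p ∂angleMeasure
      ≤ ∫⁻ φ, ∫⁻ θ, ENNReal.ofReal (poissonKernel 0 (circleMap 0 r φ) (circleMap 0 1 θ)) *
          ‖u θ‖ₑ ^ p ∂angleMeasure ∂angleMeasure :=
        lintegral_mono fun φ => hpt _ (by simp [abs_of_pos hr.1, hr.2])
    _ = ∫⁻ θ, ∫⁻ φ, ENNReal.ofReal (poissonKernel 0 (circleMap 0 r φ) (circleMap 0 1 θ)) *
          ‖u θ‖ₑ ^ p ∂angleMeasure ∂angleMeasure := by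
        rw [lintegral_lintegral_swap]
        exact ((measurable_poissonKernel r).ennreal_ofReal.aemeasurable).mul
          (hum.enorm.pow_const p).comp_snd
    _ = ∫⁻ θ, ‖u θ‖ₑ ^ p ∂angleMeasure := by
        refine lintegral_congr fun θ => ?_
        simp only [poissonKernel_circleMap_comm (θ := θ)]
        have hw : circleMap 0 r θ ∈ Metric.ball (0 : ℂ) 1 := by simp [abs_of_pos hr.1, hr.2]
        rw [lintegral_mul_const _
          (continuous_poissonKernel_circleMap hw).measurable.ennreal_ofReal,
          lintegral_poissonKernel hw, one_mul]

theorem iSup_Ioo_eq_iSup_radius {A : ℝ → ℝ≥0∞}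
    (hA : ∀ r R, 0 < r → r ≤ R → R < 1 → A r ≤ A R) :
    ⨆ r ∈ Ioo (0 : ℝ) 1, A r = ⨆ j, A (radius j) := by
  refine le_antisymm (iSup₂_le fun r hr => ?_) (iSup_le fun j => ?_)
  · obtain ⟨j, hj⟩ := (tendsto_radius_nhds.eventually (lt_mem_nhds hr.2)).exists
    exact (hA r _ hr.1 hj.le (radius_mem j).2).trans (le_iSup (fun j => A (radius j)) j)
  · exact le_iSup₂ (f := fun r (_ : r ∈ Ioo (0 : ℝ) 1) => A r) _ (radius_mem j)

/-- One inequality is Poisson majorisation integrated over the circle; the other is Fatou's lemma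
along `radius`. -/
theorem iSup_lintegral_circleMap_eq {k : ℂ → ℂ} (hk : DifferentiableOn ℂ k (Metric.ball 0 1))
    {p : ℝ} (hp : 0 < p)
    (hbd : ⨆ r ∈ Ioo (0 : ℝ) 1, ∫⁻ θ, ‖k (circleMap 0 r θ)‖ₑ ^ p ∂angleMeasure ≠ ⊤)
    {u : ℝ → ℂ} (hu : ∀ᵐ θ ∂angleMeasure,
      Tendsto (fun r : ℝ => k (circleMap 0 r θ)) (𝓝[<] 1) (𝓝 (u θ))) :
    ⨆ r ∈ Ioo (0 : ℝ) 1, ∫⁻ θ, ‖k (circleMap 0 r θ)‖ₑ ^ p ∂angleMeasure =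
      ∫⁻ θ, ‖u θ‖ₑ ^ p ∂angleMeasure := by
  have hle : ∀ r ∈ Ioo (0 : ℝ) 1, ∫⁻ θ, ‖k (circleMap 0 r θ)‖ₑ ^ p ∂angleMeasure ≤
      ⨆ r ∈ Ioo (0 : ℝ) 1, ∫⁻ θ, ‖k (circleMap 0 r θ)‖ₑ ^ p ∂angleMeasure := fun r hr =>
    le_iSup₂ (f := fun r (_ : r ∈ Ioo (0 : ℝ) 1) =>
      ∫⁻ θ, ‖k (circleMap 0 r θ)‖ₑ ^ p ∂angleMeasure) r hr
  refine le_antisymm (iSup₂_le fun r hr => lintegral_circleMap_le_of_hardy hk hp hbd hle hu hr) ?_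
  calc ∫⁻ θ, ‖u θ‖ₑ ^ p ∂angleMeasure
      = ∫⁻ θ, liminf (fun j => ‖k (circleMap 0 (radius j) θ)‖ₑ ^ p) atTop ∂angleMeasure := by
        refine lintegral_congr_ae ?_
        filter_upwards [hu] with θ hθ
        exact (((ENNReal.continuous_rpow_const (y := p)).tendsto _).comp
          (hθ.comp tendsto_radius).enorm).liminf_eq.symm
    _ ≤ liminf (fun j => ∫⁻ θ, ‖k (circleMap 0 (radius j) θ)‖ₑ ^ p ∂angleMeasure) atTop :=
        lintegral_liminf_le fun j => (continuous_comp_circleMap hk.continuousOn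
          (radius_mem j)).measurable.enorm.pow_const p
    _ ≤ _ := by
        refine (liminf_le_liminf (v := fun _ => ⨆ r ∈ Ioo (0 : ℝ) 1,
          ∫⁻ θ, ‖k (circleMap 0 r θ)‖ₑ ^ p ∂angleMeasure)
          (Eventually.of_forall fun j => hle _ (radius_mem j))).trans ?_
        simp

/-! ### Weighted means on the disc. -/

theorem discreteTopology_exp_fiber (c : ℂ) : DiscreteTopology {z : ℂ | Complex.exp z = c} := by
  refine DiscreteTopology.of_forall_le_dist (r := 2 * Real.pi) (by positivity) fun x y hxy => ?_
  obtain ⟨m, hm⟩ := Complex.exp_eq_exp_iff_exists_int.1 (x.2.trans y.2.symm)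
  have hm0 : m ≠ 0 := by
    rintro rfl
    exact hxy (Subtype.ext (by simpa using hm))
  rw [Subtype.dist_eq, dist_eq_norm, hm, add_sub_cancel_left, norm_mul]
  have h1 : (1 : ℝ) ≤ |(m : ℝ)| := by exact_mod_cast Int.one_le_abs hm0
  have h2 : ‖(2 * Real.pi * Complex.I : ℂ)‖ = 2 * Real.pi := by
    simp [abs_of_pos Real.pi_pos]
  rw [h2, Complex.norm_intCast]
  nlinarith [Real.pi_pos]

/-- A continuous logarithm of a function with a nonzero one-sided limit has a one-sided limit. -/
theorem exists_tendsto_of_tendsto_exp {L : ℝ → ℂ} (hL : ContinuousOn L (Ioo 0 1)) {c : ℂ}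
    (hc : c ≠ 0) (h : Tendsto (fun r => Complex.exp (L r)) (𝓝[<] 1) (𝓝 c)) :
    ∃ ℓ, Tendsto L (𝓝[<] 1) (𝓝 ℓ) := by
  have h1 : Tendsto (fun r => Complex.exp (L r) / c) (𝓝[<] 1) (𝓝 1) := by
    have := h.div_const c
    rwa [div_self hc] at this
  have hslit : ∀ᶠ r in 𝓝[<] (1 : ℝ), Complex.exp (L r) / c ∈ Complex.slitPlane :=
    h1.eventually (Complex.isOpen_slitPlane.mem_nhds Complex.one_mem_slitPlane)
  obtain ⟨s, hs, hsub⟩ := (mem_nhdsLT_iff_exists_Ioo_subset' (zero_lt_one' ℝ)).1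
    (Filter.inter_mem hslit (Ioo_mem_nhdsLT (zero_lt_one' ℝ)))
  -- Near `1` the quotient `exp (L r) / c` stays in the slit plane. The displayed difference is then
  -- a continuous choice of logarithm of `c`, hence constant because the logarithms of `c` form a
  -- discrete set.
  have hcont : ContinuousOn (fun r => L r - Complex.log (Complex.exp (L r) / c)) (Ioo s 1) := by
    have hLc := hL.mono fun r hr => (hsub hr).2
    exact hLc.sub ((hLc.cexp.div_const c).clog fun r hr => (hsub hr).1)
  have hmaps : MapsTo (fun r => L r - Complex.log (Complex.exp (L r) / c)) (Ioo s 1)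
      {z : ℂ | Complex.exp z = c} := by
    intro r _
    show Complex.exp _ = c
    rw [Complex.exp_sub, Complex.exp_log (div_ne_zero (Complex.exp_ne_zero _) hc)]
    have := Complex.exp_ne_zero (L r)
    field_simp
  obtain ⟨y, -, hy⟩ := isPreconnected_Ioo.eqOn_const_of_mapsTo
    ⟨discreteTopology_exp_fiber c⟩ hcont hmaps ⟨Complex.log c, Complex.exp_log hc⟩
  refine ⟨y, ?_⟩
  have h2 : Tendsto (fun r => y + Complex.log (Complex.exp (L r) / c)) (𝓝[<] 1) (𝓝 y) := by
    have := ((continuousAt_clog Complex.one_mem_slitPlane).tendsto.comp h1).const_add y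
    simpa using this
  refine h2.congr' ?_
  filter_upwards [Ioo_mem_nhdsLT hs] with r hr
  have h3 := hy hr
  simp only [Function.const_apply] at h3
  rw [← h3]
  ring

/-- Take `k = h g^{2/p}` for a branch of the power on the disc; this removes the weight. A nonzero
radial limit of `g` forces its logarithm to converge along the radius, so the limit of `k` can be
divided by that of `g^{2/p}`. -/
theorem exists_weighted_root {h g : ℂ → ℂ} (hh : DifferentiableOn ℂ h (Metric.ball 0 1))
    (hg : DifferentiableOn ℂ g (Metric.ball 0 1)) (hg0 : ∀ z ∈ Metric.ball (0 : ℂ) 1, g z ≠ 0)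
    {p : ℝ} (hp : 0 < p) :
    ∃ k : ℂ → ℂ, DifferentiableOn ℂ k (Metric.ball 0 1) ∧
      (∀ z ∈ Metric.ball (0 : ℂ) 1, ‖k z‖ₑ ^ p = ‖h z‖ₑ ^ p * ‖g z‖ₑ ^ 2) ∧
      ∀ θ : ℝ, (∃ c, c ≠ 0 ∧ Tendsto (fun r : ℝ => g (circleMap 0 r θ)) (𝓝[<] 1) (𝓝 c)) →
        (∃ c, Tendsto (fun r : ℝ => k (circleMap 0 r θ)) (𝓝[<] 1) (𝓝 c)) →
        ∃ c, Tendsto (fun r : ℝ => h (circleMap 0 r θ)) (𝓝[<] 1) (𝓝 c) := by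
  obtain ⟨L, hL, hLe⟩ := exists_exp_eqOn_ball hg hg0
  refine ⟨fun z => h z * Complex.exp ((2 / p : ℝ) * L z), by fun_prop, fun z hz => ?_, ?_⟩
  · rw [enorm_mul, ENNReal.mul_rpow_of_nonneg _ _ hp.le, ← hLe z hz]
    congr 1
    rw [← ofReal_norm, ← ofReal_norm, Complex.norm_exp, Complex.norm_exp,
      ENNReal.ofReal_rpow_of_nonneg (Real.exp_pos _).le hp.le, ← ENNReal.ofReal_pow
        (Real.exp_pos _).le, ← Real.exp_mul, ← Real.exp_nat_mul, Complex.re_ofReal_mul]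
    congr 2
    push_cast
    field_simp
  · rintro θ ⟨c, hc, hgc⟩ ⟨κ, hκ⟩
    have hin : MapsTo (fun r : ℝ => circleMap 0 r θ) (Ioo 0 1) (Metric.ball 0 1) := fun r hr => by
      simp [abs_of_pos hr.1, hr.2]
    have hcc : ContinuousOn (fun r : ℝ => L (circleMap 0 r θ)) (Ioo 0 1) :=
      hL.continuousOn.comp (by simp only [circleMap]; fun_prop) hin
    obtain ⟨ℓ, hℓ⟩ := exists_tendsto_of_tendsto_exp hcc hc (hgc.congr' (by
      filter_upwards [Ioo_mem_nhdsLT (zero_lt_one' ℝ)] with r hr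
      exact (hLe _ (hin hr)).symm))
    have h1 : Tendsto (fun r : ℝ => Complex.exp ((2 / p : ℝ) * L (circleMap 0 r θ))) (𝓝[<] 1)
        (𝓝 (Complex.exp ((2 / p : ℝ) * ℓ))) :=
      (Complex.continuous_exp.tendsto _).comp (hℓ.const_mul _)
    refine ⟨κ / _, (hκ.div h1 (Complex.exp_ne_zero _)).congr fun r => ?_⟩
    exact mul_div_cancel_right₀ _ (Complex.exp_ne_zero _)

section Weighted

variable {h g : ℂ → ℂ} {p : ℝ}

theorem weighted_mean_mono (hh : DifferentiableOn ℂ h (Metric.ball 0 1))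
    (hg : DifferentiableOn ℂ g (Metric.ball 0 1)) (hg0 : ∀ z ∈ Metric.ball (0 : ℂ) 1, g z ≠ 0)
    (hp : 0 < p) {r R : ℝ} (hr : 0 < r) (hrR : r ≤ R) (hR : R < 1) :
    ∫⁻ θ, ‖h (circleMap 0 r θ)‖ₑ ^ p * ‖g (circleMap 0 r θ)‖ₑ ^ 2 ∂angleMeasure ≤
      ∫⁻ θ, ‖h (circleMap 0 R θ)‖ₑ ^ p * ‖g (circleMap 0 R θ)‖ₑ ^ 2 ∂angleMeasure := by
  obtain ⟨k, hk, hkn, -⟩ := exists_weighted_root hh hg hg0 hp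
  have hin : ∀ r ∈ Ioo (0 : ℝ) 1, ∀ θ, circleMap 0 r θ ∈ Metric.ball (0 : ℂ) 1 := fun r hr θ => by
    simp [abs_of_pos hr.1, hr.2]
  simp only [← hkn _ (hin r ⟨hr, hrR.trans_lt hR⟩ _), ← hkn _ (hin R ⟨hr.trans_le hrR, hR⟩ _)]
  exact lintegral_enorm_rpow_circleMap_mono hk hp hr hrR hR

/-- The disc theory applied to the weighted root. The function `N` may be any almost everywhere
limit of the weighted integrand, so no limits of `h` and `g` have to be named. -/
theorem weighted_iSup_eq (hh : DifferentiableOn ℂ h (Metric.ball 0 1))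
    (hg : DifferentiableOn ℂ g (Metric.ball 0 1)) (hg0 : ∀ z ∈ Metric.ball (0 : ℂ) 1, g z ≠ 0)
    (hp : 0 < p)
    (hbd : ⨆ r ∈ Ioo (0 : ℝ) 1, ∫⁻ θ, ‖h (circleMap 0 r θ)‖ₑ ^ p *
      ‖g (circleMap 0 r θ)‖ₑ ^ 2 ∂angleMeasure ≠ ⊤)
    (hgl : ∀ᵐ θ ∂angleMeasure, ∃ c, c ≠ 0 ∧
      Tendsto (fun r : ℝ => g (circleMap 0 r θ)) (𝓝[<] 1) (𝓝 c)) :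
    (∀ᵐ θ ∂angleMeasure, ∃ c, Tendsto (fun r : ℝ => h (circleMap 0 r θ)) (𝓝[<] 1) (𝓝 c)) ∧
    ∀ N : ℝ → ℝ≥0∞, (∀ᵐ θ ∂angleMeasure, Tendsto (fun r : ℝ => ‖h (circleMap 0 r θ)‖ₑ ^ p *
      ‖g (circleMap 0 r θ)‖ₑ ^ 2) (𝓝[<] 1) (𝓝 (N θ))) →
    ⨆ r ∈ Ioo (0 : ℝ) 1, ∫⁻ θ, ‖h (circleMap 0 r θ)‖ₑ ^ p *
      ‖g (circleMap 0 r θ)‖ₑ ^ 2 ∂angleMeasure = ∫⁻ θ, N θ ∂angleMeasure := by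
  obtain ⟨k, hk, hkn, hklim⟩ := exists_weighted_root hh hg hg0 hp
  have hin : ∀ r ∈ Ioo (0 : ℝ) 1, ∀ θ, circleMap 0 r θ ∈ Metric.ball (0 : ℂ) 1 := fun r hr θ => by
    simp [abs_of_pos hr.1, hr.2]
  have heq : ⨆ r ∈ Ioo (0 : ℝ) 1, ∫⁻ θ, ‖h (circleMap 0 r θ)‖ₑ ^ p *
      ‖g (circleMap 0 r θ)‖ₑ ^ 2 ∂angleMeasure =
      ⨆ r ∈ Ioo (0 : ℝ) 1, ∫⁻ θ, ‖k (circleMap 0 r θ)‖ₑ ^ p ∂angleMeasure := by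
    refine iSup_congr fun r => iSup_congr fun hr => lintegral_congr fun θ => (hkn _ (hin r hr θ)).symm
  rw [heq] at hbd ⊢
  have hkl := ae_tendsto_radial_of_hardy hk hp hbd fun r hr =>
    le_iSup₂ (f := fun r (_ : r ∈ Ioo (0 : ℝ) 1) =>
      ∫⁻ θ, ‖k (circleMap 0 r θ)‖ₑ ^ p ∂angleMeasure) r hr
  refine ⟨?_, fun N hN => ?_⟩
  · filter_upwards [hgl, hkl] with θ h1 h2 using hklim θ h1 h2
  · choose! u hu using fun θ
      (h : ∃ c : ℂ, Tendsto (fun r : ℝ => k (circleMap 0 r θ)) (𝓝[<] 1) (𝓝 c)) => h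
    have hu' : ∀ᵐ θ ∂angleMeasure, Tendsto (fun r : ℝ => k (circleMap 0 r θ)) (𝓝[<] 1) (𝓝 (u θ)) := by
      filter_upwards [hkl] with θ h using hu θ h
    rw [iSup_lintegral_circleMap_eq hk hp hbd hu']
    refine lintegral_congr_ae ?_
    filter_upwards [hu', hN] with θ h1 h2
    have h3 := ((ENNReal.continuous_rpow_const (y := p)).tendsto _).comp h1.enorm
    refine tendsto_nhds_unique h3 (h2.congr' ?_)
    filter_upwards [Ioo_mem_nhdsLT (zero_lt_one' ℝ)] with r hr
    exact (hkn _ (hin r hr θ)).symm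

end Weighted

/-! ### Rotations and invariance of the boundary measure. -/

/-- Rotation by the angle `θ` of the coordinates with index in `S`. -/
noncomputable def rot {n : ℕ} (S : Finset (Fin n)) (θ : ℝ) : Cn n ≃ᵢ Cn n :=
  IsometryEquiv.mk'
    (fun z => WithLp.toLp 2 fun i => (if i ∈ S then Complex.exp (θ * Complex.I) else 1) * z i)
    (fun z => WithLp.toLp 2 fun i => (if i ∈ S then Complex.exp (-(θ * Complex.I)) else 1) * z i)
    (fun z => by
      ext i
      by_cases h : i ∈ S
      · simp [h, ← mul_assoc, ← Complex.exp_add]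
      · simp [h])
    (Isometry.of_dist_eq fun z w => by
      rw [EuclideanSpace.dist_eq, EuclideanSpace.dist_eq]
      congr 1
      refine Finset.sum_congr rfl fun i _ => ?_
      by_cases h : i ∈ S
      · simp [h, dist_eq_norm, ← mul_sub]
      · simp [h])

theorem rot_apply {n : ℕ} (S : Finset (Fin n)) (θ : ℝ) (z : Cn n) (i : Fin n) :
    rot S θ z i = (if i ∈ S then Complex.exp (θ * Complex.I) else 1) * z i := rfl

theorem norm_rot_apply {n : ℕ} (S : Finset (Fin n)) (θ : ℝ) (z : Cn n) (i : Fin n) :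
    ‖rot S θ z i‖ = ‖z i‖ := by
  rw [rot_apply]
  split_ifs <;> simp

theorem rot_univ {n : ℕ} (θ : ℝ) (z : Cn n) :
    rot Finset.univ θ z = Complex.exp (θ * Complex.I) • z := by
  ext i; simp [rot_apply]

theorem continuous_rot {n : ℕ} (S : Finset (Fin n)) :
    Continuous fun x : Cn n × ℝ => rot S x.2 x.1 := by
  refine (PiLp.continuous_toLp 2 _).comp (continuous_pi fun i => ?_)
  by_cases h : i ∈ S
  · simp only [h, if_true]; fun_prop
  · simp only [h, if_false]; fun_prop

theorem isOpen_polydisc (n : ℕ) : IsOpen (polydisc n) := by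
  have : polydisc n = ⋂ i, {z : Cn n | ‖z i‖ < 1} := by ext; simp [polydisc]
  rw [this]
  exact isOpen_iInter_of_finite fun i => isOpen_lt (by fun_prop) continuous_const

theorem IsCompleteReinhardt.rot_mem_iff {n : ℕ} {X : Set (Cn n)} (hX : IsCompleteReinhardt X)
    (S : Finset (Fin n)) (θ : ℝ) (z : Cn n) : rot S θ z ∈ X ↔ z ∈ X :=
  ⟨fun h => hX _ h z fun i => (norm_rot_apply S θ z i).ge,
    fun h => hX _ h _ fun i => (norm_rot_apply S θ z i).le⟩

namespace QuotientQuadruple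

variable {n : ℕ} (Q : QuotientQuadruple n)

theorem isOpen_X : IsOpen Q.X := by
  rcases Q.model with ⟨h, _⟩ | ⟨h, _⟩
  · exact h
  · rw [h]; exact isOpen_polydisc n

theorem reinhardt : IsCompleteReinhardt Q.X := by
  rcases Q.model with ⟨_, _, _, h, _⟩ | ⟨h, _⟩
  · exact h
  · rw [h]; exact fun z hz w hw i => (hw i).trans_lt (hz i)

theorem isBounded_X : Bornology.IsBounded Q.X := by
  rcases Q.model with ⟨_, _, h, _⟩ | ⟨h, _⟩
  · exact h
  · rw [h]
    refine (Metric.isBounded_closedBall (x := (0 : Cn n)) (r := √n)).subset fun z hz => ?_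
    rw [mem_closedBall_zero_iff, EuclideanSpace.norm_eq]
    refine Real.sqrt_le_sqrt ?_
    calc ∑ i, ‖z i‖ ^ 2 ≤ ∑ _i : Fin n, (1 : ℝ) :=
          Finset.sum_le_sum fun i _ => pow_le_one₀ (norm_nonneg _) (hz i).le
      _ = n := by simp

variable {Q}

theorem smul_mem_X {c : ℂ} (hc : ‖c‖ < 1) {z : Cn n} (hz : z ∈ Q.Γ) : c • z ∈ Q.X := by
  have hr : (‖c‖ + 1) / 2 ∈ Ioo (0 : ℝ) 1 := ⟨by positivity, by linarith⟩
  refine Q.reinhardt _ (smul_mem hr hz) _ fun i => ?_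
  simp only [PiLp.smul_apply, norm_smul, Real.norm_of_nonneg hr.1.le]
  gcongr
  linarith

theorem mem_X_of_le {r : ℝ} (hr : r ∈ Ioo (0 : ℝ) 1) {ζ : Cn n} (hζ : ζ ∈ Q.Γ) {z : Cn n}
    (h : ∀ i, ‖z i‖ ≤ r * ‖ζ i‖) : z ∈ Q.X :=
  Q.reinhardt _ (smul_mem hr hζ) z fun i => by
    simpa [norm_smul, abs_of_pos hr.1] using h i

theorem Γ_subset_closure : Q.Γ ⊆ closure Q.X := by
  intro z hz
  have h : Tendsto (fun r : ℝ => r • z) (𝓝[<] 1) (𝓝 z) := by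
    have : Tendsto (fun r : ℝ => r • z) (𝓝 1) (𝓝 ((1 : ℝ) • z)) :=
      Continuous.tendsto (by fun_prop) 1
    rw [one_smul] at this
    exact this.mono_left nhdsWithin_le_nhds
  refine mem_closure_of_tendsto h ?_
  filter_upwards [Ioo_mem_nhdsLT (zero_lt_one' ℝ)] with r hr using smul_mem hr hz

theorem rot_mem_Γ_iff (S : Finset (Fin n)) (θ : ℝ) (z : Cn n) : rot S θ z ∈ Q.Γ ↔ z ∈ Q.Γ := by
  rcases Q.model with ⟨_, _, _, hR, _, hΓ, _⟩ | ⟨_, hΓ, _⟩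
  · have h1 := (rot S θ).toHomeomorph.preimage_frontier Q.X
    have h2 : (rot S θ).toHomeomorph ⁻¹' Q.X = Q.X := by
      ext z; exact hR.rot_mem_iff S θ z
    rw [h2] at h1
    rw [hΓ]
    exact Set.ext_iff.1 h1 z
  · rw [hΓ]
    simp only [torus, mem_ofPred_eq, norm_rot_apply]

theorem measurePreserving_rot (S : Finset (Fin n)) (θ : ℝ) :
    MeasurePreserving (rot S θ) Q.σ Q.σ := by
  have h := ((rot S θ).measurePreserving_euclideanHausdorffMeasure Q.d).restrict_preimage
    (isClosed_Γ (Q := Q)).measurableSet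
  have h2 : (rot S θ) ⁻¹' Q.Γ = Q.Γ := by ext z; exact rot_mem_Γ_iff S θ z
  rwa [h2] at h

theorem ae_mem_Γ : ∀ᵐ ζ ∂Q.σ, ζ ∈ Q.Γ :=
  ae_restrict_mem isClosed_Γ.measurableSet

end QuotientQuadruple

/-! ### Hausdorff measure under Lipschitz maps, and finiteness of the boundary measure. -/

section Hausdorff

variable {X Y : Type*} [MetricSpace X] [MeasurableSpace X] [BorelSpace X]
  [MetricSpace Y] [MeasurableSpace Y] [BorelSpace Y]

theorem LipschitzOnWith.euclideanHausdorffMeasure_image_le {K : ℝ≥0} {f : X → Y} {s : Set X}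
    (h : LipschitzOnWith K f s) (d : ℕ) :
    (μHE[d] : Measure Y) (f '' s) ≤ (K : ℝ≥0∞) ^ d * (μHE[d] : Measure X) s := by
  rw [Measure.euclideanHausdorffMeasure_def, Measure.euclideanHausdorffMeasure_def,
    Measure.smul_apply, Measure.smul_apply, ENNReal.smul_def, ENNReal.smul_def, smul_eq_mul,
    smul_eq_mul, mul_left_comm]
  gcongr
  have := h.hausdorffMeasure_image_le (d := d) (by positivity)
  simpa using this

/-- The inverse of `f` on the image of `s` is `K`-Lipschitz. -/
theorem euclideanHausdorffMeasure_le_of_dist_le {K : ℝ≥0} {f : X → Y} {s : Set X}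
    (h : ∀ x ∈ s, ∀ y ∈ s, dist x y ≤ K * dist (f x) (f y)) (d : ℕ) :
    (μHE[d] : Measure X) s ≤ (K : ℝ≥0∞) ^ d * (μHE[d] : Measure Y) (f '' s) := by
  rcases s.eq_empty_or_nonempty with rfl | ⟨x₀, hx₀⟩
  · simp
  have : Nonempty X := ⟨x₀⟩
  have hinj : InjOn f s := fun x hx y hy hxy => by
    have := h x hx y hy
    rw [hxy, dist_self, mul_zero] at this
    exact dist_le_zero.1 this
  have hL : LipschitzOnWith K (Function.invFunOn f s) (f '' s) := by
    refine LipschitzOnWith.of_dist_le_mul ?_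
    rintro _ ⟨x, hx, rfl⟩ _ ⟨y, hy, rfl⟩
    rw [hinj.leftInvOn_invFunOn hx, hinj.leftInvOn_invFunOn hy]
    exact h x hx y hy
  have := hL.euclideanHausdorffMeasure_image_le d
  rwa [hinj.leftInvOn_invFunOn.image_image] at this

end Hausdorff

theorem finrank_ker_of_apply_eq_one {E : Type*} [NormedAddCommGroup E] [NormedSpace ℝ E]
    [FiniteDimensional ℝ E] {L : E →L[ℝ] ℝ} {v : E} (hv : L v = 1) :
    Module.finrank ℝ (LinearMap.ker L.toLinearMap) = Module.finrank ℝ E - 1 := by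
  have h := L.toLinearMap.finrank_range_add_finrank_ker
  have h2 : LinearMap.range L.toLinearMap = ⊤ := by
    rw [LinearMap.range_eq_top]
    intro t
    exact ⟨t • v, by simp [hv]⟩
  rw [h2, finrank_top, Module.finrank_self] at h
  omega

theorem finrank_real_Cn (n : ℕ) : Module.finrank ℝ (Cn n) = 2 * n := by
  rw [finrank_real_of_complex, finrank_euclideanSpace_fin]

/-- The projection onto the kernel of `L` along `v`. -/
noncomputable def kerProj {E : Type*} [NormedAddCommGroup E] [NormedSpace ℝ E]
    (L : E →L[ℝ] ℝ) (v : E) (hv : L v = 1) : E →L[ℝ] LinearMap.ker L.toLinearMap :=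
  (ContinuousLinearMap.id ℝ E - L.smulRight v).codRestrict _ fun x => by simp [hv]

theorem kerProj_coe {E : Type*} [NormedAddCommGroup E] [NormedSpace ℝ E]
    (L : E →L[ℝ] ℝ) (v : E) (hv : L v = 1) (x : E) : (kerProj L v hv x : E) = x - L x • v := rfl

section C2

variable {n : ℕ} {X : Set (Cn n)}

theorem eq_zero_of_mem_frontier (hX : IsOpen X) {U : Set (Cn n)} {ρ : Cn n → ℝ} (hU : IsOpen U)
    (hρ : ContinuousOn ρ U) (h : X ∩ U = {z ∈ U | ρ z < 0}) {x : Cn n} (hx : x ∈ frontier X)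
    (hxU : x ∈ U) : ρ x = 0 := by
  rw [hX.frontier_eq] at hx
  have hc := hρ.continuousAt (hU.mem_nhds hxU)
  rcases lt_trichotomy (ρ x) 0 with h0 | h0 | h0
  · have : x ∈ X ∩ U := by rw [h]; exact ⟨hxU, h0⟩
    exact absurd this.1 hx.2
  · exact h0
  · obtain ⟨y, hyX, hy1, hy2⟩ := ((mem_closure_iff_frequently.1 hx.1).and_eventually
      ((hc.eventually (lt_mem_nhds h0)).and (hU.mem_nhds hxU))).exists
    have : y ∈ X ∩ U := ⟨hyX, hy2⟩
    rw [h] at this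
    exact absurd this.2 (not_lt.2 hy1.le)

/-- Near `ζ` the boundary lies in the zero set of `ρ`, which projects along `v` to the hyperplane
`ker L` with a 2-Lipschitz inverse. That hyperplane has dimension `2 n - 1`, so its Hausdorff
measure is a Haar measure, finite on bounded sets. -/
theorem HasC2Boundary.exists_nhds_measure_lt_top (hX : IsOpen X) (h : HasC2Boundary X)
    {ζ : Cn n} (hζ : ζ ∈ frontier X) :
    ∃ W ∈ 𝓝 ζ, (μHE[2 * n - 1] : Measure (Cn n)) (frontier X ∩ W) < ⊤ := by
  obtain ⟨U, ρ, hU, hζU, hρ, hd, hXU⟩ := h ζ hζ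
  set L := fderiv ℝ ρ ζ with hL
  obtain ⟨v, hv⟩ : ∃ v, L v = 1 := by
    obtain ⟨w, hw⟩ : ∃ w, L w ≠ 0 := by
      by_contra! hc
      exact hd (ContinuousLinearMap.ext hc)
    exact ⟨(L w)⁻¹ • w, by simp [hw]⟩
  have hstrict : HasStrictFDerivAt ρ L ζ :=
    (hρ.contDiffAt (hU.mem_nhds hζU)).hasStrictFDerivAt two_ne_zero
  have hv0 : 0 < ‖v‖ := norm_pos_iff.2 fun h0 => by simp [h0] at hv
  -- With this constant the component of `x - y` along `v` is at most half of `‖x - y‖` for two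
  -- zeros of `ρ`, which gives the factor `2` below.
  have hs := hstrict.isLittleO.def (c := 1 / (2 * ‖v‖)) (by positivity)
  rw [nhds_prod_eq] at hs
  obtain ⟨t, ht, hts⟩ := Filter.mem_prod_self_iff.1 hs
  refine ⟨t ∩ (U ∩ Metric.ball ζ 1), inter_mem ht (inter_mem (hU.mem_nhds hζU)
    (Metric.ball_mem_nhds ζ one_pos)), ?_⟩
  set A := frontier X ∩ (t ∩ (U ∩ Metric.ball ζ 1)) with hA
  have hanti : ∀ x ∈ A, ∀ y ∈ A, dist x y ≤ (2 : ℝ≥0) * dist (kerProj L v hv x) (kerProj L v hv y) := by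
    intro x hx y hy
    have h1 : ‖ρ x - ρ y - L (x - y)‖ ≤ 1 / (2 * ‖v‖) * ‖x - y‖ :=
      hts (mk_mem_prod hx.2.1 hy.2.1)
    rw [eq_zero_of_mem_frontier hX hU hρ.continuousOn hXU hx.1 hx.2.2.1,
      eq_zero_of_mem_frontier hX hU hρ.continuousOn hXU hy.1 hy.2.2.1, sub_zero, zero_sub, norm_neg] at h1
    have h2 : dist (kerProj L v hv x) (kerProj L v hv y) = ‖(x - y) - L (x - y) • v‖ := by
      rw [Subtype.dist_eq, dist_eq_norm, kerProj_coe, kerProj_coe, map_sub, sub_smul]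
      congr 1; abel
    have h3 : ‖x - y‖ ≤ ‖(x - y) - L (x - y) • v‖ + ‖L (x - y) • v‖ := by
      have := norm_add_le ((x - y) - L (x - y) • v) (L (x - y) • v)
      rwa [sub_add_cancel] at this
    have h4 : ‖L (x - y) • v‖ ≤ ‖x - y‖ / 2 := by
      rw [norm_smul]
      calc _ ≤ 1 / (2 * ‖v‖) * ‖x - y‖ * ‖v‖ := by gcongr
        _ = _ := by field_simp
    rw [h2, dist_eq_norm]
    push_cast
    linarith
  refine lt_of_le_of_lt (euclideanHausdorffMeasure_le_of_dist_le hanti _) ?_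
  refine ENNReal.mul_lt_top (by simp) ?_
  have hfr := finrank_ker_of_apply_eq_one hv
  rw [finrank_real_Cn] at hfr
  have hbdd : Bornology.IsBounded (kerProj L v hv '' A) :=
    (kerProj L v hv).lipschitz.isBounded_image
      (Metric.isBounded_ball.subset (fun x hx => hx.2.2.2))
  have : (μHE[2 * n - 1] : Measure (LinearMap.ker L.toLinearMap)).IsAddHaarMeasure := by
    rw [← hfr]; infer_instance
  exact hbdd.measure_lt_top

end C2

/-- The torus is covered by the image of the cube `[-π, π]^n` under a 1-Lipschitz map. -/
theorem measure_torus_lt_top (n : ℕ) : (μHE[n] : Measure (Cn n)) (torus n) < ⊤ := by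
  set f : EuclideanSpace ℝ (Fin n) → Cn n :=
    fun x => WithLp.toLp 2 fun i => circleMap 0 1 (x i) with hf
  have hL : LipschitzWith 1 f := by
    refine LipschitzWith.of_dist_le_mul fun x y => ?_
    rw [NNReal.coe_one, one_mul, EuclideanSpace.dist_eq, EuclideanSpace.dist_eq]
    refine Real.sqrt_le_sqrt (Finset.sum_le_sum fun i _ => ?_)
    have := (lipschitzWith_circleMap 0 1).dist_le_mul (x i) (y i)
    simp only [hf]
    gcongr
    simpa using this
  set B : Set (EuclideanSpace ℝ (Fin n)) := {x | ∀ i, x i ∈ Icc (-Real.pi) Real.pi} with hB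
  have hBb : Bornology.IsBounded B := by
    refine (Metric.isBounded_closedBall (x := (0 : EuclideanSpace ℝ (Fin n)))
      (r := √(∑ _i : Fin n, Real.pi ^ 2))).subset fun x hx => ?_
    rw [mem_closedBall_zero_iff, EuclideanSpace.norm_eq]
    refine Real.sqrt_le_sqrt (Finset.sum_le_sum fun i _ => ?_)
    gcongr
    exact abs_le.2 (hx i)
  have hsub : torus n ⊆ f '' B := by
    intro z hz
    refine ⟨WithLp.toLp 2 fun i => (z i).arg, fun i => ⟨(Complex.neg_pi_lt_arg _).le,
      Complex.arg_le_pi _⟩, ?_⟩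
    ext i
    have := Complex.norm_mul_exp_arg_mul_I (z i)
    rw [hz i] at this
    simpa [hf, circleMap] using this
  refine lt_of_le_of_lt ((measure_mono hsub).trans
    ((hL.lipschitzOnWith).euclideanHausdorffMeasure_image_le n)) ?_
  rw [EuclideanSpace.euclideanHausdorffMeasure_eq_volume]
  exact ENNReal.mul_lt_top (by simp) hBb.measure_lt_top

namespace QuotientQuadruple

variable {n : ℕ} (Q : QuotientQuadruple n)

instance : IsFiniteMeasure Q.σ := by
  refine ⟨?_⟩
  rw [σ, Measure.restrict_apply_univ]
  rcases Q.model with ⟨hX, _, hb, _, hC, hΓ, hd⟩ | ⟨_, hΓ, hd⟩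
  · rw [hΓ, hd]
    have hcpt : IsCompact (frontier Q.X) :=
      Metric.isCompact_of_isClosed_isBounded isClosed_frontier
        (hb.closure.subset frontier_subset_closure)
    refine hcpt.measure_lt_top_of_nhdsWithin fun ζ hζ => ?_
    obtain ⟨W, hW, hlt⟩ := hC.exists_nhds_measure_lt_top hX hζ
    exact ⟨frontier Q.X ∩ W,
      inter_mem self_mem_nhdsWithin (mem_nhdsWithin_of_mem_nhds hW), hlt⟩
  · rw [hΓ, hd]; exact measure_torus_lt_top n

end QuotientQuadruple

/-! ### Null coordinate hyperplanes and lower bounds for the boundary measure. -/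

/-- The hyperplane has real dimension `2 n - 2`, and a bounded piece has finite measure in that
dimension, hence measure zero in the next one. -/
theorem measure_coord_eq_zero {n : ℕ} (i : Fin n) :
    (μHE[2 * n - 1] : Measure (Cn n)) {z | z i = 0} = 0 := by
  set N : Submodule ℝ (Cn n) :=
    (LinearMap.ker (EuclideanSpace.proj i : Cn n →L[ℂ] ℂ).toLinearMap).restrictScalars ℝ with hN
  have hNz : ∀ z : Cn n, z ∈ N ↔ z i = 0 := fun z => Iff.rfl
  have hfr : Module.finrank ℝ N < 2 * n - 1 := by
    have h := (EuclideanSpace.proj i : Cn n →L[ℂ] ℂ).toLinearMap.finrank_range_add_finrank_ker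
    have h2 : LinearMap.range (EuclideanSpace.proj i : Cn n →L[ℂ] ℂ).toLinearMap = ⊤ := by
      rw [LinearMap.range_eq_top]
      intro t
      exact ⟨EuclideanSpace.single i t, by simp⟩
    rw [h2, finrank_top, Module.finrank_self, finrank_euclideanSpace_fin] at h
    have h3 : Module.finrank ℝ N = 2 * Module.finrank ℂ
        (LinearMap.ker (EuclideanSpace.proj i : Cn n →L[ℂ] ℂ).toLinearMap) :=
      finrank_real_of_complex _
    omega
  have hcov : {z : Cn n | z i = 0} ⊆ ⋃ j : ℕ, Subtype.val '' (Metric.ball (0 : N) j) := by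
    intro z hz
    obtain ⟨j, hj⟩ := exists_nat_gt ‖z‖
    exact mem_iUnion.2 ⟨j, ⟨z, (hNz z).2 hz⟩, by simpa using hj, rfl⟩
  refine measure_mono_null hcov (measure_iUnion_null fun j => ?_)
  rw [(isometry_subtype_coe).euclideanHausdorffMeasure_image]
  rcases Measure.euclideanHausdorffMeasure_zero_or_top hfr (Metric.ball (0 : N) j) with h | h
  · exact h
  · exact absurd h (Metric.isBounded_ball.measure_lt_top).ne

/-- Taking real parts is 1-Lipschitz and maps the torus onto a set containing the unit ball of
`ℝ^n`. -/
theorem measure_torus_pos (n : ℕ) : 0 < (μHE[n] : Measure (Cn n)) (torus n) := by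
  set f : Cn n → EuclideanSpace ℝ (Fin n) := fun z => WithLp.toLp 2 fun i => (z i).re with hf
  have hL : LipschitzWith 1 f := by
    refine LipschitzWith.of_dist_le_mul fun x y => ?_
    rw [NNReal.coe_one, one_mul, EuclideanSpace.dist_eq, EuclideanSpace.dist_eq]
    refine Real.sqrt_le_sqrt (Finset.sum_le_sum fun i _ => ?_)
    simp only [hf]
    gcongr
    rw [dist_eq_norm, dist_eq_norm, ← Complex.sub_re]
    exact Complex.abs_re_le_norm _
  have hsub : Metric.ball (0 : EuclideanSpace ℝ (Fin n)) 1 ⊆ f '' torus n := by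
    intro x hx
    rw [mem_ball_zero_iff] at hx
    refine ⟨WithLp.toLp 2 fun i => ⟨x i, √(1 - x i ^ 2)⟩, fun i => ?_, ?_⟩
    · have h1 : |x i| ≤ 1 := (PiLp.norm_apply_le x i).trans hx.le
      have h2 : x i ^ 2 ≤ 1 := by rw [← sq_abs]; exact pow_le_one₀ (abs_nonneg _) h1
      rw [Complex.norm_eq_sqrt_sq_add_sq]
      simp only
      rw [Real.sq_sqrt (by linarith)]
      simp
    · ext i; simp [hf]
  have h := (measure_mono hsub).trans ((hL.lipschitzOnWith).euclideanHausdorffMeasure_image_le n)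
  rw [EuclideanSpace.euclideanHausdorffMeasure_eq_volume] at h
  have hpos : 0 < volume (Metric.ball (0 : EuclideanSpace ℝ (Fin n)) 1) :=
    Metric.measure_ball_pos _ _ one_pos
  simpa using hpos.trans_le h

theorem IsPreconnected.inter_frontier_nonempty_of_isOpen {α : Type*} [TopologicalSpace α]
    {s X : Set α} (hs : IsPreconnected s) (hX : IsOpen X) (h1 : (s ∩ X).Nonempty)
    (h2 : (s ∩ Xᶜ).Nonempty) : (s ∩ frontier X).Nonempty := by
  by_contra hcon
  have hno : ∀ x ∈ s, x ∈ closure X → x ∈ X := fun x hx hc => by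
    by_contra hxX
    exact hcon ⟨x, hx, by rw [hX.frontier_eq]; exact ⟨hc, hxX⟩⟩
  obtain ⟨x, hx, hxX⟩ := h2
  obtain ⟨y, -, hy, hy'⟩ := hs X (closure X)ᶜ hX isClosed_closure.isOpen_compl
    (fun z hz => by
      by_cases hc : z ∈ closure X
      · exact Or.inl (hno z hz hc)
      · exact Or.inr hc) h1 ⟨x, hx, fun hc => hxX (hno x hx hc)⟩
  exact hy' (subset_closure hy)

/-- From each point of a small ball of `ker L`, moved by `v` into `X`, the ray in the direction `v`
must leave the bounded set `X`, and it does so where all coordinates exceed `b`. Projection along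
`v` therefore maps this part of the boundary onto a set containing a ball of the hyperplane. -/
theorem measure_frontier_pos {n : ℕ} (hn : 0 < n) {X : Set (Cn n)}
    (hX : IsOpen X) (hb : Bornology.IsBounded X) {b : Fin n → ℝ} {ε : ℝ} (hε : 0 < ε)
    (hb0 : ∀ i, 0 ≤ b i) (hbX : (WithLp.toLp 2 fun i => ((b i + ε : ℝ) : ℂ) : Cn n) ∈ X) :
    0 < (μHE[2 * n - 1] : Measure (Cn n)) (frontier X ∩ {ζ | ∀ i, b i < ‖ζ i‖}) := by
  set v : Cn n := WithLp.toLp 2 fun i => ((b i + ε : ℝ) : ℂ) with hv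
  set i₀ : Fin n := ⟨0, hn⟩
  have hvi : ∀ i, v i = ((b i + ε : ℝ) : ℂ) := fun i => rfl
  have hbe : ∀ i, 0 < b i + ε := fun i => by linarith [hb0 i]
  set L : Cn n →L[ℝ] ℝ := (b i₀ + ε)⁻¹ • (Complex.reCLM.comp
    ((EuclideanSpace.proj i₀ : Cn n →L[ℂ] ℂ).restrictScalars ℝ)) with hL
  have hLv : L v = 1 := by
    simp [hL, hvi, inv_mul_cancel₀ (hbe i₀).ne', -Complex.ofReal_add]
  have hfr := finrank_ker_of_apply_eq_one hLv
  rw [finrank_real_Cn] at hfr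
  have hHaar : (μHE[2 * n - 1] : Measure (LinearMap.ker L.toLinearMap)).IsAddHaarMeasure := by
    rw [← hfr]; infer_instance
  obtain ⟨δ, hδ, hδX⟩ := Metric.isOpen_iff.1 hX v hbX
  obtain ⟨R, hR⟩ := hb.subset_ball 0
  have hvn : 0 < ‖v‖ := norm_pos_iff.2 fun h0 => by simp [h0] at hLv
  -- The bound by `δ` puts `x + v` in `X`; the bound by `ε` gives `|x_i| < ε`, so a point `x + t v`
  -- with `t ≥ 1` has `i`-th coordinate of modulus above `b i`.
  set η := min δ ε with hη
  have hη0 : 0 < η := lt_min hδ hε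
  have hsub : Metric.ball (0 : LinearMap.ker L.toLinearMap) η ⊆
      kerProj L v hLv '' (frontier X ∩ {ζ | ∀ i, b i < ‖ζ i‖}) := by
    intro x hx
    have hxn : ‖(x : Cn n)‖ < η := by simpa using hx
    set T : ℝ := max 1 ((R + η) / ‖v‖) with hT
    have hT1 : 1 ≤ T := le_max_left _ _
    have hpre : IsPreconnected ((fun t : ℝ => (x : Cn n) + t • v) '' Icc 1 T) :=
      isPreconnected_Icc.image _ (by fun_prop)
    have h1 : (((fun t : ℝ => (x : Cn n) + t • v) '' Icc 1 T) ∩ X).Nonempty := by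
      refine ⟨(x : Cn n) + (1 : ℝ) • v, ⟨1, ⟨le_rfl, hT1⟩, rfl⟩, hδX ?_⟩
      rw [mem_ball_iff_norm, one_smul, add_sub_cancel_right]
      exact hxn.trans_le (min_le_left _ _)
    have h2 : (((fun t : ℝ => (x : Cn n) + t • v) '' Icc 1 T) ∩ Xᶜ).Nonempty := by
      refine ⟨(x : Cn n) + T • v, ⟨T, ⟨hT1, le_rfl⟩, rfl⟩, fun hmem => ?_⟩
      have h3 := hR hmem
      rw [mem_ball_zero_iff] at h3
      have h4 : ‖T • v‖ ≤ ‖(x : Cn n) + T • v‖ + ‖(x : Cn n)‖ := by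
        have := norm_sub_le ((x : Cn n) + T • v) x
        rwa [add_sub_cancel_left] at this
      rw [norm_smul, Real.norm_of_nonneg (by linarith)] at h4
      have h5 : R + η ≤ T * ‖v‖ := by
        rw [← div_le_iff₀ hvn]; exact le_max_right _ _
      linarith
    obtain ⟨ζ, ⟨t, ht, rfl⟩, hζ⟩ := hpre.inter_frontier_nonempty_of_isOpen hX h1 h2
    refine ⟨_, ⟨hζ, fun i => ?_⟩, ?_⟩
    · have h3 : ‖(x : Cn n) i‖ < ε :=
        (PiLp.norm_apply_le (x : Cn n) i).trans_lt (hxn.trans_le (min_le_right _ _))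
      have h4 : ‖(t • v) i‖ = t * (b i + ε) := by
        rw [PiLp.smul_apply, norm_smul, hvi, Complex.norm_real, Real.norm_of_nonneg (hbe i).le,
          Real.norm_of_nonneg (by linarith [ht.1])]
      have h5 : ‖(t • v) i‖ ≤ ‖((x : Cn n) + t • v) i‖ + ‖(x : Cn n) i‖ := by
        have := norm_sub_le (((x : Cn n) + t • v) i) ((x : Cn n) i)
        rwa [PiLp.add_apply, add_sub_cancel_left] at this
      nlinarith [ht.1, hbe i]
    · have hx0 : L (x : Cn n) = 0 := x.2
      ext1
      rw [kerProj_coe, map_add, map_smul, hx0, hLv]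
      simp
  have hle := (measure_mono hsub).trans
    ((kerProj L v hLv).lipschitz.lipschitzOnWith.euclideanHausdorffMeasure_image_le (2 * n - 1))
  have hpos : 0 < (μHE[2 * n - 1] : Measure (LinearMap.ker L.toLinearMap)) (Metric.ball 0 η) :=
    Metric.measure_ball_pos _ _ hη0
  by_contra hcon
  rw [not_lt, nonpos_iff_eq_zero] at hcon
  rw [hcon, mul_zero] at hle
  exact absurd hpos (not_lt.2 hle)

namespace QuotientQuadruple

variable {n : ℕ} {Q : QuotientQuadruple n}

/-- Every point of `X` lies well inside the polydiscs given by the points of a subset of positive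
measure of `Γ_X`. -/
theorem exists_polyannulus {z : Cn n} (hz : z ∈ Q.X) :
    ∃ b : Fin n → ℝ, ∃ ρ ∈ Ioo (0 : ℝ) 1, (∀ i, 0 < b i) ∧
      (∀ᶠ z' in 𝓝 z, ∀ i, ‖z' i‖ ≤ ρ * b i) ∧ 0 < Q.σ {ζ | ∀ i, b i < ‖ζ i‖} := by
  set v : ℝ → Cn n := fun t => WithLp.toLp 2 fun i => ((‖z i‖ + t : ℝ) : ℂ) with hv
  have hvc : Continuous v := (PiLp.continuous_toLp 2 _).comp (by fun_prop)
  have hv0 : v 0 ∈ Q.X := Q.reinhardt z hz _ fun i => by simp [hv]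
  have hev : ∀ᶠ t in 𝓝[>] (0 : ℝ), v t ∈ Q.X :=
    (hvc.continuousAt.eventually (Q.isOpen_X.mem_nhds hv0)).filter_mono nhdsWithin_le_nhds
  obtain ⟨ε, hεX, hε⟩ := (hev.and self_mem_nhdsWithin).exists
  have hε : 0 < ε := hε
  set B : ℝ := ‖z‖ + ε
  have hB : 0 < B := by positivity
  have hbB : ∀ i, ‖z i‖ + ε / 2 ≤ B := fun i => by
    have := PiLp.norm_apply_le z i
    simp only [B]; linarith
  have hεB : ε ≤ B := by simp only [B]; linarith [norm_nonneg z]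
  -- Each `b i` lies halfway between `‖z i‖` and a radius still inside `X`. Since `b i ≤ B`, the
  -- factor costs at most `ε / 4`, which leaves room `ε / 4` for `z'` around `z`.
  refine ⟨fun i => ‖z i‖ + ε / 2, 1 - ε / (4 * B), ⟨?_, ?_⟩, fun i => by positivity, ?_, ?_⟩
  · rw [sub_pos, div_lt_one (by positivity)]; linarith
  · have : 0 < ε / (4 * B) := by positivity
    linarith
  · have h1 : ∀ i, ∀ᶠ z' : Cn n in 𝓝 z, ‖z' i‖ < ‖z i‖ + ε / 4 := fun i => by
      have hc : Continuous fun w : Cn n => ‖w i‖ := by fun_prop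
      exact hc.continuousAt.eventually (gt_mem_nhds (by linarith))
    filter_upwards [eventually_all.2 h1] with z' hz' i
    refine (hz' i).le.trans ?_
    have h2 : ε / (4 * B) * (‖z i‖ + ε / 2) ≤ ε / 4 := by
      calc ε / (4 * B) * (‖z i‖ + ε / 2) ≤ ε / (4 * B) * B := by gcongr; exact hbB i
        _ = ε / 4 := by field_simp
    linarith
  · have hms : MeasurableSet {ζ : Cn n | ∀ i, ‖z i‖ + ε / 2 < ‖ζ i‖} := by
      have : {ζ : Cn n | ∀ i, ‖z i‖ + ε / 2 < ‖ζ i‖} = ⋂ i, {ζ : Cn n | ‖z i‖ + ε / 2 < ‖ζ i‖} := by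
        ext; simp
      rw [this]
      exact MeasurableSet.iInter fun i => (isOpen_lt continuous_const (by fun_prop)).measurableSet
    rw [σ, Measure.restrict_apply hms, inter_comm]
    rcases Q.model with ⟨hX, _, hb, _, hC, hΓ, hd⟩ | ⟨hX, hΓ, hd⟩
    · rw [hΓ, hd]
      refine measure_frontier_pos Q.n_pos hX hb (half_pos hε) (fun i => by positivity) ?_
      simp only [add_assoc, add_halves]
      exact hεX
    · rw [hΓ, hd]
      have : torus n ∩ {ζ : Cn n | ∀ i, ‖z i‖ + ε / 2 < ‖ζ i‖} = torus n := by
        refine inter_eq_left.2 fun ζ hζ i => ?_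
        have h1 : ‖v ε i‖ < 1 := by rw [hX] at hεX; exact hεX i
        rw [hζ i]
        simp only [hv, Complex.norm_real] at h1
        rw [Real.norm_of_nonneg (by positivity)] at h1
        linarith
      rw [this]
      exact measure_torus_pos n

/-! ### Averaging over rotations. -/

theorem measurePreserving_rot_prod (S : Finset (Fin n)) :
    MeasurePreserving (fun x : Cn n × ℝ => rot S x.2 x.1) (Q.σ.prod angleMeasure) Q.σ := by
  refine ⟨(continuous_rot S).measurable, ?_⟩
  ext s hs
  rw [Measure.map_apply (continuous_rot S).measurable hs,
    Measure.prod_apply_symm ((continuous_rot S).measurable hs)]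
  have : ∀ θ, Q.σ ((fun x => (x, θ)) ⁻¹' ((fun x : Cn n × ℝ => rot S x.2 x.1) ⁻¹' s)) = Q.σ s :=
    fun θ => (measurePreserving_rot (Q := Q) S θ).measure_preimage hs.nullMeasurableSet
  simp [this]

/-- Slicing: with `S` everything it averages over the circles of the discs `w ζ`, with `S` a
singleton over one coordinate. -/
theorem lintegral_rot (S : Finset (Fin n)) {F : Cn n → ℝ≥0∞} (hF : AEMeasurable F Q.σ) :
    ∫⁻ ζ, F ζ ∂Q.σ = ∫⁻ ζ, ∫⁻ θ, F (rot S θ ζ) ∂angleMeasure ∂Q.σ := by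
  have h := measurePreserving_rot_prod (Q := Q) S
  rw [← lintegral_prod (fun x : Cn n × ℝ => F (rot S x.2 x.1))
    (hF.comp_quasiMeasurePreserving h.quasiMeasurePreserving)]
  conv_lhs => rw [← h.map_eq]
  rw [lintegral_map' (by rwa [h.map_eq]) h.measurable.aemeasurable]

theorem ae_ae_rot (S : Finset (Fin n)) {P : Cn n → Prop} (hP : ∀ᵐ ζ ∂Q.σ, P ζ) :
    ∀ᵐ ζ ∂Q.σ, ∀ᵐ θ ∂angleMeasure, P (rot S θ ζ) :=
  Measure.ae_ae_of_ae_prod ((measurePreserving_rot_prod (Q := Q) S).quasiMeasurePreserving.ae hP)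

/-- The converse of `ae_ae_rot`. Measurability is needed here, because a set whose sections are null
need not be null otherwise. -/
theorem ae_of_ae_rot (S : Finset (Fin n)) {P : Cn n → Prop} (hm : MeasurableSet {ζ | P ζ})
    (h : ∀ᵐ ζ ∂Q.σ, ∀ᵐ θ ∂angleMeasure, P (rot S θ ζ)) : ∀ᵐ ζ ∂Q.σ, P ζ := by
  have hmp := measurePreserving_rot_prod (Q := Q) S
  have h0 := hmp.measure_preimage hm.compl.nullMeasurableSet
  have h1 : (Q.σ.prod angleMeasure) ((fun x : Cn n × ℝ => rot S x.2 x.1) ⁻¹' {ζ | P ζ}ᶜ) = 0 := by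
    rw [Measure.measure_prod_null (hmp.measurable hm.compl)]
    filter_upwards [h] with ζ hζ
    exact hζ
  rw [h1] at h0
  exact h0.symm

end QuotientQuadruple

/-! ### The Jacobian determinant and the boundary derivative of `Φ`. -/

/-- Symmetry of the real second derivative transfers complex linearity from one slot to the other,
so each directional derivative is again complex differentiable. -/
theorem differentiableOn_fderiv_apply {E F : Type*} [NormedAddCommGroup E] [NormedSpace ℂ E]
    [NormedAddCommGroup F] [NormedSpace ℂ F] {f : E → F} {X : Set E} (hX : IsOpen X)
    (hd : DifferentiableOn ℂ f X) (hc : ContDiffOn ℝ 2 f X) (v : E) :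
    DifferentiableOn ℂ (fun z => fderiv ℂ f z v) X := by
  intro z hz
  have hcz : ContDiffAt ℝ 2 f z := hc.contDiffAt (hX.mem_nhds hz)
  have hrs : ∀ y ∈ X, fderiv ℝ f y = (fderiv ℂ f y).restrictScalars ℝ := fun y hy =>
    ((hd y hy).differentiableAt (hX.mem_nhds hy)).fderiv_restrictScalars ℝ
  have hD : HasFDerivAt (fderiv ℝ f) (fderiv ℝ (fderiv ℝ f) z) z :=
    ((hcz.fderiv_right (m := 1) (by norm_num)).differentiableAt (by norm_num)).hasFDerivAt
  have hsymm : IsSymmSndFDerivAt ℝ f z := hcz.isSymmSndFDerivAt (by simp)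
  have happ : ∀ u, HasFDerivAt (fun y => fderiv ℝ f y u)
      ((fderiv ℝ (fderiv ℝ f) z).flip u) z := fun u => by
    simpa using hD.clm_apply (hasFDerivAt_const u z)
  have hI : ∀ u w, fderiv ℝ (fderiv ℝ f) z w (Complex.I • u) =
      Complex.I • fderiv ℝ (fderiv ℝ f) z w u := by
    intro u w
    have h1 := (happ u).const_smul Complex.I
    have h2 : (fun y => fderiv ℝ f y (Complex.I • u)) =ᶠ[𝓝 z]
        fun y => Complex.I • fderiv ℝ f y u := by
      filter_upwards [hX.mem_nhds hz] with y hy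
      rw [hrs y hy]
      simp
    have h3 := (h1.congr_of_eventuallyEq h2).unique (happ (Complex.I • u))
    simpa using (DFunLike.congr_fun h3 w).symm
  set A : E →L[ℝ] F := (fderiv ℝ (fderiv ℝ f) z).flip v with hA
  have hAI : ∀ u, A (Complex.I • u) = Complex.I • A u := fun u => by
    simp only [hA, ContinuousLinearMap.flip_apply]
    rw [hsymm, hI, hsymm]
  have hAc : ∀ (c : ℂ) u, A (c • u) = c • A u := fun c u => by
    conv_lhs => rw [← Complex.re_add_im c, add_smul, mul_smul, Complex.coe_smul, Complex.coe_smul,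
      map_add, map_smul, map_smul, hAI]
    conv_rhs => rw [← Complex.re_add_im c, add_smul, mul_smul, Complex.coe_smul, Complex.coe_smul]
  let A' : E →L[ℂ] F := { toFun := A, map_add' := A.map_add, map_smul' := hAc, cont := A.cont }
  have hfin : HasFDerivAt (fun y => fderiv ℝ f y v) A' z :=
    hasFDerivAt_of_restrictScalars ℝ (happ v) (by ext; rfl)
  refine (hfin.congr_of_eventuallyEq ?_).differentiableAt.differentiableWithinAt
  filter_upwards [hX.mem_nhds hz] with y hy
  rw [hrs y hy]
  rfl

namespace QuotientQuadruple

variable {n : ℕ} (Q : QuotientQuadruple n)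

/-- The complex Jacobian determinant of `Φ`. -/
noncomputable def jac (z : Cn n) : ℂ := (fderiv ℂ Q.Φ z).det

variable {Q}

theorem contDiffOn_X : ContDiffOn ℝ ∞ Q.Φ Q.X := Q.smooth.mono subset_closure

theorem fderiv_real {z : Cn n} (hz : z ∈ Q.X) :
    fderiv ℝ Q.Φ z = (fderiv ℂ Q.Φ z).restrictScalars ℝ :=
  ((Q.holomorphic z hz).differentiableAt (Q.isOpen_X.mem_nhds hz)).fderiv_restrictScalars ℝ

theorem det_fderiv_real {z : Cn n} (hz : z ∈ Q.X) : (fderiv ℝ Q.Φ z).det = ‖Q.jac z‖ ^ 2 := by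
  rw [fderiv_real hz, jac, ContinuousLinearMap.det, ContinuousLinearMap.det,
    ← Complex.normSq_eq_norm_sq, ← Algebra.norm_complex_apply, ← LinearMap.det_restrictScalars]
  rfl

theorem differentiableOn_jac : DifferentiableOn ℂ Q.jac Q.X := by
  set b := (EuclideanSpace.basisFun (Fin n) ℂ).toBasis
  have h : ∀ z, Q.jac z = ∑ s : Equiv.Perm (Fin n), (Equiv.Perm.sign s : ℂ) *
      ∏ i, (fderiv ℂ Q.Φ z (b i)) (s i) := by
    intro z
    rw [jac, ContinuousLinearMap.det, ← LinearMap.det_toMatrix b, Matrix.det_apply']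
    refine Finset.sum_congr rfl fun s _ => ?_
    congr 1
    refine Finset.prod_congr rfl fun i _ => ?_
    rw [LinearMap.toMatrix_apply]
    simp [b]
  rw [funext h]
  refine DifferentiableOn.fun_sum fun s _ => DifferentiableOn.const_mul ?_ _
  have h1 : ∀ i ∈ (Finset.univ : Finset (Fin n)),
      DifferentiableOn ℂ (fun z => (fderiv ℂ Q.Φ z (b i)) (s i)) Q.X := fun i _ =>
    (EuclideanSpace.proj (s i) : Cn n →L[ℂ] ℂ).differentiable.comp_differentiableOn
      (differentiableOn_fderiv_apply Q.isOpen_X Q.holomorphic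
        (contDiffOn_X.of_le ENat.LEInfty.out) (b i))
  exact fun z hz => (HasFDerivWithinAt.finsetProd fun i hi =>
    (h1 i hi z hz).hasFDerivWithinAt).differentiableWithinAt

/-- Otherwise `Ω`, as the image of a set of critical points, would be a null set, but it is open and
nonempty. -/
theorem exists_jac_ne_zero : ∃ z ∈ Q.X, Q.jac z ≠ 0 := by
  by_contra! hcon
  have h : (Measure.addHaar : Measure (Cn n)) (Q.Φ '' Q.X) = 0 := by
    refine addHaar_image_eq_zero_of_det_fderivWithin_eq_zero _ (f' := fderiv ℝ Q.Φ)
      (fun z hz => ?_) fun z hz => by rw [det_fderiv_real hz, hcon z hz]; simp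
    exact (((contDiffOn_X z hz).contDiffAt (Q.isOpen_X.mem_nhds hz)).differentiableAt
      (by simp)).hasFDerivAt.hasFDerivWithinAt
  rw [Q.surjective] at h
  exact (Q.isOpen_Ω.measure_pos _ Q.isConnected_Ω.nonempty).ne' h

theorem exists_boundary_fderiv {ζ : Cn n} (hζ : ζ ∈ closure Q.X) :
    ∃ L : Cn n →L[ℝ] Cn n, HasFDerivWithinAt Q.Φ L (closure Q.X) ζ ∧
      Tendsto (fderiv ℝ Q.Φ) (𝓝[Q.X] ζ) (𝓝 L) := by
  have h1 : ContDiffWithinAt ℝ (0 + 1) Q.Φ (closure Q.X) ζ :=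
    (Q.smooth ζ hζ).of_le (by simp)
  obtain ⟨u, hu, -, f', hf', hc⟩ := (contDiffWithinAt_succ_iff_hasFDerivWithinAt (by simp)).1 h1
  rw [insert_eq_of_mem hζ] at hu
  refine ⟨f' ζ, ((hf' ζ (mem_of_mem_nhdsWithin hζ hu)).mono_of_mem_nhdsWithin hu), ?_⟩
  have h2 : Tendsto f' (𝓝[Q.X] ζ) (𝓝 (f' ζ)) :=
    (hc.continuousWithinAt.tendsto).mono_left
      (nhdsWithin_le_of_mem (nhdsWithin_mono _ subset_closure hu))
  refine h2.congr' ?_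
  obtain ⟨V, hV, hζV, hVu⟩ := mem_nhdsWithin.1 hu
  filter_upwards [inter_mem_nhdsWithin Q.X (hV.mem_nhds hζV)] with y hy
  have hy2 : u ∈ 𝓝 y := by
    filter_upwards [(Q.isOpen_X.inter hV).mem_nhds hy] with x hx
    exact hVu ⟨hx.2, subset_closure hx.1⟩
  exact ((hf' y (mem_of_mem_nhds hy2)).hasFDerivAt hy2).fderiv.symm

theorem exists_jac_bound : ∃ M : ℝ, ∀ z ∈ Q.X, ‖Q.jac z‖ ≤ M := by
  have hK : IsCompact (closure Q.X) := Q.isBounded_X.isCompact_closure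
  have h : ∃ M : ℝ, ∀ z ∈ closure Q.X, z ∈ Q.X → ‖Q.jac z‖ ^ 2 ≤ M := by
    refine hK.induction_on (p := fun s => ∃ M : ℝ, ∀ z ∈ s, z ∈ Q.X → ‖Q.jac z‖ ^ 2 ≤ M)
      ⟨0, by simp⟩ (fun s t hst ⟨M, hM⟩ => ⟨M, fun z hz => hM z (hst hz)⟩) ?_ ?_
    · rintro s t ⟨M, hM⟩ ⟨N, hN⟩
      refine ⟨max M N, ?_⟩
      rintro z (hz | hz) hzX
      · exact (hM z hz hzX).trans (le_max_left _ _)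
      · exact (hN z hz hzX).trans (le_max_right _ _)
    · intro ζ hζ
      obtain ⟨L, -, hL⟩ := exists_boundary_fderiv hζ
      have h1 := (ContinuousLinearMap.continuous_det.tendsto L).comp hL
      have h2 := h1.eventually (gt_mem_nhds (lt_add_one L.det))
      refine ⟨_, nhdsWithin_le_nhds (eventually_nhdsWithin_iff.1 h2), L.det + 1,
        fun z hz hzX => ?_⟩
      rw [← det_fderiv_real hzX]
      exact (hz hzX).le
  obtain ⟨M, hM⟩ := h
  exact ⟨√M, fun z hz => Real.le_sqrt_of_sq_le (hM z (subset_closure hz) hz)⟩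

end QuotientQuadruple

/-! ### The Jacobian is nonzero somewhere on almost every slice. -/

/-- The point with coordinates `r ζ i` for `i ∈ S` and `a i` for `i ∉ S`. -/
noncomputable def mixPoint {n : ℕ} (S : Finset (Fin n)) (r : ℝ) (a ζ : Cn n) : Cn n :=
  WithLp.toLp 2 fun i => if i ∈ S then r * ζ i else a i

theorem mixPoint_apply {n : ℕ} (S : Finset (Fin n)) (r : ℝ) (a ζ : Cn n) (i : Fin n) :
    mixPoint S r a ζ i = if i ∈ S then r * ζ i else a i := rfl

theorem mixPoint_empty {n : ℕ} (r : ℝ) (a ζ : Cn n) : mixPoint ∅ r a ζ = a := by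
  ext i; simp [mixPoint_apply]

theorem mixPoint_univ {n : ℕ} (r : ℝ) (a ζ : Cn n) : mixPoint Finset.univ r a ζ = r • ζ := by
  ext i; simp [mixPoint_apply]

theorem continuous_mixPoint {n : ℕ} (S : Finset (Fin n)) (r : ℝ) (a : Cn n) :
    Continuous (mixPoint S r a) := by
  refine (PiLp.continuous_toLp 2 _).comp (continuous_pi fun i => ?_)
  by_cases h : i ∈ S
  · simp only [h, if_true]; fun_prop
  · simp only [h, if_false]; fun_prop

/-- The complex line through `mixPoint S r a ζ` in the direction of the coordinate `j`,
parametrised so that the unit circle is mapped to `‖z j‖ = r ‖ζ j‖`. -/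
noncomputable def mixLine {n : ℕ} (S : Finset (Fin n)) (r : ℝ) (a ζ : Cn n) (j : Fin n) (w : ℂ) :
    Cn n :=
  WithLp.toLp 2 fun i => if i = j then w * (r * ζ j) else mixPoint S r a ζ i

theorem mixLine_apply {n : ℕ} (S : Finset (Fin n)) (r : ℝ) (a ζ : Cn n) (j i : Fin n) (w : ℂ) :
    mixLine S r a ζ j w i = if i = j then w * (r * ζ j) else mixPoint S r a ζ i := rfl

theorem differentiable_mixLine {n : ℕ} (S : Finset (Fin n)) (r : ℝ) (a ζ : Cn n) (j : Fin n) :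
    Differentiable ℂ (mixLine S r a ζ j) := by
  rw [differentiable_euclidean]
  intro i
  by_cases h : i = j
  · simp only [mixLine_apply, h, if_true]; fun_prop
  · simp only [mixLine_apply, h, if_false]; fun_prop

theorem mixLine_circleMap {n : ℕ} {S : Finset (Fin n)} (r : ℝ) (a ζ : Cn n)
    {j : Fin n} (hj : j ∉ S) (θ : ℝ) :
    mixLine S r a ζ j (circleMap 0 1 θ) = mixPoint (insert j S) r a (rot {j} θ ζ) := by
  ext i
  rw [mixLine_apply, mixPoint_apply, mixPoint_apply, rot_apply]
  by_cases h : i = j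
  · subst h; simp [circleMap]; ring
  · simp only [h, if_false, Finset.mem_insert, false_or, Finset.mem_singleton, one_mul]

theorem mixLine_self {n : ℕ} {S : Finset (Fin n)} {r : ℝ} (hr : r ≠ 0) (a : Cn n) {ζ : Cn n}
    {j : Fin n} (hj : j ∉ S) (hζ : ζ j ≠ 0) :
    mixLine S r a ζ j (a j / (r * ζ j)) = mixPoint S r a ζ := by
  ext i
  rw [mixLine_apply]
  split_ifs with h
  · subst h
    have : (r : ℂ) ≠ 0 := by exact_mod_cast hr
    rw [mixPoint_apply, if_neg hj]
    field_simp
  · rfl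

namespace QuotientQuadruple

variable {n : ℕ} {Q : QuotientQuadruple n}

theorem mixPoint_mem_X {S : Finset (Fin n)} {r : ℝ} (hr : r ∈ Ioo (0 : ℝ) 1) {a ζ : Cn n}
    (hζ : ζ ∈ Q.Γ) (ha : ∀ i, ‖a i‖ ≤ r * ‖ζ i‖) : mixPoint S r a ζ ∈ Q.X := by
  refine mem_X_of_le hr hζ fun i => ?_
  rw [mixPoint_apply]
  split_ifs
  · simp [abs_of_pos hr.1]
  · exact ha i

theorem mixLine_mem_X {S : Finset (Fin n)} {r : ℝ} (hr : r ∈ Ioo (0 : ℝ) 1) {a ζ : Cn n}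
    (hζ : ζ ∈ Q.Γ) (ha : ∀ i, ‖a i‖ ≤ r * ‖ζ i‖) {j : Fin n} {w : ℂ} (hw : ‖w‖ ≤ 1) :
    mixLine S r a ζ j w ∈ Q.X := by
  refine mem_X_of_le hr hζ fun i => ?_
  rw [mixLine_apply, mixPoint_apply]
  split_ifs with h1 h2
  · subst h1
    simp only [norm_mul, Complex.norm_real, Real.norm_of_nonneg hr.1.le]
    exact mul_le_of_le_one_left (mul_nonneg hr.1.le (norm_nonneg _)) hw
  · simp [abs_of_pos hr.1]
  · exact ha i

theorem ae_coord_ne_zero : ∀ᵐ ζ ∂Q.σ, ∀ i, ζ i ≠ 0 := by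
  rcases Q.model with ⟨_, _, _, _, _, hΓ, hd⟩ | ⟨_, hΓ, _⟩
  · rw [ae_all_iff]
    intro i
    rw [σ, hd]
    refine ae_restrict_of_ae ?_
    rw [ae_iff]
    simpa using measure_coord_eq_zero i
  · filter_upwards [ae_mem_Γ (Q := Q)] with ζ hζ i h0
    rw [hΓ] at hζ
    have := hζ i
    simp [h0] at this

theorem measurable_indicator_X {E : Type*} [NormedAddCommGroup E] [MeasurableSpace E]
    [BorelSpace E] {f : Cn n → E} (hf : ContinuousOn f Q.X) : Measurable (Q.X.indicator f) := by
  classical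
  rw [← piecewise_eq_indicator]
  exact hf.measurable_piecewise continuousOn_const Q.isOpen_X.measurableSet

/-- On the disc through a point where the Jacobian is nonzero, the identity theorem forbids
vanishing near the origin. -/
theorem exists_small_jac_ne_zero {δ : ℝ} (hδ : 0 < δ) :
    ∃ a ∈ Q.X, Q.jac a ≠ 0 ∧ ∀ i, ‖a i‖ < δ := by
  obtain ⟨z, hz, hJ⟩ := exists_jac_ne_zero (Q := Q)
  have hc : Continuous fun R : ℝ => R • z := by fun_prop
  have hev : ∀ᶠ R : ℝ in 𝓝[>] 1, R • z ∈ Q.X :=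
    (hc.continuousAt.eventually (Q.isOpen_X.mem_nhds (by simpa using hz))).filter_mono
      nhdsWithin_le_nhds
  obtain ⟨R, hRX, hR⟩ := (hev.and self_mem_nhdsWithin).exists
  have hR : 1 < R := hR
  have hmem : ∀ c ∈ Metric.ball (0 : ℂ) R, c • z ∈ Q.X := fun c hc' => by
    rw [mem_ball_zero_iff] at hc'
    refine Q.reinhardt _ hRX _ fun i => ?_
    simp only [PiLp.smul_apply, norm_smul, Real.norm_of_nonneg (zero_le_one.trans hR.le)]
    gcongr
  have han : AnalyticOnNhd ℂ (fun c : ℂ => Q.jac (c • z)) (Metric.ball 0 R) :=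
    DifferentiableOn.analyticOnNhd (differentiableOn_jac.comp
      (by fun_prop : Differentiable ℂ fun c : ℂ => c • z).differentiableOn hmem)
      Metric.isOpen_ball
  have h0 : (0 : ℂ) ∈ Metric.ball (0 : ℂ) R := by simp; linarith
  have hfr : ∃ᶠ c in 𝓝 (0 : ℂ), Q.jac (c • z) ≠ 0 := by
    intro hcon
    have hcon' : ∀ᶠ c in 𝓝 (0 : ℂ), Q.jac (c • z) = 0 := by simpa using hcon
    have := han.eqOn_zero_of_preconnected_of_eventuallyEq_zero
      (convex_ball (0 : ℂ) R).isPreconnected h0 hcon'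
    exact hJ (by simpa using this (x := 1) (by simpa using hR))
  have hsm : ∀ᶠ c in 𝓝 (0 : ℂ), ∀ i, ‖(c • z) i‖ < δ := by
    rw [eventually_all]
    intro i
    have hci : Continuous fun c : ℂ => ‖(c • z) i‖ := by fun_prop
    exact hci.continuousAt.eventually (gt_mem_nhds (by simpa using hδ))
  obtain ⟨c, hcJ, hcs, hcb⟩ :=
    (hfr.and_eventually (hsm.and (Metric.isOpen_ball.mem_nhds h0))).exists
  exact ⟨c • z, hmem c hcb, hcJ, hcs⟩

/-- The coordinates of `a` are replaced by those of `r ζ` one at a time. Along `mixLine` the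
Jacobian is a bounded holomorphic function of one variable, nonzero at the interior point `a j / (r
ζ j)` by induction, hence nonzero at almost every point of the unit circle. The lower bound `ε` on
the coordinates of `ζ` keeps that point inside the disc. -/
theorem ae_jac_mixPoint_ne_zero {ε : ℝ} {r : ℝ} (hr : r ∈ Ioo (0 : ℝ) 1)
    {a : Cn n} (haJ : Q.jac a ≠ 0) (ha : ∀ i, ‖a i‖ < r * ε) (S : Finset (Fin n)) :
    ∀ᵐ ζ ∂Q.σ, (∀ i, ε < ‖ζ i‖) → Q.jac (mixPoint S r a ζ) ≠ 0 := by
  induction S using Finset.induction_on with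
  | empty => simp [mixPoint_empty, haJ]
  | insert j S hj ih =>
    obtain ⟨M, hM⟩ := exists_jac_bound (Q := Q)
    have hM0 : 0 < max M 1 := lt_max_of_lt_right one_pos
    have hle : ∀ {ζ : Cn n}, (∀ i, ε < ‖ζ i‖) → ∀ i, ‖a i‖ ≤ r * ‖ζ i‖ := fun hζ i =>
      (ha i).le.trans (mul_le_mul_of_nonneg_left (hζ i).le hr.1.le)
    suffices h : ∀ᵐ ζ ∂Q.σ, (∀ i, ε < ‖ζ i‖) →
        Q.X.indicator Q.jac (mixPoint (insert j S) r a ζ) ≠ 0 by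
      filter_upwards [h, ae_mem_Γ] with ζ h1 hζ h2
      have h3 := h1 h2
      rwa [indicator_of_mem (mixPoint_mem_X hr hζ (hle h2))] at h3
    have hJm := measurable_indicator_X (Q := Q) differentiableOn_jac.continuousOn
    refine ae_of_ae_rot {j} ?_ ?_
    · refine MeasurableSet.imp ?_ ?_
      · rw [ofPred_forall]
        exact MeasurableSet.iInter fun i =>
          measurableSet_lt measurable_const (by fun_prop)
      · exact (hJm.comp (continuous_mixPoint _ r a).measurable)
          (measurableSet_singleton (0 : ℂ)).compl
    · filter_upwards [ih, ae_mem_Γ] with ζ h1 hζ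
      by_cases h2 : ∀ i, ε < ‖ζ i‖
      swap
      · refine ae_of_all _ fun θ h3 => absurd (fun i => ?_) h2
        rw [← norm_rot_apply {j} θ ζ i]; exact h3 i
      have hζj : ζ j ≠ 0 := fun h0 => by
        have h3 := ha j
        have h4 := h2 j
        rw [h0, norm_zero] at h4
        nlinarith [norm_nonneg (a j), hr.1]
      have hJle := hle h2
      have hmem : ∀ w ∈ Metric.closedBall (0 : ℂ) 1, mixLine S r a ζ j w ∈ Q.X := fun w hw =>
        mixLine_mem_X hr hζ hJle (by simpa using hw)
      have hdiff : ∀ w ∈ Metric.closedBall (0 : ℂ) 1,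
          DifferentiableAt ℂ (fun w => Q.jac (mixLine S r a ζ j w) / (max M 1 : ℝ)) w :=
        fun w hw => (DifferentiableAt.comp w (differentiableOn_jac.differentiableAt
          (Q.isOpen_X.mem_nhds (hmem w hw))) (differentiable_mixLine S r a ζ j w)).div_const _
      have haw : a j / (r * ζ j) ∈ Metric.ball (0 : ℂ) 1 := by
        rw [mem_ball_zero_iff, norm_div, norm_mul, Complex.norm_real,
          Real.norm_of_nonneg hr.1.le, div_lt_one (mul_pos hr.1 (norm_pos_iff.2 hζj))]
        exact (ha j).trans (mul_lt_mul_of_pos_left (h2 j) hr.1)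
      have key := ae_radial_limit_ne_zero
        (f := fun w => Q.jac (mixLine S r a ζ j w) / (max M 1 : ℝ))
        (u := fun θ => Q.jac (mixLine S r a ζ j (circleMap 0 1 θ)) / (max M 1 : ℝ))
        (fun w hw => (hdiff w (Metric.ball_subset_closedBall hw)).differentiableWithinAt)
        (fun w hw => by
          rw [norm_div, Complex.norm_real, Real.norm_of_nonneg hM0.le, div_le_one hM0]
          exact (hM _ (hmem w (Metric.ball_subset_closedBall hw))).trans (le_max_left _ _))
        haw (by
          simp only
          rw [mixLine_self hr.1.ne' a hj hζj]
          exact div_ne_zero (h1 h2) (by exact_mod_cast hM0.ne'))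
        (ae_of_all _ fun θ => by
          have hcm : Continuous fun s : ℝ => circleMap 0 s θ := by
            unfold circleMap; fun_prop
          have h5 := ((hdiff (circleMap 0 1 θ) (by simp)).continuousAt.tendsto).comp
            (hcm.tendsto 1)
          exact h5.mono_left nhdsWithin_le_nhds)
      filter_upwards [key] with θ h6 _
      rw [mixLine_circleMap r a ζ hj] at h6
      have h7 : mixPoint (insert j S) r a (rot {j} θ ζ) ∈ Q.X := by
        rw [← mixLine_circleMap r a ζ hj]
        exact hmem _ (by simp)
      rw [indicator_of_mem h7]
      exact fun h0 => h6 (by rw [h0, zero_div])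

/-- It supplies one interior point of almost every slice at which the Jacobian is nonzero. Any fixed
radius would do; since almost every `ζ` has nonzero coordinates, countably many lower bounds `1 / (k
+ 1)` exhaust `Γ_X`. -/
theorem ae_jac_half_ne_zero : ∀ᵐ ζ ∂Q.σ, Q.jac ((1 / 2 : ℝ) • ζ) ≠ 0 := by
  have hr : (1 / 2 : ℝ) ∈ Ioo (0 : ℝ) 1 := by norm_num
  have h : ∀ k : ℕ, ∀ᵐ ζ ∂Q.σ, (∀ i, 1 / ((k : ℝ) + 1) < ‖ζ i‖) →
      Q.jac ((1 / 2 : ℝ) • ζ) ≠ 0 := by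
    intro k
    obtain ⟨a, -, haJ, ha⟩ := exists_small_jac_ne_zero (Q := Q)
      (δ := 1 / 2 * (1 / ((k : ℝ) + 1))) (by positivity)
    have := ae_jac_mixPoint_ne_zero hr haJ ha Finset.univ
    simpa only [mixPoint_univ] using this
  filter_upwards [ae_all_iff.2 h, ae_coord_ne_zero] with ζ h1 h2
  have h3 : ∀ i, ∀ᶠ k : ℕ in atTop, 1 / ((k : ℝ) + 1) < ‖ζ i‖ := fun i =>
    tendsto_one_div_add_atTop_nhds_zero_nat.eventually (gt_mem_nhds (norm_pos_iff.2 (h2 i)))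
  obtain ⟨k, hk⟩ := (eventually_all.2 h3).exists
  exact h1 k hk

end QuotientQuadruple

/-! ### Positivity of the pullback density. -/

/-- Points with the same `k` and close to the same point of a dense sequence form a set on which the
inverse of `f` is `(k + 1)`-Lipschitz. There are countably many such sets. -/
theorem euclideanHausdorffMeasure_eq_zero_of_image {E F : Type*} [MetricSpace E]
    [TopologicalSpace.SeparableSpace E] [MeasurableSpace E] [BorelSpace E] [MetricSpace F]
    [MeasurableSpace F] [BorelSpace F] {f : E → F} {s : Set E} {d : ℕ}
    (h : ∀ x ∈ s, ∃ k : ℕ, ∀ y ∈ s, dist y x < 1 / ((k : ℝ) + 1) →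
      dist y x ≤ (k + 1) * dist (f y) (f x))
    (h0 : (μHE[d] : Measure F) (f '' s) = 0) : (μHE[d] : Measure E) s = 0 := by
  rcases isEmpty_or_nonempty E with _ | _
  · rw [eq_empty_of_isEmpty s, measure_empty]
  set A : ℕ → ℕ → Set E := fun k m => {x ∈ s | (∀ y ∈ s, dist y x < 1 / ((k : ℝ) + 1) →
    dist y x ≤ (k + 1) * dist (f y) (f x)) ∧
      dist x (TopologicalSpace.denseSeq E m) < 1 / ((k : ℝ) + 1) / 2} with hA
  have hcov : s ⊆ ⋃ k, ⋃ m, A k m := by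
    intro x hx
    obtain ⟨k, hk⟩ := h x hx
    have hk0 : 0 < 1 / ((k : ℝ) + 1) / 2 := by positivity
    obtain ⟨m, hm⟩ := (TopologicalSpace.denseRange_denseSeq E).exists_dist_lt x hk0
    exact mem_iUnion₂.2 ⟨k, m, hx, hk, hm⟩
  refine measure_mono_null hcov (measure_iUnion_null fun k => measure_iUnion_null fun m => ?_)
  have hle := euclideanHausdorffMeasure_le_of_dist_le (f := f) (s := A k m)
    (K := (k : ℝ≥0) + 1) (fun x hx y hy => by
      have h1 := dist_triangle_right x y (TopologicalSpace.denseSeq E m)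
      have h2 := hy.2.1 x hx.1 (by linarith [hx.2.2, hy.2.2])
      simpa using h2) d
  have h1 : (μHE[d] : Measure F) (f '' A k m) = 0 :=
    measure_mono_null (image_mono fun x hx => hx.1) h0
  rw [h1, mul_zero] at hle
  exact nonpos_iff_eq_zero.1 hle

namespace QuotientQuadruple

variable {n : ℕ} {Q : QuotientQuadruple n}

theorem circleMap_smul (r θ : ℝ) (ζ : Cn n) :
    circleMap 0 r θ • ζ = r • rot Finset.univ θ ζ := by
  rw [rot_univ, circleMap, zero_add, mul_smul, Complex.coe_smul]

theorem differentiableOn_slice {E : Type*} [NormedAddCommGroup E] [NormedSpace ℂ E]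
    {f : Cn n → E} (hf : DifferentiableOn ℂ f Q.X) {ζ : Cn n} (hζ : ζ ∈ Q.Γ) :
    DifferentiableOn ℂ (fun w : ℂ => f (w • ζ)) (Metric.ball 0 1) :=
  hf.comp (by fun_prop : Differentiable ℂ fun w : ℂ => w • ζ).differentiableOn
    fun w hw => smul_mem_X (by simpa using hw) hζ

/-- On almost every slice the Jacobian is bounded and not identically zero, so its radial limits are
nonzero. The sequence of radii and the extension by zero make the exceptional set visibly Borel, as
`ae_of_ae_rot` requires. -/
theorem ae_not_tendsto_jac_zero : ∀ᵐ ζ ∂Q.σ,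
    ¬ Tendsto (fun j => Q.X.indicator Q.jac (radius j • ζ)) atTop (𝓝 0) := by
  have hJm := measurable_indicator_X (Q := Q) differentiableOn_jac.continuousOn
  refine ae_of_ae_rot Finset.univ ?_ ?_
  · exact (measurableSet_tendsto (𝓝 0) fun j =>
      hJm.comp (measurable_const_smul (radius j))).compl
  · obtain ⟨M, hM⟩ := exists_jac_bound (Q := Q)
    have hM0 : 0 < max M 1 := lt_max_of_lt_right one_pos
    filter_upwards [ae_jac_half_ne_zero, ae_mem_Γ] with ζ h1 hζ
    have hd : DifferentiableOn ℂ (fun w : ℂ => Q.jac (w • ζ) / (max M 1 : ℝ))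
        (Metric.ball 0 1) := (differentiableOn_slice differentiableOn_jac hζ).div_const _
    have hb : ∀ w ∈ Metric.ball (0 : ℂ) 1, ‖Q.jac (w • ζ) / (max M 1 : ℝ)‖ ≤ 1 := by
      intro w hw
      rw [norm_div, Complex.norm_real, Real.norm_of_nonneg hM0.le, div_le_one hM0]
      exact (hM _ (smul_mem_X (by simpa using hw) hζ)).trans (le_max_left _ _)
    obtain ⟨u, hu⟩ := Filter.Eventually.choice (angleMeasure_absolutelyContinuous.ae_le
      (ae_tendsto_radial_of_bounded hd hb))
    have hne := ae_radial_limit_ne_zero hd hb (a := ((1 / 2 : ℝ) : ℂ))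
      (by rw [mem_ball_zero_iff, Complex.norm_real]; norm_num)
      (by
        simp only [Complex.coe_smul]
        exact div_ne_zero h1 (by exact_mod_cast hM0.ne')) hu
    filter_upwards [hu, hne] with θ h2 h3 h4
    refine h3 (tendsto_nhds_unique (h2.comp tendsto_radius) ?_)
    have h5 := h4.div_const ((max M 1 : ℝ) : ℂ)
    rw [zero_div] at h5
    refine h5.congr fun j => ?_
    simp only [Function.comp, circleMap_smul]
    rw [indicator_of_mem (smul_mem (radius_mem j) ((rot_mem_Γ_iff _ θ ζ).2 hζ))]

theorem tendsto_smul_X {ζ : Cn n} (hζ : ζ ∈ Q.Γ) :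
    Tendsto (fun r : ℝ => r • ζ) (𝓝[<] 1) (𝓝[Q.X] ζ) := by
  refine tendsto_nhdsWithin_iff.2 ⟨?_, ?_⟩
  · have : Tendsto (fun r : ℝ => r • ζ) (𝓝 1) (𝓝 ((1 : ℝ) • ζ)) :=
      Continuous.tendsto (by fun_prop) 1
    rw [one_smul] at this
    exact this.mono_left nhdsWithin_le_nhds
  · filter_upwards [Ioo_mem_nhdsLT (zero_lt_one' ℝ)] with r hr using smul_mem hr hζ

/-- Where the Jacobian does not tend to zero along the radius, the boundary derivative is
invertible, hence bounded below, and dominates the first-order error near `ζ`. -/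
theorem ae_exists_dist_le : ∀ᵐ ζ ∂Q.σ, ∃ k : ℕ, ∀ y ∈ Q.Γ, dist y ζ < 1 / ((k : ℝ) + 1) →
    dist y ζ ≤ (k + 1) * dist (Q.Φ y) (Q.Φ ζ) := by
  filter_upwards [ae_not_tendsto_jac_zero, ae_mem_Γ] with ζ h1 hζ
  obtain ⟨L, hL, hlim⟩ := exists_boundary_fderiv (Γ_subset_closure hζ)
  have hdet : L.det ≠ 0 := by
    intro h0
    have h2 := ((ContinuousLinearMap.continuous_det.tendsto L).comp hlim).comp
      ((tendsto_smul_X hζ).comp tendsto_radius)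
    rw [h0] at h2
    refine h1 (tendsto_zero_iff_norm_tendsto_zero.2 ?_)
    have h3 := h2.sqrt
    rw [Real.sqrt_zero] at h3
    refine h3.congr fun j => ?_
    have hj := smul_mem (radius_mem j) hζ
    simp only [Function.comp]
    rw [det_fderiv_real hj, Real.sqrt_sq (norm_nonneg _), indicator_of_mem hj]
  have hker : LinearMap.ker (L : Cn n →ₗ[ℝ] Cn n) = ⊥ := by
    rw [← LinearMap.isUnit_iff_ker_eq_bot, LinearMap.isUnit_iff_isUnit_det]
    exact isUnit_iff_ne_zero.2 hdet
  obtain ⟨K, hK, hanti⟩ := LinearMap.exists_antilipschitzWith _ hker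
  have hK' : (0 : ℝ) < K := hK
  have hlit := (hasFDerivWithinAt_iff_isLittleO.1 hL).def
    (show (0 : ℝ) < (2 * K)⁻¹ by positivity)
  obtain ⟨δ, hδ, hδ'⟩ := Metric.mem_nhdsWithin_iff.1 hlit
  obtain ⟨k₁, hk₁⟩ := exists_nat_one_div_lt hδ
  obtain ⟨k₂, hk₂⟩ := exists_nat_ge (2 * (K : ℝ))
  refine ⟨max k₁ k₂, fun y hy hyd => ?_⟩
  have hmono : 1 / (((max k₁ k₂ : ℕ) : ℝ) + 1) ≤ 1 / ((k₁ : ℝ) + 1) := by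
    gcongr; exact le_max_left _ _
  have h3 := hδ' ⟨by rw [Metric.mem_ball]; linarith, Γ_subset_closure hy⟩
  have h3 : ‖Q.Φ y - Q.Φ ζ - L (y - ζ)‖ ≤ (2 * (K : ℝ))⁻¹ * ‖y - ζ‖ := h3
  have h4 : ‖y - ζ‖ ≤ K * ‖L (y - ζ)‖ := by
    have := hanti.le_mul_dist (y - ζ) 0
    simpa using this
  have h5 : ‖L (y - ζ)‖ ≤ ‖Q.Φ y - Q.Φ ζ‖ + ‖Q.Φ y - Q.Φ ζ - L (y - ζ)‖ := by
    have := norm_sub_le (Q.Φ y - Q.Φ ζ) (Q.Φ y - Q.Φ ζ - L (y - ζ))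
    rwa [sub_sub_cancel] at this
  rw [dist_eq_norm, dist_eq_norm]
  have h6 : ‖y - ζ‖ ≤ 2 * K * ‖Q.Φ y - Q.Φ ζ‖ := by
    have h7 : (K : ℝ) * ((2 * (K : ℝ))⁻¹ * ‖y - ζ‖) = ‖y - ζ‖ / 2 := by field_simp
    have h8 : ‖y - ζ‖ ≤ K * (‖Q.Φ y - Q.Φ ζ‖ + (2 * (K : ℝ))⁻¹ * ‖y - ζ‖) :=
      h4.trans (mul_le_mul_of_nonneg_left (by linarith) hK'.le)
    rw [mul_add, h7] at h8
    linarith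
  refine h6.trans (mul_le_mul_of_nonneg_right ?_ (norm_nonneg _))
  have : (k₂ : ℝ) ≤ ((max k₁ k₂ : ℕ) : ℝ) := by exact_mod_cast le_max_right _ _
  linarith

theorem continuousOn_Φ : ContinuousOn Q.Φ (closure Q.X) := Q.smooth.continuousOn

/-- If `w` vanished on a compact set `K` of positive measure consisting of good points, then by
invariance it would vanish on the whole preimage of `Φ(K)` in `Γ_X`, a union of orbits. So `Φ(K)`
would be null, and then `K` too, since `Φ` is locally bounded below there. -/
theorem ae_ne_zero_of_isPullbackDensity {w : Cn n → ℝ} (hw : Q.IsPullbackDensity w) :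
    ∀ᵐ ζ ∂Q.σ, w ζ ≠ 0 := by
  obtain ⟨S, hSsub, hSm, hS0⟩ := exists_measurable_superset_of_null
    (ae_iff.1 ((ae_exists_dist_le (Q := Q)).and (Q.boundary_fibre.and (ae_mem_Γ (Q := Q)))))
  have hgood : ∀ ζ ∉ S, (∃ k : ℕ, ∀ y ∈ Q.Γ, dist y ζ < 1 / ((k : ℝ) + 1) →
      dist y ζ ≤ (k + 1) * dist (Q.Φ y) (Q.Φ ζ)) ∧
      (∀ ξ ∈ Q.Γ, Q.Φ ξ = Q.Φ ζ → ∃ τ ∈ Q.G, τ ζ = ξ) ∧ ζ ∈ Q.Γ := fun ζ hζ => by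
    by_contra hcon
    exact hζ (hSsub hcon)
  have hA : MeasurableSet ({ζ | w ζ = 0} \ S) :=
    (hw.measurable (measurableSet_singleton 0)).diff hSm
  have hA0 : Q.σ ({ζ | w ζ = 0} \ S) = 0 := by
    by_contra hpos
    obtain ⟨K, hKA, hK, hKpos⟩ := hA.exists_lt_isCompact (pos_iff_ne_zero.2 hpos)
    have hKΓ : K ⊆ Q.Γ := fun ζ hζ => (hgood ζ (hKA hζ).2).2.2
    have hE : IsCompact (Q.Φ '' K) :=
      hK.image_of_continuousOn (continuousOn_Φ.mono (hKΓ.trans Γ_subset_closure))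
    have hcv := hw.change_of_variables _ hE.measurableSet
    have hz : ∫⁻ ζ in Q.Γ ∩ Q.Φ ⁻¹' (Q.Φ '' K), ENNReal.ofReal (w ζ) ∂Q.σ = 0 := by
      refine setLIntegral_eq_zero ((continuousOn_Φ.mono Γ_subset_closure).preimage_isClosed_of_isClosed
        isClosed_Γ hE.isClosed).measurableSet fun ζ hζ => ?_
      obtain ⟨hζΓ, ξ, hξ, hξζ⟩ := hζ
      obtain ⟨τ, hτ, rfl⟩ := (hgood ξ (hKA hξ).2).2.1 ζ hζΓ hξζ.symm
      rw [hw.invariant τ hτ ξ (hKΓ hξ), (hKA hξ).1, ENNReal.ofReal_zero, Pi.zero_apply]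
    rw [hz, mul_zero, m, Measure.restrict_apply hE.measurableSet,
      ΓΩ, inter_eq_left.2 (image_mono hKΓ)] at hcv
    have h1 := euclideanHausdorffMeasure_eq_zero_of_image (s := K)
      (fun x hx => by
        obtain ⟨k, hk⟩ := (hgood x (hKA hx).2).1
        exact ⟨k, fun y hy => hk y (hKΓ hy)⟩) hcv.symm
    have h2 : Q.σ K = 0 := by
      rw [σ, Measure.restrict_apply hK.measurableSet]
      exact measure_mono_null inter_subset_left h1
    exact hKpos.ne' h2
  rw [ae_iff]
  refine measure_mono_null (t := ({ζ | w ζ = 0} \ S) ∪ S) (fun ζ hζ => ?_)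
    (measure_union_null hA0 hS0)
  have hζ : w ζ = 0 := by simpa using hζ
  by_cases h : ζ ∈ S
  · exact Or.inr h
  · exact Or.inl ⟨hζ, h⟩

end QuotientQuadruple

/-! ### Radial limits on `Γ_X` and the norm identity, by slicing. -/

/-- Rational radii detect the radial limit of a continuous function, so the set of points with a
radial limit is determined by countably many functions and is Borel. -/
theorem tendsto_of_tendsto_rat {E : Type*} [TopologicalSpace E] [RegularSpace E] {f : ℝ → E}
    (hf : ContinuousOn f (Ioo 0 1)) {c : E}
    (h : Tendsto (fun q : ℚ => f q) (comap (fun q : ℚ => (q : ℝ)) (𝓝[<] 1)) (𝓝 c)) :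
    Tendsto f (𝓝[<] 1) (𝓝 c) := by
  rw [(closed_nhds_basis c).tendsto_right_iff]
  rintro V ⟨hV, hVc⟩
  obtain ⟨t, ht, htV⟩ := mem_comap.1 (h hV)
  obtain ⟨δ, hδ, hδt⟩ := (mem_nhdsLT_iff_exists_Ioo_subset' (zero_lt_one' ℝ)).1 ht
  have hmax : max 0 δ < 1 := max_lt one_pos hδ
  filter_upwards [Ioo_mem_nhdsLT hmax] with r hr
  have hr0 : r ∈ Ioo (0 : ℝ) 1 := ⟨(le_max_left _ _).trans_lt hr.1, hr.2⟩
  have hcl : r ∈ closure (range (fun q : ℚ => (q : ℝ)) ∩ Ioo (max 0 δ) 1) := by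
    rw [inter_comm]
    exact Dense.open_subset_closure_inter Rat.denseRange_cast isOpen_Ioo hr
  have hcont : ContinuousWithinAt f (range (fun q : ℚ => (q : ℝ)) ∩ Ioo (max 0 δ) 1) r :=
    (hf.continuousAt (isOpen_Ioo.mem_nhds hr0)).continuousWithinAt
  have hmaps := hcont.mem_closure_image hcl
  refine (closure_minimal ?_ hVc) hmaps
  rintro _ ⟨_, ⟨⟨q, rfl⟩, hq⟩, rfl⟩
  exact htV (show (q : ℝ) ∈ t from hδt ⟨(le_max_right _ _).trans_lt hq.1, hq.2⟩)

namespace QuotientQuadruple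

variable {n : ℕ} {Q : QuotientQuadruple n} {g : Cn n → ℂ} {p : ℝ} {f : Cn n → ℂ}

theorem differentiableOn_comp (hf : DifferentiableOn ℂ f Q.Ω) :
    DifferentiableOn ℂ (fun z => f (Q.Φ z)) Q.X :=
  hf.comp Q.holomorphic Q.mapsTo

theorem measurableSet_tendsto_radial {h : Cn n → ℂ} (hh : ContinuousOn h Q.X) :
    MeasurableSet {ζ | ζ ∈ Q.Γ ∧ ∃ c, Tendsto (fun r : ℝ => h (r • ζ)) (𝓝[<] 1) (𝓝 c)} := by
  have hm : MeasurableSet {ζ | ∃ c, Tendsto (fun q : ℚ => Q.X.indicator h ((q : ℝ) • ζ))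
      (comap (fun q : ℚ => (q : ℝ)) (𝓝[<] 1)) (𝓝 c)} :=
    measurableSet_exists_tendsto fun q =>
      (measurable_indicator_X hh).comp (measurable_const_smul (q : ℝ))
  convert isClosed_Γ.measurableSet.inter hm using 1
  ext ζ
  refine and_congr_right fun hζ => exists_congr fun c => ?_
  have heq : (fun r : ℝ => Q.X.indicator h (r • ζ)) =ᶠ[𝓝[<] 1] fun r => h (r • ζ) := by
    filter_upwards [Ioo_mem_nhdsLT (zero_lt_one' ℝ)] with r hr
    rw [indicator_of_mem (smul_mem hr hζ)]
  rw [← tendsto_congr' heq]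
  refine ⟨fun h1 => h1.comp tendsto_comap, fun h1 => ?_⟩
  refine tendsto_of_tendsto_rat (f := fun r : ℝ => Q.X.indicator h (r • ζ)) ?_ h1
  refine ContinuousOn.congr (f := fun r : ℝ => h (r • ζ)) ?_ fun r hr =>
    indicator_of_mem (smul_mem hr hζ) h
  exact hh.comp (by fun_prop) fun r hr => smul_mem hr hζ

theorem ae_exists_limit_ne_zero (hg : Q.IsAdmissible g) : ∀ᵐ ζ ∂Q.σ, ∃ c : ℂ, c ≠ 0 ∧
    Tendsto (fun r : ℝ => g (r • ζ)) (𝓝[<] 1) (𝓝 c) := by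
  obtain ⟨w, hw, hlim⟩ := hg.boundary
  filter_upwards [hlim, ae_ne_zero_of_isPullbackDensity hw] with ζ ⟨c, hc, hcw⟩ hne
  refine ⟨c, fun h0 => hne ?_, hc⟩
  rw [← hcw, h0]
  simp

/-- Existence of radial limits, and the Hardy norm as an integral over `Γ_X`. -/
theorem ae_tendsto_radial_and_iSup_eq (hg : Q.IsAdmissible g) (hp : 0 < p)
    (hf : DifferentiableOn ℂ f Q.Ω)
    (hbd : ⨆ r ∈ Ioo (0 : ℝ) 1, Q.hardyIntegral g p f r ≠ ⊤) :
    (∀ᵐ ζ ∂Q.σ, ∃ c, Tendsto (fun r : ℝ => f (Q.Φ (r • ζ))) (𝓝[<] 1) (𝓝 c)) ∧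
    ∀ N : Cn n → ℝ≥0∞, (∀ᵐ ζ ∂Q.σ, Tendsto
        (fun r : ℝ => ‖f (Q.Φ (r • ζ))‖ₑ ^ p * ‖g (r • ζ)‖ₑ ^ 2) (𝓝[<] 1) (𝓝 (N ζ))) →
      ⨆ r ∈ Ioo (0 : ℝ) 1, Q.hardyIntegral g p f r = ∫⁻ ζ, N ζ ∂Q.σ := by
  set F : ℝ → Cn n → ℝ≥0∞ := fun r ζ => ‖f (Q.Φ (r • ζ))‖ₑ ^ p * ‖g (r • ζ)‖ₑ ^ 2 with hF
  set A : ℝ → Cn n → ℝ≥0∞ := fun r ζ => ∫⁻ θ, ‖f (Q.Φ (circleMap 0 r θ • ζ))‖ₑ ^ p *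
    ‖g (circleMap 0 r θ • ζ)‖ₑ ^ 2 ∂angleMeasure with hA
  have hFm : ∀ r ∈ Ioo (0 : ℝ) 1, AEMeasurable (F r) Q.σ := fun r hr =>
    aemeasurable_integrand hg hf hr
  have hAF : ∀ r ζ, ∫⁻ θ, F r (rot Finset.univ θ ζ) ∂angleMeasure = A r ζ := fun r ζ => by
    simp only [hA, hF, circleMap_smul]
  have hIA : ∀ r ∈ Ioo (0 : ℝ) 1, Q.hardyIntegral g p f r = ∫⁻ ζ, A r ζ ∂Q.σ := fun r hr => by
    rw [hardyIntegral, lintegral_rot Finset.univ (hFm r hr)]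
    simp only [← hAF, hF]
  have hAm : ∀ r ∈ Ioo (0 : ℝ) 1, AEMeasurable (A r) Q.σ := fun r hr => by
    have h1 := (hFm r hr).comp_quasiMeasurePreserving
      (measurePreserving_rot_prod (Q := Q) Finset.univ).quasiMeasurePreserving
    simpa only [Function.comp, hAF] using h1.lintegral_prod_right'
  have hhs : ∀ ζ ∈ Q.Γ, DifferentiableOn ℂ (fun w : ℂ => f (Q.Φ (w • ζ))) (Metric.ball 0 1) :=
    fun ζ hζ => differentiableOn_slice (differentiableOn_comp hf) hζ
  have hgs : ∀ ζ ∈ Q.Γ, DifferentiableOn ℂ (fun w : ℂ => g (w • ζ)) (Metric.ball 0 1) :=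
    fun ζ hζ => differentiableOn_slice hg.holomorphic hζ
  have hg0 : ∀ ζ ∈ Q.Γ, ∀ w ∈ Metric.ball (0 : ℂ) 1, g (w • ζ) ≠ 0 := fun ζ hζ w hw =>
    hg.ne_zero _ (smul_mem_X (by simpa using hw) hζ)
  have hmono : ∀ ζ ∈ Q.Γ, ∀ r R, 0 < r → r ≤ R → R < 1 → A r ζ ≤ A R ζ :=
    fun ζ hζ r R hr hrR hR =>
      weighted_mean_mono (hhs ζ hζ) (hgs ζ hζ) (hg0 ζ hζ) hp hr hrR hR
  -- On each slice the mean increases with `r`, so monotone convergence moves the supremum inside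
  -- the integral with no loss of constants.
  have hsup : ⨆ r ∈ Ioo (0 : ℝ) 1, Q.hardyIntegral g p f r =
      ∫⁻ ζ, ⨆ r ∈ Ioo (0 : ℝ) 1, A r ζ ∂Q.σ := by
    rw [iSup_Ioo_eq_iSup_radius (fun r R hr hrR hR => by
      rw [hIA r ⟨hr, hrR.trans_lt hR⟩, hIA R ⟨hr.trans_le hrR, hR⟩]
      refine lintegral_mono_ae ?_
      filter_upwards [ae_mem_Γ] with ζ hζ using hmono ζ hζ r R hr hrR hR)]
    rw [lintegral_congr_ae (g := fun ζ => ⨆ j, A (radius j) ζ)]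
    · rw [lintegral_iSup' (fun j => hAm _ (radius_mem j))]
      · exact iSup_congr fun j => hIA _ (radius_mem j)
      · filter_upwards [ae_mem_Γ] with ζ hζ
        exact fun i j hij => hmono ζ hζ _ _ (radius_mem i).1 (radius_mono hij) (radius_mem j).2
    · filter_upwards [ae_mem_Γ] with ζ hζ
      exact iSup_Ioo_eq_iSup_radius fun r R hr hrR hR => hmono ζ hζ r R hr hrR hR
  have hfin : ∀ᵐ ζ ∂Q.σ, ⨆ r ∈ Ioo (0 : ℝ) 1, A r ζ ≠ ⊤ := by
    have hm : AEMeasurable (fun ζ => ⨆ r ∈ Ioo (0 : ℝ) 1, A r ζ) Q.σ := by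
      refine (AEMeasurable.iSup fun j => hAm _ (radius_mem j)).congr ?_
      filter_upwards [ae_mem_Γ] with ζ hζ
      exact (iSup_Ioo_eq_iSup_radius fun r R hr hrR hR => hmono ζ hζ r R hr hrR hR).symm
    filter_upwards [ae_lt_top' hm (hsup ▸ hbd)] with ζ hζ using hζ.ne
  have hglim : ∀ᵐ ζ ∂Q.σ, ∀ᵐ θ ∂angleMeasure, ∃ c : ℂ, c ≠ 0 ∧
      Tendsto (fun r : ℝ => g (circleMap 0 r θ • ζ)) (𝓝[<] 1) (𝓝 c) := by
    simpa only [circleMap_smul] using ae_ae_rot Finset.univ (ae_exists_limit_ne_zero hg)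
  refine ⟨?_, fun N hN => ?_⟩
  · have h1 : ∀ᵐ ζ ∂Q.σ, ζ ∈ Q.Γ ∧
        ∃ c, Tendsto (fun r : ℝ => f (Q.Φ (r • ζ))) (𝓝[<] 1) (𝓝 c) := by
      refine ae_of_ae_rot Finset.univ
        (measurableSet_tendsto_radial (differentiableOn_comp hf).continuousOn) ?_
      filter_upwards [hfin, hglim, ae_mem_Γ] with ζ h2 h3 hζ
      filter_upwards [(weighted_iSup_eq (hhs ζ hζ) (hgs ζ hζ) (hg0 ζ hζ) hp h2 h3).1] with θ h4
      refine ⟨(rot_mem_Γ_iff _ θ ζ).2 hζ, ?_⟩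
      simpa only [circleMap_smul] using h4
    exact h1.mono fun ζ h => h.2
  · have hNm : AEMeasurable N Q.σ := by
      refine aemeasurable_of_tendsto_metrizable_ae atTop (fun j => hFm _ (radius_mem j)) ?_
      filter_upwards [hN] with ζ h using h.comp tendsto_radius
    rw [hsup, lintegral_rot Finset.univ hNm]
    refine lintegral_congr_ae ?_
    filter_upwards [hfin, hglim, ae_mem_Γ, ae_ae_rot Finset.univ hN] with ζ h2 h3 hζ h4
    exact (weighted_iSup_eq (hhs ζ hζ) (hgs ζ hζ) (hg0 ζ hζ) hp h2 h3).2 _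
      (by simpa only [circleMap_smul] using h4)

end QuotientQuadruple

/-! ### Descent of boundary values to `Γ_Ω`. -/

/-- A subset of the range with Borel preimage is relatively Borel, because the source is standard
Borel. This gives a Borel factor without a measurable section of `f`. -/
theorem Measurable.exists_eq_comp_of_factorsThrough {α β γ : Type*} [MeasurableSpace α]
    [StandardBorelSpace α] [MeasurableSpace β] [MeasurableSpace γ] [StandardBorelSpace γ]
    [Nonempty γ] {f : α → β} [MeasurableSpace.CountablySeparated (range f)] (hf : Measurable f)
    {u : α → γ} (hu : Measurable u) (h : u.FactorsThrough f) :
    ∃ F : β → γ, Measurable F ∧ u = F ∘ f := by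
  obtain ⟨e, rfl⟩ := (Function.factorsThrough_iff u).1 h
  refine Measurable.exists_eq_measurable_comp (f := f) fun V hV => ?_
  obtain ⟨A, hA, hAV⟩ := (hf.measurableSet_preimage_iff_preimage_val (s := e ⁻¹' V)).1 (hu hV)
  refine ⟨A, hA, ?_⟩
  ext x
  exact Set.ext_iff.1 hAV ⟨f x, x, rfl⟩

theorem MeasureTheory.Measure.AbsolutelyContinuous.map_of_aemeasurable {α β : Type*}
    [MeasurableSpace α] [MeasurableSpace β] {μ ν : Measure α} (h : μ ≪ ν) {f : α → β}
    (hf : AEMeasurable f ν) : μ.map f ≪ ν.map f := by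
  refine Measure.AbsolutelyContinuous.mk fun s hs h0 => ?_
  rw [Measure.map_apply_of_aemeasurable hf hs] at h0
  rw [Measure.map_apply_of_aemeasurable (hf.mono_ac h) hs]
  exact h h0

namespace QuotientQuadruple

variable {n : ℕ} {Q : QuotientQuadruple n} {g : Cn n → ℂ} {p : ℝ} {f : Cn n → ℂ}
  {w : Cn n → ℝ}

theorem aemeasurable_Φ : AEMeasurable Q.Φ Q.σ :=
  (continuousOn_Φ.mono Γ_subset_closure).aemeasurable isClosed_Γ.measurableSet

theorem card_ne_zero : (Nat.card Q.G : ℝ≥0∞) ≠ 0 := by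
  have := Q.finite
  exact_mod_cast Nat.card_pos.ne'

/-- The measure on `Γ_Ω` as the image of a measure with density on `Γ_X`. -/
theorem m_eq_map (hw : Q.IsPullbackDensity w) :
    Q.m = (Nat.card Q.G : ℝ≥0∞)⁻¹ •
      (Q.σ.withDensity fun ζ => ENNReal.ofReal (w ζ)).map Q.Φ := by
  ext E hE
  rw [← hw.change_of_variables E hE, Measure.smul_apply, Measure.map_apply_of_aemeasurable
    (aemeasurable_Φ.mono_ac (withDensity_absolutelyContinuous _ _)) hE, withDensity_apply', smul_eq_mul]
  congr 1
  refine setLIntegral_congr ?_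
  filter_upwards [ae_mem_Γ] with ζ hζ
  exact propext ⟨fun h => h.2, fun h => ⟨hζ, h⟩⟩

theorem lintegral_m (hw : Q.IsPullbackDensity w) {F : Cn n → ℝ≥0∞} (hF : AEMeasurable F Q.m) :
    ∫⁻ y, F y ∂Q.m = (Nat.card Q.G : ℝ≥0∞)⁻¹ *
      ∫⁻ ζ, F (Q.Φ ζ) * ENNReal.ofReal (w ζ) ∂Q.σ := by
  have hwm : Measurable fun ζ => ENNReal.ofReal (w ζ) := hw.measurable.ennreal_ofReal
  have hΦ : AEMeasurable Q.Φ (Q.σ.withDensity fun ζ => ENNReal.ofReal (w ζ)) :=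
    aemeasurable_Φ.mono_ac (withDensity_absolutelyContinuous _ _)
  have hF' : AEMeasurable F ((Q.σ.withDensity fun ζ => ENNReal.ofReal (w ζ)).map Q.Φ) := by
    refine hF.mono_ac ?_
    rw [m_eq_map hw]
    exact Measure.absolutelyContinuous_smul (by simp)
  rw [m_eq_map hw, lintegral_smul_measure, lintegral_map' hF' hΦ, smul_eq_mul,
    lintegral_withDensity_eq_lintegral_mul_non_measurable _ hwm (by simp)]
  simp [mul_comm]

theorem m_absolutelyContinuous (hg : Q.IsAdmissible g) : Q.m ≪ Q.σ.map Q.Φ := by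
  obtain ⟨w, hw, -⟩ := hg.boundary
  rw [m_eq_map hw]
  exact (Measure.smul_absolutelyContinuous).trans
    ((withDensity_absolutelyContinuous _ _).map_of_aemeasurable aemeasurable_Φ)

/-- This is where positivity of `w` enters: null sets of `m` pull back to null sets of `σ`, so
composing an almost everywhere class on `Γ_Ω` with `Φ` makes sense. -/
theorem map_absolutelyContinuous_m (hg : Q.IsAdmissible g) : Q.σ.map Q.Φ ≪ Q.m := by
  obtain ⟨w, hw, -⟩ := hg.boundary
  rw [m_eq_map hw]
  have h0 : ∀ᵐ ζ ∂Q.σ, ENNReal.ofReal (w ζ) ≠ 0 := by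
    filter_upwards [ae_ne_zero_of_isPullbackDensity hw, ae_mem_Γ] with ζ h1 hζ h2
    exact h1 (le_antisymm (ENNReal.ofReal_eq_zero.1 h2) (hw.nonneg ζ hζ))
  refine Measure.AbsolutelyContinuous.trans ?_ (Measure.absolutelyContinuous_smul (by simp))
  exact (withDensity_absolutelyContinuous' hw.measurable.ennreal_ofReal.aemeasurable
    h0).map_of_aemeasurable (aemeasurable_Φ.mono_ac (withDensity_absolutelyContinuous _ _))

theorem ae_comp_of_ae_m (hg : Q.IsAdmissible g) {P : Cn n → Prop} (h : ∀ᵐ y ∂Q.m, P y) :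
    ∀ᵐ ζ ∂Q.σ, P (Q.Φ ζ) :=
  ae_of_ae_map aemeasurable_Φ ((map_absolutelyContinuous_m hg).ae_le h)

theorem ae_eq_of_comp (hg : Q.IsAdmissible g) {F F' : Cn n → ℂ}
    (hF : AEStronglyMeasurable F Q.m) (hF' : AEStronglyMeasurable F' Q.m)
    (h : ∀ᵐ ζ ∂Q.σ, F (Q.Φ ζ) = F' (Q.Φ ζ)) : F =ᵐ[Q.m] F' := by
  have h1 : hF.mk F =ᵐ[Q.m] hF'.mk F' := by
    refine (m_absolutelyContinuous hg).ae_le ((ae_map_iff aemeasurable_Φ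
      (measurableSet_eq_fun hF.stronglyMeasurable_mk.measurable
        hF'.stronglyMeasurable_mk.measurable)).2 ?_)
    filter_upwards [h, ae_comp_of_ae_m hg hF.ae_eq_mk, ae_comp_of_ae_m hg hF'.ae_eq_mk]
      with ζ h2 h3 h4
    rw [← h3, ← h4, h2]
  exact hF.ae_eq_mk.trans (h1.trans hF'.ae_eq_mk.symm)

theorem Φ_smul_eq {τ : Cn n ≃ₗᵢ[ℂ] Cn n} (hτ : τ ∈ Q.G) {ζ : Cn n} (hζ : ζ ∈ Q.Γ) {r : ℝ}
    (hr : r ∈ Ioo (0 : ℝ) 1) : Q.Φ (r • τ ζ) = Q.Φ (r • ζ) := by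
  have h1 := smul_mem hr hζ
  have h2 : τ (r • ζ) = r • τ ζ := by
    rw [← Complex.coe_smul, ← Complex.coe_smul, map_smul]
  rw [← h2]
  exact ((Q.fibre _ h1 _ (Q.G_X τ hτ _ h1)).2 ⟨τ, hτ, rfl⟩).symm

/-- The boundary values of `f ∘ Φ` descend to `Γ_Ω`. -/
theorem exists_boundary_value (hf : DifferentiableOn ℂ f Q.Ω)
    (hlim : ∀ᵐ ζ ∂Q.σ, ∃ c, Tendsto (fun r : ℝ => f (Q.Φ (r • ζ))) (𝓝[<] 1) (𝓝 c)) :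
    ∃ F : Cn n → ℂ, Measurable F ∧ ∀ᵐ ζ ∂Q.σ,
      Tendsto (fun r : ℝ => f (Q.Φ (r • ζ))) (𝓝[<] 1) (𝓝 (F (Q.Φ ζ))) := by
  have hex : ∀ ζ, ∃ c₀, (∃ c, Tendsto (fun r : ℝ => f (Q.Φ (r • ζ))) (𝓝[<] 1) (𝓝 c)) →
      Tendsto (fun r : ℝ => f (Q.Φ (r • ζ))) (𝓝[<] 1) (𝓝 c₀) := fun ζ => by
    by_cases h : ∃ c, Tendsto (fun r : ℝ => f (Q.Φ (r • ζ))) (𝓝[<] 1) (𝓝 c)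
    · exact h.imp fun c hc _ => hc
    · exact ⟨0, fun h' => absurd h' h⟩
  choose u₀ hu₀' using hex
  have hu₀ := hlim.mono hu₀'
  have hfm : ∀ r ∈ Ioo (0 : ℝ) 1, AEMeasurable (fun ζ => f (Q.Φ (r • ζ))) Q.σ := fun r hr =>
    ((differentiableOn_comp hf).continuousOn.comp (by fun_prop)
      fun z hz => smul_mem hr hz).aemeasurable isClosed_Γ.measurableSet
  have hu₀m : AEMeasurable u₀ Q.σ :=
    aemeasurable_of_tendsto_metrizable_ae atTop (fun j => hfm _ (radius_mem j))
      (hu₀.mono fun ζ h => h.comp tendsto_radius)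
  set u := hu₀m.mk u₀
  have hu : ∀ᵐ ζ ∂Q.σ, Tendsto (fun r : ℝ => f (Q.Φ (r • ζ))) (𝓝[<] 1) (𝓝 (u ζ)) := by
    filter_upwards [hu₀, hu₀m.ae_eq_mk] with ζ h1 h2
    rwa [h2] at h1
  -- Off the Borel null set `N`, limits exist and fibres are orbits, so `u` is constant on the
  -- fibres of `Φ` by invariance of `f ∘ Φ`. The complement of `N` is still standard Borel.
  obtain ⟨N, hNsub, hNm, hN0⟩ := exists_measurable_superset_of_null
    (ae_iff.1 (hu.and (Q.boundary_fibre.and (ae_mem_Γ (Q := Q)))))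
  have hgood : ∀ ζ ∈ Nᶜ, Tendsto (fun r : ℝ => f (Q.Φ (r • ζ))) (𝓝[<] 1) (𝓝 (u ζ)) ∧
      (∀ ξ ∈ Q.Γ, Q.Φ ξ = Q.Φ ζ → ∃ τ ∈ Q.G, τ ζ = ξ) ∧ ζ ∈ Q.Γ := fun ζ hζ => by
    by_contra hcon
    exact hζ (hNsub hcon)
  have hstd : StandardBorelSpace (Nᶜ : Set (Cn n)) := hNm.compl.standardBorel
  have hΦm : Measurable fun ζ : (Nᶜ : Set (Cn n)) => Q.Φ ζ :=
    (continuousOn_iff_continuous_domRestrict.1 (continuousOn_Φ.mono fun ζ hζ =>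
      Γ_subset_closure (hgood ζ hζ).2.2)).measurable
  obtain ⟨F, hF, hFu⟩ := hΦm.exists_eq_comp_of_factorsThrough
    (u := fun ζ : (Nᶜ : Set (Cn n)) => u ζ) (hu₀m.measurable_mk.comp measurable_subtype_coe)
    (by
      rintro ⟨ζ, hζ⟩ ⟨ξ, hξ⟩ hζξ
      obtain ⟨τ, hτ, rfl⟩ := (hgood ζ hζ).2.1 ξ (hgood ξ hξ).2.2 hζξ.symm
      refine tendsto_nhds_unique (hgood ζ hζ).1 ((hgood _ hξ).1.congr' ?_)
      filter_upwards [Ioo_mem_nhdsLT (zero_lt_one' ℝ)] with r hr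
      rw [Φ_smul_eq hτ (hgood ζ hζ).2.2 hr])
  refine ⟨F, hF, ?_⟩
  have hNae : ∀ᵐ ζ ∂Q.σ, ζ ∈ Nᶜ := by
    rw [ae_iff]
    simpa using hN0
  filter_upwards [hNae] with ζ hζ
  have := congrFun hFu ⟨ζ, hζ⟩
  simp only [Function.comp] at this
  rw [← this]
  exact (hgood ζ hζ).1

/-- The weighted integrand tends to `|F ∘ Φ|^p w`, whose integral over `Γ_X` is the integral of
`|F|^p` over `Γ_Ω` up to the factor `|G|`, built into both sides. -/
theorem eLpNorm_eq_hardyNorm (hg : Q.IsAdmissible g) (hp : 0 < p)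
    (hf : DifferentiableOn ℂ f Q.Ω) (hbd : Q.hardyNorm g p f < ⊤) {F : Cn n → ℂ}
    (hF : AEStronglyMeasurable F Q.m)
    (hlim : ∀ᵐ ζ ∂Q.σ,
      Tendsto (fun r : ℝ => f (Q.Φ (r • ζ))) (𝓝[<] 1) (𝓝 (F (Q.Φ ζ)))) :
    eLpNorm F (ENNReal.ofReal p) Q.m = Q.hardyNorm g p f := by
  obtain ⟨w, hw, hgw⟩ := hg.boundary
  have h1 := (ae_tendsto_radial_and_iSup_eq hg hp hf
    ((hardyNorm_lt_top_iff hp).1 hbd).ne).2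
    (fun ζ => ‖F (Q.Φ ζ)‖ₑ ^ p * ENNReal.ofReal (w ζ)) (by
      filter_upwards [hlim, hgw] with ζ h2 ⟨c, hc, hcw⟩
      have h3 : ENNReal.ofReal (w ζ) = ‖c‖ₑ ^ 2 := by
        rw [← hcw, ENNReal.ofReal_pow (norm_nonneg _), ofReal_norm]
      rw [h3]
      refine ENNReal.Tendsto.mul ((ENNReal.continuous_rpow_const.tendsto _).comp h2.enorm)
        (Or.inr (by finiteness)) (((ENNReal.continuous_pow 2).tendsto _).comp hc.enorm)
        (Or.inr (by finiteness)))
  rw [hardyNorm, h1, eLpNorm_eq_lintegral_rpow_enorm_toReal (by simpa using hp) (by simp),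
    ENNReal.toReal_ofReal hp.le, lintegral_m hw (hF.enorm.pow_const p)]

end QuotientQuadruple

/-! ### Local bounds for point evaluations. -/

theorem poissonKernel_circleMap_le {w : ℂ} {s : ℝ} (hs : s < 1) (hw : ‖w‖ ≤ s) (θ : ℝ) :
    poissonKernel 0 w (circleMap 0 1 θ) ≤ ((1 - s) ^ 2)⁻¹ := by
  have h1 : ‖circleMap 0 1 θ‖ = 1 := by simp
  have h2 : 1 - s ≤ ‖circleMap 0 1 θ - w‖ := by
    have := norm_sub_norm_le (circleMap 0 1 θ) w
    linarith
  rw [poissonKernel_def]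
  simp only [sub_zero, h1]
  rw [inv_eq_one_div]
  have h3 : 0 < 1 - s := by linarith
  gcongr
  nlinarith [norm_nonneg w]

namespace QuotientQuadruple

variable {n : ℕ} {Q : QuotientQuadruple n} {g : Cn n → ℂ} {p : ℝ} {f : Cn n → ℂ}

theorem enorm_mixPoint_rpow_le {h : Cn n → ℂ} (hh : DifferentiableOn ℂ h Q.X) (hp : 0 < p)
    {r s : ℝ} (hr : r ∈ Ioo (0 : ℝ) 1) (hs : s < 1) {a ζ : Cn n} (hζ : ζ ∈ Q.Γ)
    (hζ0 : ∀ i, ζ i ≠ 0) (ha : ∀ i, ‖a i‖ ≤ s * (r * ‖ζ i‖)) {S : Finset (Fin n)} {j : Fin n}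
    (hj : j ∉ S) :
    ‖h (mixPoint S r a ζ)‖ₑ ^ p ≤ ENNReal.ofReal ((1 - s) ^ 2)⁻¹ *
      ∫⁻ θ, ‖h (mixPoint (insert j S) r a (rot {j} θ ζ))‖ₑ ^ p ∂angleMeasure := by
  have hrζ : ∀ i, 0 < r * ‖ζ i‖ := fun i => mul_pos hr.1 (norm_pos_iff.2 (hζ0 i))
  have ha' : ∀ i, ‖a i‖ ≤ r * ‖ζ i‖ := fun i =>
    (ha i).trans (mul_le_of_le_one_left (hrζ i).le hs.le)
  have hd : ∀ w ∈ Metric.closedBall (0 : ℂ) 1,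
      DifferentiableAt ℂ (fun w => h (mixLine S r a ζ j w)) w := fun w hw =>
    DifferentiableAt.comp w (hh.differentiableAt (Q.isOpen_X.mem_nhds
      (mixLine_mem_X hr hζ ha' (by simpa using hw)))) (differentiable_mixLine S r a ζ j w)
  have hw : ‖a j / (r * ζ j)‖ ≤ s := by
    rw [norm_div, norm_mul, Complex.norm_real, Real.norm_of_nonneg hr.1.le, div_le_iff₀ (hrζ j)]
    exact ha j
  have h1 := enorm_rpow_le_lintegral_poissonKernel one_pos
    (fun w hw => (hd w hw).continuousAt.continuousWithinAt)
    (fun w hw => (hd w (Metric.ball_subset_closedBall hw)).differentiableWithinAt) hp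
    (w := a j / (r * ζ j)) (by rw [mem_ball_zero_iff]; linarith)
  rw [Complex.ofReal_one, one_mul, mixLine_self hr.1.ne' a hj (hζ0 j)] at h1
  refine h1.trans ?_
  rw [← lintegral_const_mul' _ _ ENNReal.ofReal_ne_top]
  refine lintegral_mono fun θ => ?_
  rw [mixLine_circleMap r a ζ hj]
  gcongr
  exact poissonKernel_circleMap_le hs hw θ

/-- The part of `Γ_X` outside the coordinate strips of widths `b i`. -/
def outerPart (b : Fin n → ℝ) : Set (Cn n) := {ζ | ∀ i, b i < ‖ζ i‖}

theorem measurableSet_outerPart (b : Fin n → ℝ) : MeasurableSet (outerPart b) := by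
  rw [outerPart, ofPred_forall]
  exact MeasurableSet.iInter fun i => measurableSet_lt measurable_const (by fun_prop)

theorem rot_mem_outerPart_iff (b : Fin n → ℝ) (S : Finset (Fin n)) (θ : ℝ) (ζ : Cn n) :
    rot S θ ζ ∈ outerPart b ↔ ζ ∈ outerPart b := by
  simp only [outerPart, mem_ofPred_eq, norm_rot_apply]

/-- Each coordinate of `a` is replaced by that of `r ζ` through a one-variable Poisson majorisation,
at the cost of one bounded kernel factor. `outerPart b` is rotation invariant, so the averages can
be absorbed; with all coordinates replaced, the right side is a mean over `r Γ_X`. -/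
theorem setLIntegral_mixPoint_le {h : Cn n → ℂ} (hh : DifferentiableOn ℂ h Q.X) (hp : 0 < p)
    {r s : ℝ} (hr : r ∈ Ioo (0 : ℝ) 1) (hs : s < 1) {b : Fin n → ℝ} (hb : ∀ i, 0 < b i)
    {a : Cn n} (ha : ∀ i, ‖a i‖ ≤ s * (r * b i)) (hs0 : 0 ≤ s) (S : Finset (Fin n)) :
    ‖h a‖ₑ ^ p * Q.σ (outerPart b) ≤ ENNReal.ofReal ((1 - s) ^ 2)⁻¹ ^ S.card *
      ∫⁻ ζ in outerPart b, ‖Q.X.indicator h (mixPoint S r a ζ)‖ₑ ^ p ∂Q.σ := by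
  have hle : ∀ {ζ : Cn n}, ζ ∈ outerPart b → ∀ i, ‖a i‖ ≤ s * (r * ‖ζ i‖) := fun hζ i =>
    (ha i).trans (by
      have := (hζ i).le
      have := hr.1
      gcongr)
  have hle' : ∀ {ζ : Cn n}, ζ ∈ outerPart b → ∀ i, ‖a i‖ ≤ r * ‖ζ i‖ := fun hζ i =>
    (hle hζ i).trans (mul_le_of_le_one_left (mul_nonneg hr.1.le (norm_nonneg _)) hs.le)
  have hB := measurableSet_outerPart b
  have hm : ∀ S, Measurable fun ζ => ‖Q.X.indicator h (mixPoint S r a ζ)‖ₑ ^ p := fun S =>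
    (((measurable_indicator_X hh.continuousOn).comp
      (continuous_mixPoint S r a).measurable).enorm).pow_const p
  induction S using Finset.induction_on with
  | empty =>
    rw [Finset.card_empty, pow_zero, one_mul, ← setLIntegral_const]
    refine lintegral_mono_ae ?_
    filter_upwards [ae_restrict_of_ae (ae_mem_Γ (Q := Q)), ae_restrict_mem hB] with ζ hζ hζb
    have h1 := mixPoint_mem_X (S := ∅) hr hζ (hle' hζb)
    rw [indicator_of_mem h1, mixPoint_empty]
  | insert j S hj ih =>
    refine ih.trans ?_
    rw [Finset.card_insert_of_notMem hj, pow_succ _ S.card, mul_assoc]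
    refine mul_le_mul_right ?_ _
    rw [← lintegral_indicator hB, ← lintegral_indicator hB,
      lintegral_rot {j} ((hm (insert j S)).indicator hB).aemeasurable,
      ← lintegral_const_mul' _ _ ENNReal.ofReal_ne_top]
    refine lintegral_mono_ae ?_
    filter_upwards [ae_mem_Γ] with ζ hζ
    by_cases hζb : ζ ∈ outerPart b
    · have h1 := mixPoint_mem_X (S := S) hr hζ (hle' hζb)
      rw [indicator_of_mem hζb, indicator_of_mem h1]
      refine (enorm_mixPoint_rpow_le hh hp hr hs hζ (fun i h0 => ?_) (hle hζb) hj).trans_eq ?_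
      · have := (hb i).trans (hζb i)
        rw [h0, norm_zero] at this
        exact lt_irrefl _ this
      · congr 1
        refine lintegral_congr fun θ => ?_
        have h2 := (rot_mem_outerPart_iff b {j} θ ζ).2 hζb
        rw [indicator_of_mem h2, indicator_of_mem
          (mixPoint_mem_X hr ((rot_mem_Γ_iff _ θ ζ).2 hζ) (hle' h2))]
    · rw [indicator_of_notMem hζb]
      exact zero_le

/-- Point evaluations are locally uniformly bounded. -/
theorem exists_nhds_enorm_rpow_le (hg : Q.IsAdmissible g) (hp : 0 < p) {z : Cn n}
    (hz : z ∈ Q.X) : ∃ C : ℝ≥0∞, C ≠ ⊤ ∧ ∀ᶠ z' in 𝓝 z, ∀ f : Cn n → ℂ,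
      DifferentiableOn ℂ f Q.Ω →
      ‖f (Q.Φ z')‖ₑ ^ p ≤ C * ⨆ r ∈ Ioo (0 : ℝ) 1, Q.hardyIntegral g p f r := by
  obtain ⟨b, ρ, hρ, hb, hnear, hpos⟩ := exists_polyannulus hz
  -- Any radius strictly between `ρ` and `1` works; `s` is chosen so that `s * r = ρ`, and `s < 1`
  -- keeps the Poisson kernels bounded.
  set r : ℝ := (1 + ρ) / 2 with hrdef
  have hr : r ∈ Ioo (0 : ℝ) 1 := ⟨by linarith [hρ.1], by linarith [hρ.2]⟩
  set s : ℝ := ρ / r with hsdef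
  have hs : s < 1 := (div_lt_one hr.1).2 (by linarith [hρ.2])
  have hs0 : 0 ≤ s := div_nonneg hρ.1.le hr.1.le
  have hsr : s * r = ρ := div_mul_cancel₀ _ hr.1.ne'
  have hK : IsCompact ((fun ζ : Cn n => r • ζ) '' Q.Γ) :=
    ((Q.isBounded_X.isCompact_closure).of_isClosed_subset isClosed_Γ Γ_subset_closure).image
      (by fun_prop)
  have hKX : (fun ζ : Cn n => r • ζ) '' Q.Γ ⊆ Q.X := by
    rintro _ ⟨ζ, hζ, rfl⟩
    exact smul_mem hr hζ
  -- The weight is removed by bounding the zero-free `g` from below on the compact set `r Γ_X`.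
  have hgK : ∃ c : ℝ, 0 < c ∧ ∀ y ∈ (fun ζ : Cn n => r • ζ) '' Q.Γ, c ≤ ‖g y‖ := by
    rcases ((fun ζ : Cn n => r • ζ) '' Q.Γ).eq_empty_or_nonempty with he | hne
    · exact ⟨1, one_pos, by simp [he]⟩
    · obtain ⟨y, hy, hmin⟩ := hK.exists_isMinOn hne (hg.holomorphic.continuousOn.mono hKX).norm
      exact ⟨‖g y‖, norm_pos_iff.2 (hg.ne_zero y (hKX hy)), fun x hx => hmin hx⟩
  obtain ⟨c, hc, hcg⟩ := hgK
  set C₁ : ℝ≥0∞ := ENNReal.ofReal ((1 - s) ^ 2)⁻¹ ^ (Finset.univ : Finset (Fin n)).card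
  set m₀ : ℝ≥0∞ := Q.σ (outerPart b)
  set c₀ : ℝ≥0∞ := ENNReal.ofReal c ^ 2
  have hm₀ : m₀ ≠ 0 := hpos.ne'
  have hm₀' : m₀ ≠ ⊤ := measure_ne_top _ _
  have hc₀ : c₀ ≠ 0 := pow_ne_zero _ (ENNReal.ofReal_pos.2 hc).ne'
  have hc₀' : c₀ ≠ ⊤ := ENNReal.pow_ne_top ENNReal.ofReal_ne_top
  refine ⟨m₀⁻¹ * (C₁ * c₀⁻¹), ENNReal.mul_ne_top (ENNReal.inv_ne_top.2 hm₀) (ENNReal.mul_ne_top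
    (ENNReal.pow_ne_top ENNReal.ofReal_ne_top) (ENNReal.inv_ne_top.2 hc₀)), ?_⟩
  filter_upwards [hnear] with a ha f hf
  have key := setLIntegral_mixPoint_le (Q := Q) (differentiableOn_comp hf) hp hr hs hb (a := a)
    (fun i => by rw [← mul_assoc, hsr]; exact ha i) hs0 Finset.univ
  simp only [mixPoint_univ] at key
  have h1 : ∫⁻ ζ in outerPart b, ‖Q.X.indicator (fun z => f (Q.Φ z)) (r • ζ)‖ₑ ^ p ∂Q.σ ≤
      c₀⁻¹ * Q.hardyIntegral g p f r := by
    rw [hardyIntegral, ← lintegral_const_mul' _ _ (ENNReal.inv_ne_top.2 hc₀)]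
    refine (setLIntegral_le_lintegral _ _).trans (lintegral_mono_ae ?_)
    filter_upwards [ae_mem_Γ] with ζ hζ
    rw [indicator_of_mem (smul_mem hr hζ), mul_left_comm]
    refine le_mul_of_one_le_right' ?_
    have h2 : c₀ ≤ ‖g (r • ζ)‖ₑ ^ 2 := by
      have := hcg _ ⟨ζ, hζ, rfl⟩
      rw [← ofReal_norm]
      exact pow_le_pow_left' (ENNReal.ofReal_le_ofReal this) 2
    calc (1 : ℝ≥0∞) = c₀⁻¹ * c₀ := (ENNReal.inv_mul_cancel hc₀ hc₀').symm
      _ ≤ _ := by gcongr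
  calc ‖f (Q.Φ a)‖ₑ ^ p = m₀⁻¹ * (‖f (Q.Φ a)‖ₑ ^ p * m₀) := by
        rw [mul_comm _ m₀, ← mul_assoc, ENNReal.inv_mul_cancel hm₀ hm₀', one_mul]
    _ ≤ m₀⁻¹ * (C₁ * (c₀⁻¹ * Q.hardyIntegral g p f r)) := by
        exact mul_le_mul_right (key.trans (mul_le_mul_right h1 _)) _
    _ ≤ _ := by
        rw [← mul_assoc C₁, ← mul_assoc m₀⁻¹]
        gcongr
        exact le_iSup₂ (f := fun r (_ : r ∈ Ioo (0 : ℝ) 1) => Q.hardyIntegral g p f r) r hr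

/-- Properness makes the preimage of `K` in `X` compact, and finitely many of the local bounds cover
it. -/
theorem exists_enorm_rpow_le (hg : Q.IsAdmissible g) (hp : 0 < p) {K : Set (Cn n)}
    (hK : IsCompact K) (hKΩ : K ⊆ Q.Ω) : ∃ C : ℝ≥0∞, C ≠ ⊤ ∧ ∀ y ∈ K, ∀ f : Cn n → ℂ,
      DifferentiableOn ℂ f Q.Ω →
      ‖f y‖ₑ ^ p ≤ C * ⨆ r ∈ Ioo (0 : ℝ) 1, Q.hardyIntegral g p f r := by
  have hK' : IsCompact ((↑) ⁻¹' K : Set Q.Ω) :=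
    Topology.IsInducing.subtypeVal.isCompact_preimage_iff (by simpa using hKΩ) |>.2 hK
  have hL := (Q.proper.isCompact_preimage hK').image continuous_subtype_val
  set L : Set (Cn n) := Subtype.val '' (Q.mapsTo.restrict ⁻¹' ((↑) ⁻¹' K))
  have h : ∃ C : ℝ≥0∞, C ≠ ⊤ ∧ ∀ z ∈ L, ∀ f : Cn n → ℂ, DifferentiableOn ℂ f Q.Ω →
      ‖f (Q.Φ z)‖ₑ ^ p ≤ C * ⨆ r ∈ Ioo (0 : ℝ) 1, Q.hardyIntegral g p f r := by
    refine hL.induction_on (p := fun s => ∃ C : ℝ≥0∞, C ≠ ⊤ ∧ ∀ z ∈ s, ∀ f : Cn n → ℂ,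
      DifferentiableOn ℂ f Q.Ω →
      ‖f (Q.Φ z)‖ₑ ^ p ≤ C * ⨆ r ∈ Ioo (0 : ℝ) 1, Q.hardyIntegral g p f r)
      ⟨0, by simp⟩ (fun s t hst ⟨C, hC, h⟩ => ⟨C, hC, fun z hz => h z (hst hz)⟩) ?_ ?_
    · rintro s t ⟨C, hC, h⟩ ⟨D, hD, h'⟩
      refine ⟨C + D, ENNReal.add_ne_top.2 ⟨hC, hD⟩, ?_⟩
      rintro z (hz | hz) f hf
      · exact (h z hz f hf).trans (by gcongr; exact le_self_add)
      · exact (h' z hz f hf).trans (by gcongr; exact le_add_self)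
    · rintro _ ⟨z, -, rfl⟩
      obtain ⟨C, hC, h⟩ := exists_nhds_enorm_rpow_le hg hp z.2
      exact ⟨_, nhdsWithin_le_nhds h, C, hC, fun z hz => hz⟩
  obtain ⟨C, hC, h⟩ := h
  refine ⟨C, hC, fun y hy => ?_⟩
  have hyΩ := hKΩ hy
  rw [← Q.surjective] at hyΩ
  obtain ⟨z, hz, rfl⟩ := hyΩ
  exact h z ⟨⟨z, hz⟩, hy, rfl⟩

end QuotientQuadruple

/-! ### Completeness of the Hardy space. -/

theorem norm_fderiv_le_of_forall_mem_closedBall {E : Type*} [NormedAddCommGroup E]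
    [NormedSpace ℂ E] {f : E → ℂ} {z : E} {δ C : ℝ} (hδ : 0 < δ)
    (hf : ∀ x ∈ Metric.closedBall z δ, DifferentiableAt ℂ f x)
    (hC : ∀ x ∈ Metric.closedBall z δ, ‖f x‖ ≤ C) : ‖fderiv ℂ f z‖ ≤ C / δ := by
  have hC0 : 0 ≤ C := (norm_nonneg _).trans (hC z (Metric.mem_closedBall_self hδ.le))
  refine ContinuousLinearMap.opNorm_le_bound _ (by positivity) fun v => ?_
  rcases eq_or_ne v 0 with rfl | hv
  · simp
  have hv' : 0 < ‖v‖ := norm_pos_iff.2 hv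
  have hR : 0 < δ / ‖v‖ := by positivity
  have hmem : ∀ t ∈ Metric.closedBall (0 : ℂ) (δ / ‖v‖), z + t • v ∈ Metric.closedBall z δ := by
    intro t ht
    rw [mem_closedBall_zero_iff, le_div_iff₀ hv'] at ht
    rwa [mem_closedBall_iff_norm, add_sub_cancel_left, norm_smul]
  have hline : ∀ t : ℂ, HasDerivAt (fun t : ℂ => z + t • v) v t := fun t => by
    simpa using ((hasDerivAt_id t).smul_const v).const_add z
  have hd : ∀ t ∈ Metric.closedBall (0 : ℂ) (δ / ‖v‖),
      HasDerivAt (fun t : ℂ => f (z + t • v)) (fderiv ℂ f (z + t • v) v) t := fun t ht =>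
    (hf _ (hmem t ht)).hasFDerivAt.comp_hasDerivAt t (hline t)
  have h0 := hd 0 (Metric.mem_closedBall_self hR.le)
  rw [zero_smul, add_zero] at h0
  have h1 := Complex.norm_deriv_le_of_forall_mem_sphere_norm_le (f := fun t : ℂ => f (z + t • v))
    (c := 0) (C := C) hR
    (DifferentiableOn.diffContOnCl_ball
      (U := Metric.closedBall 0 (δ / ‖v‖))
      (fun t ht => (hd t ht).differentiableAt.differentiableWithinAt) le_rfl)
    (fun t ht => hC _ (hmem t (Metric.sphere_subset_closedBall ht)))
  rw [h0.deriv] at h1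
  refine h1.trans_eq ?_
  field_simp

/-- Cauchy's estimate on half-balls makes the derivatives uniformly Cauchy as well, so the limit is
differentiable. -/
theorem exists_differentiableOn_limit {E : Type*} [NormedAddCommGroup E] [NormedSpace ℂ E]
    {Ω : Set E} {f : ℕ → E → ℂ} (hf : ∀ k, DifferentiableOn ℂ (f k) Ω)
    (hC : ∀ y ∈ Ω, ∃ δ > 0, Metric.closedBall y δ ⊆ interior Ω ∧ ∃ β : ℕ → ℝ,
      Tendsto β atTop (𝓝 0) ∧
      ∀ k l, k ≤ l → ∀ x ∈ Metric.closedBall y δ, ‖f k x - f l x‖ ≤ β k) :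
    ∃ F : E → ℂ, DifferentiableOn ℂ F Ω ∧ ∀ y ∈ Ω, Tendsto (fun k => f k y) atTop (𝓝 (F y)) := by
  have hlim : ∀ y, ∃ c, y ∈ Ω → Tendsto (fun k => f k y) atTop (𝓝 c) := by
    intro y
    by_cases hy : y ∈ Ω
    · obtain ⟨δ, hδ, -, β, hβ, h⟩ := hC y hy
      obtain ⟨c, hc⟩ := cauchySeq_tendsto_of_complete (cauchySeq_of_le_tendsto_0' (s := fun k => f k y)
        β (fun k l hkl => by
          rw [dist_eq_norm]
          exact h k l hkl y (Metric.mem_closedBall_self hδ.le)) hβ)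
      exact ⟨c, fun _ => hc⟩
    · exact ⟨0, fun h => absurd h hy⟩
  choose F hF using hlim
  refine ⟨F, fun y hy => ?_, hF⟩
  obtain ⟨δ, hδ, hδΩ, β, hβ, h⟩ := hC y hy
  have hda : ∀ k, ∀ x ∈ Metric.closedBall y δ, DifferentiableAt ℂ (f k) x := fun k x hx =>
    (hf k).differentiableAt (mem_interior_iff_mem_nhds.1 (hδΩ hx))
  have hsub : ∀ x ∈ Metric.ball y (δ / 2),
      Metric.closedBall x (δ / 2) ⊆ Metric.closedBall y δ := fun x hx =>
    Metric.closedBall_subset_closedBall' (by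
      rw [Metric.mem_ball] at hx
      linarith)
  have hder : ∀ k l, k ≤ l → ∀ x ∈ Metric.ball y (δ / 2),
      dist (fderiv ℂ (f k) x) (fderiv ℂ (f l) x) ≤ β k / (δ / 2) := by
    intro k l hkl x hx
    have hxm := hsub x hx (Metric.mem_closedBall_self (by positivity))
    rw [dist_eq_norm, ← fderiv_fun_sub (hda k x hxm) (hda l x hxm)]
    exact norm_fderiv_le_of_forall_mem_closedBall (half_pos hδ)
      (fun z hz => (hda k z (hsub x hx hz)).sub (hda l z (hsub x hx hz)))
      fun z hz => h k l hkl z (hsub x hx hz)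
  have hβ' : Tendsto (fun k => β k / (δ / 2)) atTop (𝓝 0) := by
    simpa using hβ.div_const (δ / 2)
  have hlim' : ∀ x, ∃ L, x ∈ Metric.ball y (δ / 2) →
      Tendsto (fun k => fderiv ℂ (f k) x) atTop (𝓝 L) := by
    intro x
    by_cases hx : x ∈ Metric.ball y (δ / 2)
    · obtain ⟨c, hc⟩ := cauchySeq_tendsto_of_complete
        (cauchySeq_of_le_tendsto_0' _ (fun k l hkl => hder k l hkl x hx) hβ')
      exact ⟨c, fun _ => hc⟩
    · exact ⟨0, fun h => absurd h hx⟩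
  choose L hL using hlim'
  have hunif : TendstoUniformlyOn (fun k x => fderiv ℂ (f k) x) L atTop
      (Metric.ball y (δ / 2)) := by
    rw [Metric.tendstoUniformlyOn_iff]
    intro ε hε
    filter_upwards [hβ'.eventually (gt_mem_nhds hε)] with k hk x hx
    rw [dist_comm]
    refine lt_of_le_of_lt (le_of_tendsto (tendsto_const_nhds.dist (hL x hx)) ?_) hk
    filter_upwards [eventually_ge_atTop k] with l hl using hder k l hl x hx
  have hself : ∀ x ∈ Metric.ball y (δ / 2), x ∈ Metric.closedBall y δ := fun x hx =>
    hsub x hx (Metric.mem_closedBall_self (by positivity))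
  exact (hasFDerivAt_of_tendstoUniformlyOn Metric.isOpen_ball hunif
    (fun k x hx => (hda k x (hself x hx)).hasFDerivAt)
    (fun x hx => hF x (interior_subset (hδΩ (hself x hx))))
    (Metric.mem_ball_self (half_pos hδ))).differentiableAt.differentiableWithinAt

namespace QuotientQuadruple

variable {n : ℕ} {Q : QuotientQuadruple n} {g : Cn n → ℂ} {p : ℝ}

theorem iSup_hardyIntegral_eq (hp : 0 < p) (f : Cn n → ℂ) :
    ⨆ r ∈ Ioo (0 : ℝ) 1, Q.hardyIntegral g p f r = Nat.card Q.G * Q.hardyNorm g p f ^ p := by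
  rw [hardyNorm, ← ENNReal.rpow_mul, one_div_mul_cancel hp.ne', ENNReal.rpow_one, ← mul_assoc,
    ENNReal.mul_inv_cancel card_ne_zero (by simp), one_mul]

theorem hardyNorm_le_iff (hp : 0 < p) {f : Cn n → ℂ} {η : ℝ≥0∞} : Q.hardyNorm g p f ≤ η ↔
    ∀ r ∈ Ioo (0 : ℝ) 1, Q.hardyIntegral g p f r ≤ Nat.card Q.G * η ^ p := by
  rw [← iSup₂_le_iff (f := fun r (_ : r ∈ Ioo (0 : ℝ) 1) => Q.hardyIntegral g p f r),
    iSup_hardyIntegral_eq hp, ENNReal.mul_le_mul_iff_right card_ne_zero (by simp),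
    ENNReal.rpow_le_rpow_iff hp]

/-- Completeness of the Hardy space. -/
theorem exists_hardySpace_limit (hg : Q.IsAdmissible g) (hp : 0 < p)
    (f : ℕ → Q.hardySpace hg hp) {η : ℕ → ℝ≥0∞} (hη : Tendsto η atTop (𝓝 0))
    (hη' : ∀ k, η k ≠ ⊤)
    (hf : ∀ k l, k ≤ l → Q.hardyNorm g p (f k - f l : Q.hardySpace hg hp) ≤ η k) :
    ∃ F : Q.hardySpace hg hp, ∀ k, Q.hardyNorm g p (f k - F : Q.hardySpace hg hp) ≤ η k := by
  have hfd : ∀ k, DifferentiableOn ℂ (f k : Cn n → ℂ) Q.Ω := fun k => (f k).2.1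
  obtain ⟨F, hF, hFlim⟩ := exists_differentiableOn_limit hfd (fun y hy => by
    obtain ⟨δ, hδ, hδΩ⟩ := Metric.nhds_basis_closedBall.mem_iff.1 (Q.isOpen_Ω.mem_nhds hy)
    obtain ⟨C, hC, hCb⟩ := exists_enorm_rpow_le hg hp (isCompact_closedBall y δ) hδΩ
    set B : ℕ → ℝ≥0∞ := fun k => (C * (Nat.card Q.G * η k ^ p)) ^ (1 / p) with hB
    have hB0 : Tendsto B atTop (𝓝 0) := by
      have h1 : Tendsto (fun k => C * (Nat.card Q.G * η k ^ p)) atTop (𝓝 0) := by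
        have h2 := (ENNReal.continuous_rpow_const (y := p)).tendsto 0 |>.comp hη
        rw [ENNReal.zero_rpow_of_pos hp] at h2
        have h3 := ENNReal.Tendsto.const_mul h2 (a := C * Nat.card Q.G)
          (Or.inr (ENNReal.mul_ne_top hC (by simp)))
        rw [mul_zero] at h3
        simpa only [mul_assoc, Function.comp] using h3
      have h4 := (ENNReal.continuous_rpow_const (y := 1 / p)).tendsto 0 |>.comp h1
      rwa [ENNReal.zero_rpow_of_pos (by positivity)] at h4
    have hbound : ∀ k l, k ≤ l → ∀ x ∈ Metric.closedBall y δ,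
        ‖(f k : Cn n → ℂ) x - (f l : Cn n → ℂ) x‖ₑ ≤ B k := by
      intro k l hkl x hx
      have h1 := hCb x hx (f k - f l : Q.hardySpace hg hp) (f k - f l).2.1
      rw [iSup_hardyIntegral_eq hp] at h1
      have h2 : ‖(f k : Cn n → ℂ) x - (f l : Cn n → ℂ) x‖ₑ ^ p ≤ C * (Nat.card Q.G * η k ^ p) :=
        h1.trans (by gcongr; exact hf k l hkl)
      rw [hB]
      simpa only [one_div, ← ENNReal.rpow_mul, mul_inv_cancel₀ hp.ne', ENNReal.rpow_one] using
        ENNReal.rpow_le_rpow h2 (by positivity : (0 : ℝ) ≤ 1 / p)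
    have hBt : ∀ k, B k ≠ ⊤ := fun k => ENNReal.rpow_ne_top_of_nonneg (by positivity)
      (ENNReal.mul_ne_top hC (ENNReal.mul_ne_top (by simp)
        (ENNReal.rpow_ne_top_of_nonneg hp.le (hη' k))))
    refine ⟨δ, hδ, by rwa [Q.isOpen_Ω.interior_eq], fun k => (B k).toReal,
      (ENNReal.tendsto_toReal ENNReal.zero_ne_top).comp hB0, fun k l hkl x hx => ?_⟩
    rw [← toReal_enorm]
    exact ENNReal.toReal_mono (hBt k) (hbound k l hkl x hx))
  -- The limit is controlled only on `Ω`; elements of the Hardy space vanish elsewhere.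
  set F₀ : Cn n → ℂ := Q.Ω.indicator F with hF₀
  have hF₀d : DifferentiableOn ℂ F₀ Q.Ω := hF.congr fun y hy => indicator_of_mem hy F
  have hdiff : ∀ k, Q.hardyNorm g p ((f k : Cn n → ℂ) - F₀) ≤ η k := by
    intro k
    rw [hardyNorm_le_iff hp]
    intro r hr
    -- For fixed `r`, pointwise convergence on `Ω` and Fatou's lemma pass the bound to the limit in
    -- `l`.
    have hconv : ∀ᵐ z ∂Q.σ, ‖((f k : Cn n → ℂ) - F₀) (Q.Φ (r • z))‖ₑ ^ p * ‖g (r • z)‖ₑ ^ 2 =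
        liminf (fun l => ‖((f k : Cn n → ℂ) - (f l : Cn n → ℂ)) (Q.Φ (r • z))‖ₑ ^ p *
          ‖g (r • z)‖ₑ ^ 2) atTop := by
      filter_upwards [ae_mem_Γ] with z hz
      have hy : Q.Φ (r • z) ∈ Q.Ω := Q.mapsTo (smul_mem hr hz)
      refine (Tendsto.liminf_eq ?_).symm
      refine ENNReal.Tendsto.mul_const ?_ (Or.inr (by finiteness))
      refine (ENNReal.continuous_rpow_const.tendsto _).comp (Tendsto.enorm ?_)
      simp only [Pi.sub_apply, hF₀, indicator_of_mem hy]
      exact tendsto_const_nhds.sub (hFlim _ hy)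
    rw [hardyIntegral, lintegral_congr_ae hconv]
    refine (lintegral_liminf_le' fun l =>
      aemeasurable_integrand hg ((hfd k).sub (hfd l)) hr).trans ?_
    refine liminf_le_of_le (by isBoundedDefault) fun b hb => ?_
    obtain ⟨l, hl, hkl⟩ := (hb.and (eventually_ge_atTop k)).exists
    exact hl.trans ((hardyNorm_le_iff hp).1 (hf k l hkl) r hr)
  have hmem : ∀ k, (f k : Cn n → ℂ) - F₀ ∈ Q.hardySpace hg hp := fun k =>
    ⟨(hfd k).sub hF₀d, fun z hz => by
      rw [Pi.sub_apply, (f k).2.2.1 z hz, hF₀, indicator_of_notMem hz, sub_zero],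
      (hdiff k).trans_lt (hη' k).lt_top⟩
  have hF₀m : F₀ ∈ Q.hardySpace hg hp := by
    have := Submodule.sub_mem _ (f 0).2 (hmem 0)
    rwa [sub_sub_cancel] at this
  exact ⟨⟨F₀, hF₀m⟩, hdiff⟩

end QuotientQuadruple

/-! ### The boundary map and the closedness of its image. -/

namespace QuotientQuadruple

variable {n : ℕ} {Q : QuotientQuadruple n} {g : Cn n → ℂ} {p : ℝ} (hg : Q.IsAdmissible g)
  (hp : 0 < p)

/-- `F` is the boundary function of `f`: radial limits of `f ∘ Φ` are almost everywhere the values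
of `F ∘ Φ`. -/
def IsBoundaryValue (Q : QuotientQuadruple n) (f F : Cn n → ℂ) : Prop :=
  ∀ᵐ ζ ∂Q.σ, Tendsto (fun r : ℝ => f (Q.Φ (r • ζ))) (𝓝[<] 1) (𝓝 (F (Q.Φ ζ)))

theorem IsBoundaryValue.congr (hg : Q.IsAdmissible g) {f F F' : Cn n → ℂ} (h : Q.IsBoundaryValue f F)
    (hF : F =ᵐ[Q.m] F') : Q.IsBoundaryValue f F' := by
  filter_upwards [h, ae_comp_of_ae_m hg hF] with ζ h1 h2
  rwa [← h2]

theorem IsBoundaryValue.ae_eq (hg : Q.IsAdmissible g) {f F F' : Cn n → ℂ} (h : Q.IsBoundaryValue f F)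
    (h' : Q.IsBoundaryValue f F') (hF : AEStronglyMeasurable F Q.m)
    (hF' : AEStronglyMeasurable F' Q.m) : F =ᵐ[Q.m] F' :=
  ae_eq_of_comp hg hF hF' (by
    filter_upwards [h, h'] with ζ h1 h2 using tendsto_nhds_unique h1 h2)

theorem exists_boundaryLp (f : Q.hardySpace hg hp) :
    ∃ F : Lp ℂ (ENNReal.ofReal p) Q.m, Q.IsBoundaryValue f F := by
  obtain ⟨F, hF, hlim⟩ := exists_boundary_value f.2.1 (ae_tendsto_radial_and_iSup_eq hg hp f.2.1
    ((hardyNorm_lt_top_iff hp).1 f.2.2.2).ne).1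
  have hF' := hF.aestronglyMeasurable (μ := Q.m)
  have hLp : MemLp F (ENNReal.ofReal p) Q.m :=
    ⟨hF', by rw [eLpNorm_eq_hardyNorm hg hp f.2.1 f.2.2.2 hF' hlim]; exact f.2.2.2⟩
  exact ⟨hLp.toLp F, IsBoundaryValue.congr hg hlim hLp.coeFn_toLp.symm⟩

/-- The boundary map `f ↦ f*`. -/
noncomputable def boundaryMap : Q.hardySpace hg hp →ₗ[ℂ] Lp ℂ (ENNReal.ofReal p) Q.m where
  -- The choice is immaterial: boundary values are unique `m`-almost everywhere, which also yields
  -- linearity.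
  toFun f := (exists_boundaryLp hg hp f).choose
  map_add' a b := by
    have hsum := (exists_boundaryLp hg hp (a + b)).choose_spec
    refine Lp.ext (IsBoundaryValue.ae_eq hg hsum (IsBoundaryValue.congr hg ?_
      (Lp.coeFn_add _ _).symm) (Lp.aestronglyMeasurable _) (Lp.aestronglyMeasurable _))
    filter_upwards [(exists_boundaryLp hg hp a).choose_spec,
      (exists_boundaryLp hg hp b).choose_spec] with ζ h1 h2 using h1.add h2
  map_smul' c a := by
    have hsmul := (exists_boundaryLp hg hp (c • a)).choose_spec
    refine Lp.ext (IsBoundaryValue.ae_eq hg hsmul (IsBoundaryValue.congr hg ?_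
      (Lp.coeFn_smul c _).symm) (Lp.aestronglyMeasurable _) (Lp.aestronglyMeasurable _))
    filter_upwards [(exists_boundaryLp hg hp a).choose_spec] with ζ h1 using h1.const_smul c

theorem isBoundaryValue_boundaryMap (f : Q.hardySpace hg hp) :
    Q.IsBoundaryValue f (boundaryMap hg hp f) :=
  (exists_boundaryLp hg hp f).choose_spec

theorem eLpNorm_boundaryMap (f : Q.hardySpace hg hp) :
    eLpNorm (boundaryMap hg hp f) (ENNReal.ofReal p) Q.m = Q.hardyNorm g p f :=
  eLpNorm_eq_hardyNorm hg hp f.2.1 f.2.2.2 (Lp.aestronglyMeasurable _)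
    (isBoundaryValue_boundaryMap hg hp f)

/-- Approximants of `F` form a Cauchy sequence in the Hardy norm because the boundary map is
isometric, and their limit is a preimage. For `p < 1` the triangle inequality holds only up to the
constant `c`. -/
theorem mem_range_boundaryMap {F : Lp ℂ (ENNReal.ofReal p) Q.m}
    (hF : ∀ ε : ℝ≥0∞, 0 < ε → ∃ f : Q.hardySpace hg hp,
      eLpNorm (F - boundaryMap hg hp f : Lp ℂ (ENNReal.ofReal p) Q.m) (ENNReal.ofReal p) Q.m < ε) :
    F ∈ LinearMap.range (boundaryMap hg hp) := by
  set T := boundaryMap hg hp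
  set c := ENNReal.LpAddConst (ENNReal.ofReal p)
  have hc : c ≠ ⊤ := (ENNReal.LpAddConst_lt_top (ENNReal.ofReal p)).ne
  have hneg : ∀ A B : Lp ℂ (ENNReal.ofReal p) Q.m,
      eLpNorm (A - B : Lp ℂ (ENNReal.ofReal p) Q.m) (ENNReal.ofReal p) Q.m = eLpNorm (B - A : Lp ℂ (ENNReal.ofReal p) Q.m) (ENNReal.ofReal p) Q.m := fun A B => by
    rw [← neg_sub B A, eLpNorm_congr_ae (Lp.coeFn_neg (B - A)), eLpNorm_neg]
  have htri : ∀ A B D : Lp ℂ (ENNReal.ofReal p) Q.m, eLpNorm (A - D : Lp ℂ (ENNReal.ofReal p) Q.m) (ENNReal.ofReal p) Q.m ≤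
      c * (eLpNorm (A - B : Lp ℂ (ENNReal.ofReal p) Q.m) (ENNReal.ofReal p) Q.m + eLpNorm (B - D : Lp ℂ (ENNReal.ofReal p) Q.m) (ENNReal.ofReal p) Q.m) := by
    intro A B D
    rw [← sub_add_sub_cancel A B D, eLpNorm_congr_ae (Lp.coeFn_add (A - B) (B - D))]
    exact eLpNorm_add_le' (Lp.aestronglyMeasurable _) (Lp.aestronglyMeasurable _) (ENNReal.ofReal p)
  set δ : ℕ → ℝ≥0∞ := fun k => ((k : ℝ≥0∞) + 1)⁻¹ with hδ
  have hδ0 : Tendsto δ atTop (𝓝 0) := by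
    have := (tendsto_add_atTop_iff_nat 1).2 ENNReal.tendsto_inv_nat_nhds_zero
    simpa using this
  have hδt : ∀ k, δ k ≠ ⊤ := fun k => ENNReal.inv_ne_top.2 (by simp)
  choose f hf using fun k => hF (δ k) (ENNReal.inv_pos.2 (by simp))
  -- For `k ≤ l`, comparison of both approximants with `F` gives `c (δ k + δ l) ≤ η k`.
  set η : ℕ → ℝ≥0∞ := fun k => c * (2 * δ k)
  have hη0 : Tendsto η atTop (𝓝 0) := by
    have h1 := ENNReal.Tendsto.const_mul (a := c * 2) hδ0
      (Or.inr (ENNReal.mul_ne_top hc (by simp)))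
    simpa only [mul_zero, mul_assoc] using h1
  have hηt : ∀ k, η k ≠ ⊤ := fun k =>
    ENNReal.mul_ne_top hc (ENNReal.mul_ne_top (by simp) (hδt k))
  obtain ⟨f₀, hf₀⟩ := exists_hardySpace_limit hg hp f hη0 hηt (fun k l hkl => by
    rw [← eLpNorm_boundaryMap, map_sub]
    refine (htri _ F _).trans ?_
    have hle : δ l ≤ δ k := ENNReal.inv_le_inv.2 (by gcongr)
    rw [hneg]
    simp only [η, two_mul]
    gcongr
    · exact (hf k).le
    · exact (hf l).le.trans hle)
  have hlim : Tendsto (fun k => c * (δ k + η k)) atTop (𝓝 0) := by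
    have h1 := ENNReal.Tendsto.const_mul (a := c) (hδ0.add hη0) (Or.inr hc)
    simpa using h1
  have hzero : eLpNorm (F - T f₀ : Lp ℂ (ENNReal.ofReal p) Q.m) (ENNReal.ofReal p) Q.m = 0 := by
    refine nonpos_iff_eq_zero.1 (ge_of_tendsto hlim (Eventually.of_forall fun k => ?_))
    refine (htri _ (T (f k)) _).trans ?_
    gcongr
    · exact (hf k).le
    · rw [← map_sub, eLpNorm_boundaryMap]
      exact hf₀ k
  have hq : (ENNReal.ofReal p) ≠ 0 := by simpa using hp
  have h0 := (eLpNorm_eq_zero_iff (Lp.aestronglyMeasurable _) hq).1 hzero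
  refine ⟨f₀, (sub_eq_zero.1 (Lp.ext (h0.trans (Lp.coeFn_zero _ _ _).symm))).symm⟩

end QuotientQuadruple

theorem mainTheorem9 {n : ℕ} (Q : QuotientQuadruple n) {g : Cn n → ℂ} (hg : Q.IsAdmissible g)
    {p : ℝ} (hp : 0 < p) :
    -- the boundary limit `(f ∘ Φ)*` exists almost everywhere on `Γ_X`
    (∀ f ∈ Q.hardySpace hg hp, ∀ᵐ ζ ∂Q.σ, ∃ c : ℂ,
      Tendsto (fun r : ℝ => f (Q.Φ (r • ζ))) (𝓝[<] 1) (𝓝 c)) ∧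
    -- the map `T : f ↦ f*` into `L^p(Γ_Ω)`
    ∃ T : Q.hardySpace hg hp →ₗ[ℂ] Lp ℂ (ENNReal.ofReal p) Q.m,
      -- `T f` is the unique (class of a) function `f*` on `Γ_Ω` with `f* ∘ Φ = (f ∘ Φ)*`
      (∀ (f : Q.hardySpace hg hp) (F : Cn n →ₘ[Q.m] ℂ),
        (∀ᵐ ζ ∂Q.σ, Tendsto (fun r : ℝ => (f : Cn n → ℂ) (Q.Φ (r • ζ))) (𝓝[<] 1)
          (𝓝 (F (Q.Φ ζ)))) ↔ F = T f) ∧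
      -- quasi-isometry
      (∃ C : ℝ≥0, ∀ f : Q.hardySpace hg hp,
        eLpNorm (T f) (ENNReal.ofReal p) Q.m ≤ C * Q.hardyNorm g p f ∧
        Q.hardyNorm g p f ≤ C * eLpNorm (T f) (ENNReal.ofReal p) Q.m) ∧
      -- the image is closed in `L^p(Γ_Ω)`
      (∀ F : Lp ℂ (ENNReal.ofReal p) Q.m,
        (∀ ε : ℝ≥0∞, 0 < ε → ∃ f : Q.hardySpace hg hp,
          eLpNorm (F - T f : Lp ℂ (ENNReal.ofReal p) Q.m) (ENNReal.ofReal p) Q.m < ε) →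
        F ∈ LinearMap.range T) ∧
      -- isometry for the polydisc and the ball
      (Q.X = polydisc n ∨ Q.X = Metric.ball 0 1 → ∀ f : Q.hardySpace hg hp,
        eLpNorm (T f) (ENNReal.ofReal p) Q.m = Q.hardyNorm g p f) := by
  -- The quasi-isometry constant is `1`, since the norm identity is exact.
  refine ⟨fun f hf => (QuotientQuadruple.ae_tendsto_radial_and_iSup_eq hg hp hf.1
    ((QuotientQuadruple.hardyNorm_lt_top_iff hp).1 hf.2.2).ne).1,
    QuotientQuadruple.boundaryMap hg hp, fun f F => ⟨fun h => ?_, ?_⟩, ⟨1, fun f => ?_⟩,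
    fun F hF => QuotientQuadruple.mem_range_boundaryMap hg hp hF,
    fun _ f => QuotientQuadruple.eLpNorm_boundaryMap hg hp f⟩
  · exact AEEqFun.ext (QuotientQuadruple.IsBoundaryValue.ae_eq hg h
      (QuotientQuadruple.isBoundaryValue_boundaryMap hg hp f) F.aestronglyMeasurable
      (Lp.aestronglyMeasurable _))
  · rintro rfl
    exact QuotientQuadruple.isBoundaryValue_boundaryMap hg hp f
  · rw [QuotientQuadruple.eLpNorm_boundaryMap, ENNReal.coe_one, one_mul]
    exact ⟨le_rfl, le_rfl⟩
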